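/- Let $G$ be an affine algebraic group over $\mathbb{C}$ with Lie algebra $\mathfrak{g}$, let $(\cdot,\cdot)_{\mathfrak g}$ be a nondegenerate symmetric invariant bilinear form on $\mathfrak g$, and let $\omega$ be an algebraic group involution of $G$ whose differential (also denoted $\omega$) preserves this form. Let $G_1[\![z^{-1}]\!]$ be the affine group scheme over $\mathbb{C}$ with $R$-points $\ker\big(G(R[\![z^{-1}]\!])\xrightarrow{z^{-1}\mapsto 0}G(R)\big)$ for commutative $\mathbb{C}$-algebras $R$. Its coordinate ring is generated by the elements $a^{(n)}$ ($a\in\mathbb{C}[G]$, $n\ge 0$), where $a(g)=\sum_{n\ge0}a^{(n)}(g)z^{-n}$, and it is graded by $\deg a^{(n)}=n$. Equip $G_1[\![z^{-1}]\!]$ with the Poisson structure attached to the Manin triple $\big(\mathfrak g(\!(z^{-1})\!),\,z^{-1}\mathfrak g[\![z^{-1}]\!],\,\mathfrak g[z]\big)$ with form $(X,Y)=-\operatorname{Res}_{z=0}(X(z),Y(z))_{\mathfrak g}$: there is exactly one Poisson bracket on $\mathbb{C}[G_1[\![z^{-1}]\!]]$ for which multiplication $G_1[\![z^{-1}]\!]\times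 G_1[\![z^{-1}]\!]\to G_1[\![z^{-1}]\!]$ is Poisson and whose linearization at the identity $e$ is the Lie bracket of $\mathfrak g[z]$, that is, $d_e\{f,h\}=[d_ef,d_eh]$, where the differentials at $e$ are viewed as elements of $\mathfrak g[z]$ through the form. Extend $\omega$ to the involution of $G_1[\![z^{-1}]\!]$ which applies $\omega$ and substitutes $z\mapsto -z$, and set $\sigma(g)=\omega(g)^{-1}$. Let $G_1[\![z^{-1}]\!]^\omega$ (a closed subgroup scheme) and $G_1[\![z^{-1}]\!]^\sigma$ (a closed subscheme) be the fixed-point schemes. The Dirac reduction is the well-defined bracket on $\mathbb{C}[G_1[\![z^{-1}]\!]^\sigma]$ given as follows: the bracket of two functions is the restriction of the bracket of any $\sigma$-invariant extensions of them to $G_1[\![z^{-1}]\!]$. Equip $G_1[\![z^{-1}]\!]^\sigma$ with twice this bracket, and with the grading induced from $\mathbb{C}[G_1[\![z^{-1}]\!]]$. Then: 1. Group multiplication is an isomorphism of affine schemes $$G_1[\![z^{-1}]\!]^\sigma\times G_1[\![z^{-1}]\!]^\omega\xrightarrow{\ \sim\ }G_1[\![z^{-1}]\!].$$ 2. The doubled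 Dirac bracket is a Poisson bracket, and $g\cdot p=g\,p\,\sigma(g)=g\,p\,\omega(g)^{-1}$ defines a Poisson action of $G_1[\![z^{-1}]\!]$ on $G_1[\![z^{-1}]\!]^\sigma$ (the action map $G_1[\![z^{-1}]\!]\times G_1[\![z^{-1}]\!]^\sigma\to G_1[\![z^{-1}]\!]^\sigma$ is Poisson). This action is transitive: $G_1[\![z^{-1}]\!](R)$ acts transitively on $G_1[\![z^{-1}]\!]^\sigma(R)$ for every commutative $\mathbb{C}$-algebra $R$. 3. There is an induced isomorphism of Poisson homogeneous spaces $$G_1[\![z^{-1}]\!]/G_1[\![z^{-1}]\!]^\omega\xrightarrow{\ \sim\ }G_1[\![z^{-1}]\!]^\sigma,\qquad [g]\mapsto g\cdot e=g\,\sigma(g).$$ Explicitly, on $R$-points this map is bijective and $G_1[\![z^{-1}]\!](R)$-equivariant for every commutative $\mathbb{C}$-algebra $R$. The algebra of invariants $\mathbb{C}\big[G_1[\![z^{-1}]\!]\big]^{G_1[\![z^{-1}]\!]^\omega}$ for right translation is closed under the Poisson bracket, the algebras $\mathbb{C}\big[G_1[\![z^{-1}]\!]\big]$ and $\mathbb{C}\big[G_1[\![z^{-1}]\!]^\sigma\big]$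 are graded algebras with Poisson brackets of degree $-1$, and pullback along $g\mapsto g\,\sigma(g)$ is an isomorphism $$\mathbb{C}\big[G_1[\![z^{-1}]\!]^\sigma\big]\xrightarrow{\ \sim\ }\mathbb{C}\big[G_1[\![z^{-1}]\!]\big]^{G_1[\![z^{-1}]\!]^\omega}$$ of graded Poisson algebras, compatible with the left coactions of $\mathbb{C}\big[G_1[\![z^{-1}]\!]\big]$. -/

import Mathlib

open scoped TensorProduct PowerSeries

universe u v w

noncomputable section

namespace LoopSym



/-! ### The Lie algebra of an affine algebraic group

An affine algebraic group `G` over `ℂ` is given by its coordinate ring `A = ℂ[G]`, a commutative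
Hopf algebra over `ℂ` of finite type. -/

section LieAlg

variable (A : Type u) [CommRing A] [HopfAlgebra ℂ A]

/-- The commutator bracket of the convolution algebra `A* = Hom(A, ℂ)`. -/
instance convLieRing : LieRing (WithConv (A →ₗ[ℂ] ℂ)) := LieRing.ofAssociativeRing

variable {A}

/-- `f ⊗ g` as a functional on `A ⊗ A`. -/
abbrev tens (f g : A →ₗ[ℂ] ℂ) : A ⊗[ℂ] A →ₗ[ℂ] ℂ :=
  LinearMap.mul' ℂ ℂ ∘ₗ TensorProduct.map f g

theorem tens_mul (e x y : A →ₗ[ℂ] ℂ)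
    (hx : ∀ a b, x (a * b) = e a * x b + x a * e b)
    (hy : ∀ a b, y (a * b) = e a * y b + y a * e b) (s t : A ⊗[ℂ] A) :
    tens x y (s * t) = tens e e s * tens x y t + tens e y s * tens x e t
      + tens x e s * tens e y t + tens x y s * tens e e t := by
  induction s with
  | zero => simp
  | add s s' h h' => rw [add_mul, map_add, h, h']; simp only [map_add]; ring
  | tmul a b =>
    induction t with
    | zero => simp
    | add t t' h h' => rw [mul_add, map_add, h, h']; simp only [map_add]; ring
    | tmul c d => simp [tens, hx, hy]; ring

theorem conv_mul_apply (x y : WithConv (A →ₗ[ℂ] ℂ))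
    (hx : ∀ a b : A, x.ofConv (a * b) =
      Coalgebra.counit (R := ℂ) a * x.ofConv b + x.ofConv a * Coalgebra.counit (R := ℂ) b)
    (hy : ∀ a b : A, y.ofConv (a * b) =
      Coalgebra.counit (R := ℂ) a * y.ofConv b + y.ofConv a * Coalgebra.counit (R := ℂ) b)
    (a b : A) :
    (x * y).ofConv (a * b) = Coalgebra.counit (R := ℂ) a * (x * y).ofConv b
      + y.ofConv a * x.ofConv b + x.ofConv a * y.ofConv b
      + (x * y).ofConv a * Coalgebra.counit (R := ℂ) b := by
  have key : ∀ (f g : WithConv (A →ₗ[ℂ] ℂ)) (c : A),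
      (f * g).ofConv c = tens f.ofConv g.ofConv (Coalgebra.comul (R := ℂ) c) := fun _ _ _ => rfl
  have h1 : (WithConv.toConv (Coalgebra.counit (R := ℂ) (A := A))) = 1 := rfl
  have hee := key 1 1
  have hex := key 1
  have hxe := fun f => key f 1
  rw [key, Bialgebra.comul_mul, tens_mul (Coalgebra.counit (R := ℂ)) x.ofConv y.ofConv
    hx hy]
  have e1 : ∀ c : A, tens (Coalgebra.counit (R := ℂ)) (Coalgebra.counit (R := ℂ))
      (Coalgebra.comul (R := ℂ) c) = Coalgebra.counit (R := ℂ) c := fun c => by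
    have := key 1 1 c
    rw [mul_one] at this
    exact this.symm
  have e2 : ∀ (f : WithConv (A →ₗ[ℂ] ℂ)) (c : A), tens (Coalgebra.counit (R := ℂ)) f.ofConv
      (Coalgebra.comul (R := ℂ) c) = f.ofConv c := fun f c => by
    have := key 1 f c
    rw [one_mul] at this
    exact this.symm
  have e3 : ∀ (f : WithConv (A →ₗ[ℂ] ℂ)) (c : A), tens f.ofConv (Coalgebra.counit (R := ℂ))
      (Coalgebra.comul (R := ℂ) c) = f.ofConv c := fun f c => by
    have := key f 1 c
    rw [mul_one] at this
    exact this.symm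
  rw [e1, e1, e2, e2, e3, e3, ← key, ← key]

variable (A)

/-- The Lie algebra `𝔤` of `G`: the point derivations `x : A → ℂ` at the identity, with the
commutator of the convolution product `(x * y)(a) = ∑ x(a₁) y(a₂)` as Lie bracket
(this is the bracket of left invariant vector fields). -/
def lieAlg : LieSubalgebra ℂ (WithConv (A →ₗ[ℂ] ℂ)) where
  carrier := {x | ∀ a b : A, x.ofConv (a * b) =
    Coalgebra.counit (R := ℂ) a * x.ofConv b + x.ofConv a * Coalgebra.counit (R := ℂ) b}
  add_mem' := by
    intro x y hx hy a b
    simp only [Set.mem_ofPred_eq] at hx hy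
    simp only [WithConv.ofConv_add, LinearMap.add_apply, hx a b, hy a b]
    ring
  zero_mem' := by
    intro a b
    simp
  smul_mem' := by
    intro c x hx a b
    simp only [Set.mem_ofPred_eq] at hx
    simp only [WithConv.ofConv_smul, LinearMap.smul_apply, hx a b, smul_eq_mul]
    ring
  lie_mem' := by
    intro x y hx hy a b
    have h1 := conv_mul_apply x y hx hy a b
    have h2 := conv_mul_apply y x hy hx a b
    rw [LieRing.of_associative_ring_bracket]
    simp only [WithConv.ofConv_sub, LinearMap.sub_apply, h1, h2]
    ring

/-- The Lie algebra `𝔤` of `G`, as a type. -/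
def LieAlg : Type u := lieAlg A

instance : LieRing (LieAlg A) := inferInstanceAs (LieRing (lieAlg A))

instance : LieAlgebra ℂ (LieAlg A) := inferInstanceAs (LieAlgebra ℂ (lieAlg A))

variable {A}

/-- A tangent vector `x ∈ 𝔤` as a functional on `A = ℂ[G]`. -/
def LieAlg.eval (x : LieAlg A) : A →ₗ[ℂ] ℂ := x.1.ofConv

theorem LieAlg.eval_mul (x : LieAlg A) (a b : A) : x.eval (a * b) =
    Coalgebra.counit (R := ℂ) a * x.eval b + x.eval a * Coalgebra.counit (R := ℂ) b :=
  x.2 a b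

end LieAlg

/-! ### Involutions of `G` -/

/-- An involution `ω` of the algebraic group `G`, given by its comorphism. -/
structure GroupInvolution (A : Type u) [CommRing A] [HopfAlgebra ℂ A] where
  /-- the comorphism `a ↦ a ∘ ω` -/
  toHom : A →ₐc[ℂ] A
  invol : ∀ a, toHom (toHom a) = a

section Involution

variable {A : Type u} [CommRing A] [HopfAlgebra ℂ A]

/-- The involution of the Lie algebra `𝔤` induced by `ω`: `x ↦ (a ↦ x (a ∘ ω))`. -/
def GroupInvolution.onLie (θ : GroupInvolution A) (x : LieAlg A) : LieAlg A :=
  ⟨WithConv.toConv (x.eval ∘ₗ (θ.toHom : A →ₗ[ℂ] A)), by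
    intro a b
    have hc : ∀ a : A, Coalgebra.counit (R := ℂ) (θ.toHom a) = Coalgebra.counit (R := ℂ) a :=
      fun a => CoalgHomClass.counit_comp_apply θ.toHom a
    have := x.eval_mul (θ.toHom a) (θ.toHom b)
    simpa [hc] using this⟩

end Involution

/-! ### The group scheme `G₁[[z⁻¹]]`

Throughout, `t = z⁻¹` is the variable of the power series rings. -/

/-- The group `G₁[[z⁻¹]](R)`, the kernel of the evaluation `G(R[[t]]) → G(R)` at `t = 0`, where
`G(S) = Hom(A, S)` for a commutative `ℂ`-algebra `S`. -/
@[ext] structure LoopGroup (A : Type u) [CommRing A] [HopfAlgebra ℂ A]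
    (R : Type v) [CommRing R] [Algebra ℂ R] : Type (max u v) where
  /-- the `R[[t]]`-point of `G` -/
  hom : A →ₐ[ℂ] R⟦X⟧
  const : ∀ a, PowerSeries.constantCoeff (hom a) =
    algebraMap ℂ R (Coalgebra.counit (R := ℂ) a)

namespace LoopGroup

variable {A : Type u} [CommRing A] [HopfAlgebra ℂ A]
variable {R : Type v} [CommRing R] [Algebra ℂ R] {S : Type w} [CommRing S] [Algebra ℂ S]

theorem ext' {g h : LoopGroup A R} (H : ∀ a, g.hom a = h.hom a) : g = h :=
  LoopGroup.ext (AlgHom.ext H)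

/-- The constant term, as an algebra homomorphism. -/
def cc (R : Type v) [CommRing R] [Algebra ℂ R] : R⟦X⟧ →ₐ[ℂ] R :=
  { (PowerSeries.constantCoeff : R⟦X⟧ →+* R) with
    commutes' := fun r => by
      change PowerSeries.constantCoeff (algebraMap ℂ R⟦X⟧ r) = _
      rw [PowerSeries.algebraMap_apply, PowerSeries.constantCoeff_C] }

theorem const_iff (φ : A →ₐ[ℂ] R⟦X⟧) :
    (∀ a, PowerSeries.constantCoeff (φ a) = algebraMap ℂ R (Coalgebra.counit (R := ℂ) a)) ↔
      (cc R).comp φ = (1 : WithConv (A →ₐ[ℂ] R)).ofConv :=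
  ⟨fun h => AlgHom.ext h, fun h a => congrArg (fun f => f a) h⟩

/-- Multiplication in `G(R[[t]])`: `(g h)(a) = ∑ g(a₁) h(a₂)`. -/
instance : Mul (LoopGroup A R) where
  mul g h := ⟨(WithConv.toConv g.hom * WithConv.toConv h.hom).ofConv, by
    rw [const_iff, AlgHom.comp_convMul_distrib]
    change (WithConv.toConv ((cc R).comp g.hom) * WithConv.toConv ((cc R).comp h.hom)).ofConv = _
    rw [(const_iff _).1 g.const, (const_iff _).1 h.const]
    exact congrArg WithConv.ofConv (mul_one (1 : WithConv (A →ₐ[ℂ] R)))⟩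

/-- The identity element: `a ↦ a(e)`. -/
instance : One (LoopGroup A R) where
  one := ⟨(1 : WithConv (A →ₐ[ℂ] R⟦X⟧)).ofConv, fun a => by
    change PowerSeries.constantCoeff (algebraMap ℂ R⟦X⟧ _) = _
    rw [PowerSeries.algebraMap_apply, PowerSeries.constantCoeff_C]
    rfl⟩

/-- The inverse, given by composition with the antipode. -/
instance : Inv (LoopGroup A R) where
  inv g := ⟨g.hom.comp (HopfAlgebra.antipodeAlgHom ℂ A), fun a => by
    rw [AlgHom.comp_apply, g.const]
    exact congrArg (algebraMap ℂ R) (congrArg (fun f : A →ₐ[ℂ] ℂ => f a) (AlgHom.counitAlgHom_comp_antipodeAlgHom (R := ℂ) (A := A)))⟩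

theorem mul_val (g h : LoopGroup A R) :
    (g * h).hom = (WithConv.toConv g.hom * WithConv.toConv h.hom).ofConv := rfl

theorem one_val : (1 : LoopGroup A R).hom = (1 : WithConv (A →ₐ[ℂ] R⟦X⟧)).ofConv := rfl

theorem inv_val (g : LoopGroup A R) :
    (g⁻¹).hom = g.hom.comp (HopfAlgebra.antipodeAlgHom ℂ A) := rfl

instance : Group (LoopGroup A R) where
  mul_assoc g h k := LoopGroup.ext (congrArg WithConv.ofConv
    (mul_assoc (WithConv.toConv g.hom) (WithConv.toConv h.hom) (WithConv.toConv k.hom)))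
  one_mul g := LoopGroup.ext (congrArg WithConv.ofConv (one_mul (WithConv.toConv g.hom)))
  mul_one g := LoopGroup.ext (congrArg WithConv.ofConv (mul_one (WithConv.toConv g.hom)))
  inv_mul_cancel g := by
    apply LoopGroup.ext
    rw [mul_val, inv_val]
    have h := AlgHom.comp_convMul_distrib g.hom
      (WithConv.toConv (HopfAlgebra.antipodeAlgHom ℂ A)) (WithConv.toConv (AlgHom.id ℂ A))
    rw [AlgHom.antipode_id_cancel] at h
    simp only [AlgHom.comp_id] at h
    rw [← h]
    ext a : 1
    exact g.hom.commutes _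

/-- Functoriality of `R ↦ G₁[[z⁻¹]](R)`. -/
def map (f : R →ₐ[ℂ] S) : LoopGroup A R →* LoopGroup A S where
  toFun g := ⟨(PowerSeries.mapAlgHom f).comp g.hom, fun a => by
    rw [AlgHom.comp_apply, PowerSeries.mapAlgHom_apply,
      ← PowerSeries.coeff_zero_eq_constantCoeff_apply, PowerSeries.coeff_map,
      PowerSeries.coeff_zero_eq_constantCoeff_apply, g.const a]
    exact f.commutes _⟩
  map_one' := by
    apply LoopGroup.ext
    ext a : 1
    exact (PowerSeries.mapAlgHom f).commutes _
  map_mul' g h := LoopGroup.ext (AlgHom.comp_convMul_distrib (PowerSeries.mapAlgHom f) _ _)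

/-- The substitution `t ↦ -t` on power series, i.e. `z ↦ -z`. -/
def negVar (R : Type v) [CommRing R] [Algebra ℂ R] : R⟦X⟧ →ₐ[ℂ] R⟦X⟧ :=
  { PowerSeries.rescale (-1 : R) with
    commutes' := fun r => by
      change PowerSeries.rescale (-1 : R) (algebraMap ℂ R⟦X⟧ r) = _
      rw [PowerSeries.algebraMap_apply]
      ext n
      rw [PowerSeries.coeff_rescale, PowerSeries.coeff_C]
      split_ifs with h <;> simp [h] }

theorem coeff_negVar (f : R⟦X⟧) (n : ℕ) :
    PowerSeries.coeff n (negVar R f) = (-1) ^ n * PowerSeries.coeff n f :=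
  PowerSeries.coeff_rescale _ _ _

/-- The involution `ω` of `G₁[[z⁻¹]](R)`: apply `ω` of `G` and substitute `z ↦ -z`. -/
def omega (θ : GroupInvolution A) (R : Type v) [CommRing R] [Algebra ℂ R] :
    LoopGroup A R →* LoopGroup A R where
  toFun g := ⟨((negVar R).comp g.hom).comp (θ.toHom : A →ₐ[ℂ] A), fun a => by
    have h := g.const (θ.toHom a)
    have hc : Coalgebra.counit (R := ℂ) (θ.toHom a) = Coalgebra.counit (R := ℂ) a :=
      CoalgHomClass.counit_comp_apply θ.toHom a
    rw [hc] at h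
    rw [← h, ← PowerSeries.coeff_zero_eq_constantCoeff_apply,
      ← PowerSeries.coeff_zero_eq_constantCoeff_apply]
    change PowerSeries.coeff 0 (negVar R (g.hom (θ.toHom a))) = _
    rw [coeff_negVar, pow_zero, one_mul]⟩
  map_one' := by
    apply LoopGroup.ext'; intro a
    change negVar R (algebraMap ℂ R⟦X⟧ (Coalgebra.counit (R := ℂ) (θ.toHom a))) = _
    rw [AlgHom.commutes, CoalgHomClass.counit_comp_apply θ.toHom a]
    rfl
  map_mul' g h := by
    apply LoopGroup.ext
    change ((negVar R).comp (WithConv.toConv g.hom * WithConv.toConv h.hom).ofConv).comp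
      (θ.toHom : A →ₐ[ℂ] A) = _
    rw [AlgHom.comp_convMul_distrib]
    exact AlgHom.convMul_comp_bialgHom_distrib _ _ θ.toHom

theorem omega_val (θ : GroupInvolution A) (g : LoopGroup A R) (a : A) :
    (omega θ R g).hom a = negVar R (g.hom (θ.toHom a)) := rfl

theorem omega_omega (θ : GroupInvolution A) (g : LoopGroup A R) :
    omega θ R (omega θ R g) = g := by
  apply LoopGroup.ext'; intro a; ext n
  rw [omega_val, omega_val, θ.invol, coeff_negVar, coeff_negVar, ← mul_assoc, ← mul_pow]
  simp

theorem map_omega (θ : GroupInvolution A) (f : R →ₐ[ℂ] S) (g : LoopGroup A R) :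
    map f (omega θ R g) = omega θ S (map f g) := by
  apply LoopGroup.ext'; intro a; ext n
  change PowerSeries.coeff n (PowerSeries.mapAlgHom f (negVar R (g.hom (θ.toHom a)))) =
    PowerSeries.coeff n (negVar S (PowerSeries.mapAlgHom f (g.hom (θ.toHom a))))
  simp [PowerSeries.mapAlgHom_apply, coeff_negVar]

/-- The anti-automorphism `σ = inv ∘ ω` of `G₁[[z⁻¹]](R)`. -/
def sigma (θ : GroupInvolution A) (R : Type v) [CommRing R] [Algebra ℂ R]
    (g : LoopGroup A R) : LoopGroup A R :=
  (omega θ R g)⁻¹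

theorem sigma_mul (θ : GroupInvolution A) (g h : LoopGroup A R) :
    sigma θ R (g * h) = sigma θ R h * sigma θ R g := by
  simp [sigma]

theorem sigma_sigma (θ : GroupInvolution A) (g : LoopGroup A R) :
    sigma θ R (sigma θ R g) = g := by
  simp [sigma, omega_omega]

theorem map_sigma (θ : GroupInvolution A) (f : R →ₐ[ℂ] S) (g : LoopGroup A R) :
    map f (sigma θ R g) = sigma θ S (map f g) := by
  simp [sigma, map_omega]

/-- The subgroup `G₁[[z⁻¹]]^ω` on `R`-points. -/
def omegaFixed (θ : GroupInvolution A) (R : Type v) [CommRing R] [Algebra ℂ R] :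
    Subgroup (LoopGroup A R) where
  carrier := {g | omega θ R g = g}
  mul_mem' := by
    intro g h hg hh
    change omega θ R (g * h) = g * h
    rw [map_mul, show omega θ R g = g from hg, show omega θ R h = h from hh]
  one_mem' := map_one _
  inv_mem' := by
    intro g hg
    change omega θ R g⁻¹ = g⁻¹
    rw [map_inv, show omega θ R g = g from hg]

/-- The fixed-point locus `G₁[[z⁻¹]]^σ` on `R`-points. -/
@[ext] structure SigmaFixed (θ : GroupInvolution A) (R : Type v) [CommRing R] [Algebra ℂ R] :
    Type (max u v) where
  /-- the underlying point of `G₁[[z⁻¹]]` -/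
  val : LoopGroup A R
  fixed : LoopGroup.sigma θ R val = val

/-- The action `g · p = g p σ(g)` of `G₁[[z⁻¹]]` on `G₁[[z⁻¹]]^σ`, on `R`-points. -/
instance (θ : GroupInvolution A) : MulAction (LoopGroup A R) (SigmaFixed θ R) where
  smul g p := ⟨g * p.val * sigma θ R g, by
    rw [sigma_mul, sigma_mul, sigma_sigma, p.fixed, mul_assoc]⟩
  one_smul p := SigmaFixed.ext (by
    change 1 * p.val * sigma θ R 1 = p.val
    simp [sigma])
  mul_smul g h p := SigmaFixed.ext (by
    change g * h * p.val * sigma θ R (g * h) = g * (h * p.val * sigma θ R h) * sigma θ R g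
    simp only [sigma_mul, mul_assoc])

/-- The identity element `e` as a point of `G₁[[z⁻¹]]^σ`. -/
instance (θ : GroupInvolution A) : One (SigmaFixed θ R) where
  one := ⟨1, by simp [sigma]⟩

/-- The map `G₁[[z⁻¹]] / G₁[[z⁻¹]]^ω → G₁[[z⁻¹]]^σ`, `[g] ↦ g · e = g σ(g)`, on `R`-points. -/
def orbitMap (θ : GroupInvolution A) (R : Type v) [CommRing R] [Algebra ℂ R] :
    LoopGroup A R ⧸ omegaFixed θ R → SigmaFixed θ R :=
  Quotient.lift (fun g : LoopGroup A R => g • (1 : SigmaFixed θ R)) (by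
    intro g h hgh
    have hk : omega θ R (g⁻¹ * h) = g⁻¹ * h := QuotientGroup.leftRel_apply.1 hgh
    apply SigmaFixed.ext
    change g * 1 * (omega θ R g)⁻¹ = h * 1 * (omega θ R h)⁻¹
    obtain ⟨k, rfl⟩ : ∃ k, h = g * k := ⟨g⁻¹ * h, by group⟩
    rw [inv_mul_cancel_left] at hk
    rw [map_mul, hk]
    group)

end LoopGroup

/-! ### The coordinate ring of `G₁[[z⁻¹]]` -/

section CoordRing

variable (A : Type u) [CommRing A] [HopfAlgebra ℂ A]

/-- The relations between the symbols `a⁽ⁿ⁾` (`a ∈ ℂ[G]`, `n ≥ 0`), expressing that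
`a ↦ ∑ a⁽ⁿ⁾ tⁿ` is a homomorphism of `ℂ`-algebras with constant term `a ↦ a(e)`. -/
inductive LoopRel : MvPolynomial (A × ℕ) ℂ → Prop
  | add (a b : A) (n : ℕ) :
      LoopRel (MvPolynomial.X (a + b, n) - (MvPolynomial.X (a, n) + MvPolynomial.X (b, n)))
  | smul (c : ℂ) (a : A) (n : ℕ) :
      LoopRel (MvPolynomial.X (c • a, n) - MvPolynomial.C c * MvPolynomial.X (a, n))
  | one (n : ℕ) : LoopRel (MvPolynomial.X (1, n) - if n = 0 then 1 else 0)
  | mul (a b : A) (n : ℕ) :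
      LoopRel (MvPolynomial.X (a * b, n) -
        ∑ p ∈ Finset.HasAntidiagonal.antidiagonal n, MvPolynomial.X (a, p.1) * MvPolynomial.X (b, p.2))
  | const (a : A) :
      LoopRel (MvPolynomial.X (a, 0) - MvPolynomial.C (Coalgebra.counit (R := ℂ) a))

/-- The ideal generated by the relations. -/
def loopIdeal : Ideal (MvPolynomial (A × ℕ) ℂ) := Ideal.span {r | LoopRel A r}

/-- The coordinate ring `ℂ[G₁[[z⁻¹]]]`, the ring representing `R ↦ G₁[[z⁻¹]](R)`. -/
def LoopRing : Type u := MvPolynomial (A × ℕ) ℂ ⧸ loopIdeal A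

instance : CommRing (LoopRing A) :=
  inferInstanceAs (CommRing (MvPolynomial (A × ℕ) ℂ ⧸ loopIdeal A))

instance : Algebra ℂ (LoopRing A) :=
  inferInstanceAs (Algebra ℂ (MvPolynomial (A × ℕ) ℂ ⧸ loopIdeal A))

namespace LoopRing

/-- The projection from the polynomial ring. -/
def proj : MvPolynomial (A × ℕ) ℂ →ₐ[ℂ] LoopRing A := Ideal.Quotient.mkₐ ℂ (loopIdeal A)

variable {A}
variable {R : Type v} [CommRing R] [Algebra ℂ R]

/-- The function `a⁽ⁿ⁾ : g ↦` coefficient of `tⁿ = z⁻ⁿ` in `a(g(z))`. -/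
def gen (a : A) (n : ℕ) : LoopRing A := proj A (MvPolynomial.X (a, n))

theorem mk_eq_zero {r : MvPolynomial (A × ℕ) ℂ} (h : LoopRel A r) :
    proj A r = 0 :=
  Ideal.Quotient.eq_zero_iff_mem.2 (Ideal.subset_span h)

theorem gen_add (a b : A) (n : ℕ) : gen (a + b) n = gen a n + gen b n := by
  have := mk_eq_zero (LoopRel.add a b n)
  rwa [map_sub, map_add, sub_eq_zero] at this

theorem gen_smul (c : ℂ) (a : A) (n : ℕ) : gen (c • a) n = c • gen a n := by
  have := mk_eq_zero (LoopRel.smul c a n)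
  rw [map_sub, map_mul, sub_eq_zero, ← MvPolynomial.algebraMap_eq, AlgHom.commutes] at this
  exact this.trans (Algebra.smul_def c (gen a n)).symm

theorem gen_one (n : ℕ) : gen (1 : A) n = if n = 0 then 1 else 0 := by
  have := mk_eq_zero (LoopRel.one (A := A) n)
  rw [map_sub, sub_eq_zero] at this
  refine this.trans ?_
  split_ifs <;> simp

theorem gen_mul (a b : A) (n : ℕ) :
    gen (a * b) n = ∑ p ∈ Finset.HasAntidiagonal.antidiagonal n, gen a p.1 * gen b p.2 := by
  have := mk_eq_zero (LoopRel.mul a b n)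
  rw [map_sub, sub_eq_zero, map_sum] at this
  refine this.trans (Finset.sum_congr rfl fun p _ => ?_)
  rw [map_mul]
  rfl

theorem gen_zero (a : A) :
    gen a 0 = algebraMap ℂ (LoopRing A) (Coalgebra.counit (R := ℂ) a) := by
  have := mk_eq_zero (LoopRel.const a)
  rwa [map_sub, sub_eq_zero, ← MvPolynomial.algebraMap_eq, AlgHom.commutes] at this

/-- The universal point of `G₁[[z⁻¹]]`: `a ↦ ∑ a⁽ⁿ⁾ tⁿ`. -/
def univ : LoopGroup A (LoopRing A) :=
  ⟨AlgHom.ofLinearMap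
    { toFun := fun a => PowerSeries.mk (gen a)
      map_add' := fun a b => by ext n; simp [gen_add]
      map_smul' := fun c a => by
        ext n
        simp [gen_smul] }
    (by
      ext n
      simp only [LinearMap.coe_mk, AddHom.coe_mk, PowerSeries.coeff_mk, gen_one,
        PowerSeries.coeff_one])
    (fun a b => by
      ext n
      simp only [LinearMap.coe_mk, AddHom.coe_mk, PowerSeries.coeff_mk, PowerSeries.coeff_mul,
        gen_mul]),
  fun a => by
    rw [← PowerSeries.coeff_zero_eq_constantCoeff_apply]
    simp [gen_zero]⟩

theorem coeff_univ (a : A) (n : ℕ) : PowerSeries.coeff n ((univ (A := A)).hom a) = gen a n := by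
  simp [univ]

/-- The homomorphism `ℂ[G₁[[z⁻¹]]] → R` corresponding to an `R`-point of `G₁[[z⁻¹]]`. -/
def lift (g : LoopGroup A R) : LoopRing A →ₐ[ℂ] R :=
  Ideal.Quotient.liftₐ (loopIdeal A)
    (MvPolynomial.aeval fun p : A × ℕ => PowerSeries.coeff p.2 (g.hom p.1)) (by
      intro r hr
      refine (Ideal.span_le (I := RingHom.ker (MvPolynomial.aeval (R := ℂ)
        fun p : A × ℕ => PowerSeries.coeff p.2 (g.hom p.1)))).2 ?_ hr
      intro r hr
      change MvPolynomial.aeval _ r = 0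
      rcases hr with ⟨a, b, n⟩ | ⟨c, a, n⟩ | ⟨n⟩ | ⟨a, b, n⟩ | ⟨a⟩
      · simp
      · rw [map_sub, map_mul, MvPolynomial.aeval_X, MvPolynomial.aeval_X, MvPolynomial.aeval_C,
          map_smul]
        have : PowerSeries.coeff n (c • g.hom a) = c • PowerSeries.coeff n (g.hom a) := rfl
        rw [this, Algebra.smul_def, sub_self]
      · rw [map_sub, MvPolynomial.aeval_X, map_one, PowerSeries.coeff_one]
        split_ifs <;> simp
      · simp [PowerSeries.coeff_mul]
      · simp [g.const a])

theorem lift_gen (g : LoopGroup A R) (a : A) (n : ℕ) :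
    lift g (gen a n) = PowerSeries.coeff n (g.hom a) := by
  change MvPolynomial.aeval (fun p : A × ℕ => PowerSeries.coeff p.2 (g.hom p.1))
    (MvPolynomial.X (a, n)) = _
  simp

theorem coeff_map_hom {S : Type w} [CommRing S] [Algebra ℂ S] (f : R →ₐ[ℂ] S)
    (g : LoopGroup A R) (a : A) (n : ℕ) :
    PowerSeries.coeff n ((LoopGroup.map f g).hom a) = f (PowerSeries.coeff n (g.hom a)) :=
  PowerSeries.coeff_map (f : R →+* S) n (g.hom a)

theorem map_lift_univ (g : LoopGroup A R) : LoopGroup.map (lift g) univ = g := by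
  apply LoopGroup.ext'; intro a; ext n
  rw [coeff_map_hom, coeff_univ, lift_gen]

theorem algHom_ext {f f' : LoopRing A →ₐ[ℂ] R}
    (h : LoopGroup.map f univ = LoopGroup.map f' univ) : f = f' := by
  have key : f.comp (proj A) = f'.comp (proj A) := by
    apply MvPolynomial.algHom_ext
    rintro ⟨a, n⟩
    have := congrArg (fun g : LoopGroup A R => PowerSeries.coeff n (g.hom a)) h
    simp only [coeff_map_hom, coeff_univ] at this
    exact this
  ext r
  obtain ⟨r, rfl⟩ := Ideal.Quotient.mk_surjective (I := loopIdeal A) r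
  exact congrArg (fun F : MvPolynomial (A × ℕ) ℂ →ₐ[ℂ] R => F r) key

theorem map_comp {S : Type w} [CommRing S] [Algebra ℂ S] {T : Type*} [CommRing T] [Algebra ℂ T]
    (f : R →ₐ[ℂ] S) (f' : S →ₐ[ℂ] T) (g : LoopGroup A R) :
    LoopGroup.map (f'.comp f) g = LoopGroup.map f' (LoopGroup.map f g) := by
  apply LoopGroup.ext'; intro a; ext n
  simp only [coeff_map_hom, AlgHom.comp_apply]

theorem comp_lift {S : Type w} [CommRing S] [Algebra ℂ S] (f : R →ₐ[ℂ] S) (g : LoopGroup A R) :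
    f.comp (lift g) = lift (LoopGroup.map f g) :=
  algHom_ext (by rw [map_comp, map_lift_univ, map_lift_univ])

variable (A) in
/-- The comultiplication: the comorphism of `(g, h) ↦ g h`. -/
def comul : LoopRing A →ₐ[ℂ] LoopRing A ⊗[ℂ] LoopRing A :=
  lift (LoopGroup.map Algebra.TensorProduct.includeLeft univ *
    LoopGroup.map Algebra.TensorProduct.includeRight univ)

/-- The comorphism of the involution `ω` of `G₁[[z⁻¹]]`. -/
def omega (θ : GroupInvolution A) : LoopRing A →ₐ[ℂ] LoopRing A :=
  lift (LoopGroup.omega θ (LoopRing A) univ)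

/-- The comorphism of the anti-automorphism `σ` of `G₁[[z⁻¹]]`. -/
def sigma (θ : GroupInvolution A) : LoopRing A →ₐ[ℂ] LoopRing A :=
  lift (LoopGroup.sigma θ (LoopRing A) univ)

theorem lift_comp_sigma (θ : GroupInvolution A) (g : LoopGroup A R) :
    (lift g).comp (sigma θ) = lift (LoopGroup.sigma θ R g) := by
  rw [sigma, comp_lift, LoopGroup.map_sigma, map_lift_univ]

end LoopRing

end CoordRing

/-! ### Fixed-point schemes -/

section Fixed

variable {B : Type u} [CommRing B] [Algebra ℂ B]

/-- The ideal `⟨s(f) - f⟩` of the fixed-point scheme of an endomorphism `s`. -/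
def fixedIdeal (s : B →ₐ[ℂ] B) : Ideal B := Ideal.span (Set.range fun f => s f - f)

/-- The coordinate ring `B / ⟨s(f) - f⟩` of the fixed-point scheme `(Spec B)^s`. -/
def FixedRing (s : B →ₐ[ℂ] B) : Type u := B ⧸ fixedIdeal s

instance (s : B →ₐ[ℂ] B) : CommRing (FixedRing s) :=
  inferInstanceAs (CommRing (B ⧸ fixedIdeal s))

instance (s : B →ₐ[ℂ] B) : Algebra ℂ (FixedRing s) :=
  inferInstanceAs (Algebra ℂ (B ⧸ fixedIdeal s))

/-- Restriction of functions to the fixed-point scheme. -/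
def FixedRing.mk (s : B →ₐ[ℂ] B) : B →ₐ[ℂ] FixedRing s := Ideal.Quotient.mkₐ ℂ (fixedIdeal s)

theorem FixedRing.mk_comp (s : B →ₐ[ℂ] B) :
    (FixedRing.mk s).comp s = FixedRing.mk s := by
  ext f
  exact Ideal.Quotient.eq.2 (Ideal.subset_span ⟨f, rfl⟩)

/-- Factor a homomorphism with `F ∘ s = F` through the coordinate ring of the fixed-point
scheme. -/
def FixedRing.lift (s : B →ₐ[ℂ] B) {R : Type v} [CommRing R] [Algebra ℂ R] (F : B →ₐ[ℂ] R)
    (hF : F.comp s = F) : FixedRing s →ₐ[ℂ] R :=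
  Ideal.Quotient.liftₐ (fixedIdeal s) F (by
    intro r hr
    refine (Ideal.span_le (I := RingHom.ker F)).2 ?_ hr
    rintro _ ⟨f, rfl⟩
    change F (s f - f) = 0
    rw [map_sub, sub_eq_zero]
    exact congrArg (fun h => h f) hF)

end Fixed

section Comorphisms

variable {A : Type u} [CommRing A] [HopfAlgebra ℂ A] (θ : GroupInvolution A)

/-- The coordinate ring `ℂ[G₁[[z⁻¹]]^σ]`. -/
abbrev SigmaRing : Type u := FixedRing (LoopRing.sigma θ)

/-- The coordinate ring `ℂ[G₁[[z⁻¹]]^ω]`. -/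
abbrev OmegaRing : Type u := FixedRing (LoopRing.omega θ)

/-- The comorphism of the multiplication map `G₁[[z⁻¹]]^σ × G₁[[z⁻¹]]^ω → G₁[[z⁻¹]]`. -/
def mulComorphism : LoopRing A →ₐ[ℂ] SigmaRing θ ⊗[ℂ] OmegaRing θ :=
  (Algebra.TensorProduct.map (FixedRing.mk (LoopRing.sigma θ))
    (FixedRing.mk (LoopRing.omega θ))).comp (LoopRing.comul A)

/-- The universal point of `G₁[[z⁻¹]]^σ`. -/
def univSigma : LoopGroup A (SigmaRing θ) :=
  LoopGroup.map (FixedRing.mk (LoopRing.sigma θ)) LoopRing.univ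

theorem sigma_univSigma : LoopGroup.sigma θ _ (univSigma θ) = univSigma θ := by
  have h1 : LoopGroup.map (LoopRing.sigma θ) LoopRing.univ =
      LoopGroup.sigma θ (LoopRing A) LoopRing.univ := LoopRing.map_lift_univ _
  have h2 := congrArg (fun F => LoopGroup.map F LoopRing.univ) (FixedRing.mk_comp (LoopRing.sigma θ))
  simp only [LoopRing.map_comp, h1, LoopGroup.map_sigma] at h2
  exact h2

/-- The comorphism of the action `(g, p) ↦ g p σ(g)` of `G₁[[z⁻¹]]` on `G₁[[z⁻¹]]^σ`. -/
def coaction : SigmaRing θ →ₐ[ℂ] LoopRing A ⊗[ℂ] SigmaRing θ :=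
  let g : LoopGroup A (LoopRing A ⊗[ℂ] SigmaRing θ) :=
    LoopGroup.map Algebra.TensorProduct.includeLeft LoopRing.univ
  let p : LoopGroup A (LoopRing A ⊗[ℂ] SigmaRing θ) :=
    LoopGroup.map Algebra.TensorProduct.includeRight (univSigma θ)
  FixedRing.lift (LoopRing.sigma θ) (LoopRing.lift (g * p * LoopGroup.sigma θ _ g)) (by
    have hp : LoopGroup.sigma θ _ p = p := by
      rw [← LoopGroup.map_sigma, sigma_univSigma]
    rw [LoopRing.lift_comp_sigma, LoopGroup.sigma_mul, LoopGroup.sigma_mul,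
      LoopGroup.sigma_sigma, hp, mul_assoc])

/-- The comorphism of the orbit map `G₁[[z⁻¹]] → G₁[[z⁻¹]]^σ`, `g ↦ g · e = g σ(g)`. -/
def orbitComorphism : SigmaRing θ →ₐ[ℂ] LoopRing A :=
  FixedRing.lift (LoopRing.sigma θ)
    (LoopRing.lift (LoopRing.univ * LoopGroup.sigma θ _ LoopRing.univ)) (by
    rw [LoopRing.lift_comp_sigma, LoopGroup.sigma_mul, LoopGroup.sigma_sigma])

/-- The ring of invariants `ℂ[G₁[[z⁻¹]]]^(G₁[[z⁻¹]]^ω)`, i.e. the functions `f` with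
`f(g k) = f(g)` for `k` in the subgroup scheme `G₁[[z⁻¹]]^ω`; this is the coordinate ring of
`G₁[[z⁻¹]] / G₁[[z⁻¹]]^ω`. -/
def invariants : Subalgebra ℂ (LoopRing A) :=
  AlgHom.equalizer
    ((Algebra.TensorProduct.map (AlgHom.id ℂ (LoopRing A))
      (FixedRing.mk (LoopRing.omega θ))).comp (LoopRing.comul A))
    (Algebra.TensorProduct.includeLeft : LoopRing A →ₐ[ℂ] LoopRing A ⊗[ℂ] OmegaRing θ)

end Comorphisms

/-! ### Poisson brackets -/

section Poisson

variable {B : Type u} [CommRing B] [Algebra ℂ B] {C : Type v} [CommRing C] [Algebra ℂ C]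

/-- A bilinear operation on a commutative algebra is a Poisson bracket: it is alternating, a
derivation in each argument, and satisfies the Jacobi identity. -/
structure IsPoissonBracket (P : B →ₗ[ℂ] B →ₗ[ℂ] B) : Prop where
  self : ∀ f, P f f = 0
  leibniz : ∀ f g h, P f (g * h) = P f g * h + g * P f h
  jacobi : ∀ f g h, P f (P g h) + P g (P h f) + P h (P f g) = 0

/-- The bracket of the product of two Poisson schemes:
`{b ⊗ c, b' ⊗ c'} = {b, b'} ⊗ c c' + b b' ⊗ {c, c'}`. -/
def prodBracket (P : B →ₗ[ℂ] B →ₗ[ℂ] B) (Q : C →ₗ[ℂ] C →ₗ[ℂ] C) :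
    B ⊗[ℂ] C →ₗ[ℂ] B ⊗[ℂ] C →ₗ[ℂ] B ⊗[ℂ] C :=
  TensorProduct.map₂ P (LinearMap.mul ℂ C) + TensorProduct.map₂ (LinearMap.mul ℂ B) Q

/-- A homomorphism of algebras preserves the brackets. -/
def IsPoissonHom (P : B →ₗ[ℂ] B →ₗ[ℂ] B) (Q : C →ₗ[ℂ] C →ₗ[ℂ] C) (F : B →ₐ[ℂ] C) : Prop :=
  ∀ f h, F (P f h) = Q (F f) (F h)

/-- `D` is the bracket on the fixed-point scheme of `s` obtained from `P` by Dirac reduction: the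
bracket of two functions is the restriction of the bracket of `s`-invariant extensions. -/
def IsDiracReduction (P : B →ₗ[ℂ] B →ₗ[ℂ] B) (s : B →ₐ[ℂ] B)
    (D : FixedRing s →ₗ[ℂ] FixedRing s →ₗ[ℂ] FixedRing s) : Prop :=
  ∀ f h, s f = f → s h = h →
    D (FixedRing.mk s f) (FixedRing.mk s h) = FixedRing.mk s (P f h)

/-- The submodules `𝒜 n` form an algebra grading, for which the bracket has degree `-1`. -/
structure IsGradedPoisson (𝒜 : ℤ → Submodule ℂ B) (P : B →ₗ[ℂ] B →ₗ[ℂ] B) : Prop where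
  gradedMonoid : SetLike.GradedMonoid 𝒜
  isInternal : DirectSum.IsInternal 𝒜
  bracket_mem : ∀ i j f h, f ∈ 𝒜 i → h ∈ 𝒜 j → P f h ∈ 𝒜 (i + j - 1)

end Poisson

/-! ### The Manin triple and the Poisson structure of `G₁[[z⁻¹]]` -/

section Manin

variable {A : Type u} [CommRing A] [HopfAlgebra ℂ A]

/-- The field `ℂ((z⁻¹))` of Laurent series in the variable `t = z⁻¹`, as a `ℂ`-algebra. -/
def Laurent : Type := LaurentSeries ℂ

instance : CommRing Laurent := inferInstanceAs (CommRing (LaurentSeries ℂ))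

instance : Algebra ℂ Laurent := inferInstanceAs (Algebra ℂ (LaurentSeries ℂ))

/-- The element `zᵏ = t⁻ᵏ` of `ℂ((z⁻¹))`. -/
def Laurent.zpow (k : ℤ) : Laurent := (HahnSeries.single (-k) (1 : ℂ) : LaurentSeries ℂ)

/-- The coefficient of `zᵏ = t⁻ᵏ` in a Laurent series. -/
def Laurent.zcoeff (k : ℤ) (f : Laurent) : ℂ := HahnSeries.coeff (f : LaurentSeries ℂ) (-k)

variable (A) in
/-- The loop Lie algebra `𝔤((z⁻¹)) = ℂ((z⁻¹)) ⊗ 𝔤`, with the Lie bracket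
`⁅f ⊗ x, g ⊗ y⁆ = f g ⊗ ⁅x, y⁆`. -/
abbrev LoopLie : Type u := Laurent ⊗[ℂ] LieAlg A

/-- The element `x zᵏ` of `𝔤((z⁻¹))`. -/
def zpow (x : LieAlg A) (k : ℤ) : LoopLie A := Laurent.zpow k ⊗ₜ[ℂ] x

variable (A) in
/-- The subspace `𝔤[z]` of `𝔤((z⁻¹))`. -/
def polyLie : Submodule ℂ (LoopLie A) :=
  Submodule.span ℂ {ξ | ∃ (x : LieAlg A) (m : ℕ), ξ = zpow x m}

/-- The form `(X, Y) = - Res_{z=0} (X, Y)_𝔤` on `𝔤((z⁻¹))`; the residue is the coefficient of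
`z⁻¹`. -/
def loopForm (κ : LinearMap.BilinForm ℂ (LieAlg A)) (X Y : LoopLie A) : ℂ :=
  -(Laurent.zcoeff (-1) (LinearMap.BilinForm.baseChange Laurent κ X Y))

/-- The power series `ε tᵏ` over the dual numbers `ℂ[ε]`. -/
def epsPow (k : ℕ) : (DualNumber ℂ)⟦X⟧ := PowerSeries.monomial k DualNumber.eps

theorem epsPow_mul_self (k : ℕ) : epsPow k * epsPow k = 0 := by
  rw [epsPow, PowerSeries.monomial_mul_monomial, DualNumber.eps_mul_eps, map_zero]

/-- The `ℂ[ε]`-point `exp(ε x z⁻ⁿ⁻¹)` of `G₁[[z⁻¹]]`, `a ↦ a(e) + x(a) ε tⁿ⁺¹`. -/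
def tangentPoint (x : LieAlg A) (n : ℕ) : LoopGroup A (DualNumber ℂ) where
  hom := AlgHom.ofLinearMap
    { toFun := fun a => algebraMap ℂ (DualNumber ℂ)⟦X⟧ (Coalgebra.counit (R := ℂ) a) +
        algebraMap ℂ (DualNumber ℂ)⟦X⟧ (x.eval a) * epsPow (n + 1)
      map_add' := fun a b => by
        simp only [map_add]
        ring
      map_smul' := fun c a => by
        simp only [map_smul, smul_eq_mul, map_mul]
        rw [RingHom.id_apply, Algebra.smul_def]
        ring }
    (by
      have hx : x.eval 1 = 0 := by simpa using x.eval_mul 1 1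
      simp [hx])
    (fun a b => by
      have h := epsPow_mul_self (n + 1)
      simp only [LinearMap.coe_mk, AddHom.coe_mk, x.eval_mul, Bialgebra.counit_mul, map_mul,
        map_add]
      linear_combination -(algebraMap ℂ (DualNumber ℂ)⟦X⟧ (x.eval a) *
        algebraMap ℂ (DualNumber ℂ)⟦X⟧ (x.eval b)) * h)
  const := fun a => by
    have h : PowerSeries.constantCoeff (epsPow (n + 1)) = 0 := by
      rw [← PowerSeries.coeff_zero_eq_constantCoeff_apply, epsPow, PowerSeries.coeff_monomial]
      simp
    change PowerSeries.constantCoeff (algebraMap ℂ (DualNumber ℂ)⟦X⟧ _ +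
      algebraMap ℂ (DualNumber ℂ)⟦X⟧ _ * epsPow (n + 1)) = _
    rw [map_add, map_mul, h, mul_zero, add_zero, PowerSeries.algebraMap_apply,
      PowerSeries.constantCoeff_C]

/-- The derivative of a function on `G₁[[z⁻¹]]` at the identity in the direction
`x z⁻ⁿ⁻¹ ∈ z⁻¹𝔤[[z⁻¹]]`. -/
def tangentVec (x : LieAlg A) (n : ℕ) (f : LoopRing A) : ℂ :=
  TrivSqZeroExt.snd (LoopRing.lift (tangentPoint x n) f)

/-- The differential at the identity of `f ∈ ℂ[G₁[[z⁻¹]]]`, a continuous functional on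
`z⁻¹𝔤[[z⁻¹]]`, is given by pairing with `ξ ∈ 𝔤[z]` under the form on `𝔤((z⁻¹))`. -/
structure IsDifferential (κ : LinearMap.BilinForm ℂ (LieAlg A)) (f : LoopRing A)
    (ξ : LoopLie A) : Prop where
  mem : ξ ∈ polyLie A
  pairing : ∀ (x : LieAlg A) (n : ℕ), tangentVec x n f = loopForm κ (zpow x (-(n + 1 : ℤ))) ξ

/-- `P` is the Poisson structure on the group `G₁[[z⁻¹]]` corresponding to the Manin triple
`(𝔤((z⁻¹)), z⁻¹𝔤[[z⁻¹]], 𝔤[z])`: it is a Poisson bracket, multiplication in the group is a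
Poisson map, and its linearization at the identity is the Lie bracket of
`𝔤[z] ≅ (z⁻¹𝔤[[z⁻¹]])*`. -/
structure IsLoopPoisson (κ : LinearMap.BilinForm ℂ (LieAlg A))
    (P : LoopRing A →ₗ[ℂ] LoopRing A →ₗ[ℂ] LoopRing A) : Prop where
  poisson : IsPoissonBracket P
  multiplicative : IsPoissonHom P (prodBracket P P) (LoopRing.comul A)
  linearization : ∀ f h ξ η, IsDifferential κ f ξ → IsDifferential κ h η →
    IsDifferential κ (P f h) ⁅ξ, η⁆

end Manin

/-! ### Gradings by loop rotation -/

section Grading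

variable (A : Type u) [CommRing A] [HopfAlgebra ℂ A]

/-- The grading of `ℂ[G₁[[z⁻¹]]]` given by loop rotation: `a⁽ⁿ⁾` has degree `n`. -/
def loopGrading (n : ℤ) : Submodule ℂ (LoopRing A) :=
  (MvPolynomial.weightedHomogeneousSubmodule ℂ (fun p : A × ℕ => (p.2 : ℤ)) n).map
    (LoopRing.proj A).toLinearMap

variable {A}

/-- The induced grading of `ℂ[G₁[[z⁻¹]]^σ]`. -/
def sigmaGrading (θ : GroupInvolution A) (n : ℤ) : Submodule ℂ (SigmaRing θ) :=
  (loopGrading A n).map (FixedRing.mk (LoopRing.sigma θ)).toLinearMap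

end Grading

end LoopSym

end

open LoopSym

namespace LoopSym

/-! ### Square roots of power series with constant term `1` -/

section Sqrt

/-! Write t = z⁻¹. The part without brackets rests on unique square roots. An `R`-point of the group
is a power series in t over the convolution algebra Hom(A, R) with constant term 1, and over ℂ such
a series has exactly one square root with constant term 1. Uniqueness, applied on `A ⊗ A`, makes the
root of an algebra homomorphism an algebra homomorphism (`exists_mul_self`); applied on `A`, it
makes roots natural in `R` and compatible with σ. Hence g = p k with p = √(g σ(g)) and k = p⁻¹ g,
and every σ-fixed p equals √p σ(√p). This gives the factorization, transitivity and the orbit map on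
points. At universal points the same identities become statements about coordinate rings: pullback
along g ↦ g σ(g) maps isomorphically onto the invariants, with inverse induced by p ↦ √p.

The bracket is the one of Yang's r-matrix: {a(g(z)), b(g(w))} is 1/(w - z) times the difference of
the left and right invariant bivectors of the Casimir element, evaluated on a(g(z)) and b(g(w)).
This numerator vanishes at z = w because the Casimir element is invariant (`gen_casimirDiff`), so
the quotient makes sense. Skew symmetry, multiplicativity, degree -1 and compatibility with σ are
checked on generators after clearing the denominator (`eq_of_shift_eq`).

The Jacobi identity and uniqueness are reduced to the linearization. The Euler field t d/dt is a
combination of left invariant fields with coefficients taken from g⁻¹ dg/dt, so a function killed by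
all left invariant fields is constant. Moreover every function is killed by long products of such
fields. An invariant operation in two or three arguments that vanishes at e is therefore zero
(`bilinear_eq_zero`, `trilinear_eq_zero`), and this applies to the difference of two candidate
brackets and to the Jacobiator.

Inversion exchanges left and right fields and z ↦ -z changes the sign of 1/(w - z), so σ is Poisson.
The doubled Dirac bracket of the restrictions of f and h is then the restriction of {f, h} + {σf,
h}. The action is (g, p) ↦ (g, p, σ(g)) followed by triple multiplication. The first map is not
Poisson, but its defect is the bracket with the reversed function (`prodBracket_twistHom`). For the
pullback of a σ-invariant function the reversal changes nothing, and the sum of the two equal terms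
is the factor 2. The orbit map is the action at e, where the Dirac bracket vanishes, hence it is
Poisson too. Both gradings are eigenspace decompositions for the Euler derivation. -/

theorem coeff_succ_mul_of_one {E : Type*} [Ring E] (u v : E⟦X⟧) (hu : PowerSeries.coeff 0 u = 1)
    (hv : PowerSeries.coeff 0 v = 1) (n : ℕ) :
    PowerSeries.coeff (n + 1) (u * v) = PowerSeries.coeff (n + 1) u + PowerSeries.coeff (n + 1) v +
      ∑ i : Fin n, PowerSeries.coeff (i + 1) u * PowerSeries.coeff (n - i) v := by
  rw [PowerSeries.coeff_mul, Finset.Nat.sum_antidiagonal_eq_sum_range_succ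
    (fun i j => PowerSeries.coeff i u * PowerSeries.coeff j v), Finset.sum_range_succ,
    Finset.sum_range_succ', Fin.sum_univ_eq_sum_range
    (fun i => PowerSeries.coeff (i + 1) u * PowerSeries.coeff (n - i) v) n]
  simp only [Nat.sub_zero, hu, hv, Nat.sub_self, one_mul, mul_one, Nat.add_sub_add_right]
  abel

variable {E : Type*} [Ring E] [Algebra ℂ E]

/-- The coefficients of the square root of `1 + ∑ w n tⁿ`, `n ≥ 1`. -/
noncomputable def sqrtCoeff (w : ℕ → E) : ℕ → E
  | 0 => 1
  | n + 1 => (1 / 2 : ℂ) •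
      (w (n + 1) - ∑ i : Fin n, sqrtCoeff w (i + 1) * sqrtCoeff w (n - i))
  decreasing_by all_goals omega

/-- Coefficient `n + 1` of a square is twice the unknown coefficient plus terms in earlier ones, so
the root is built recursively by dividing by 2. -/
theorem exists_sqrt (w : E⟦X⟧) (hw : PowerSeries.coeff 0 w = 1) :
    ∃ u : E⟦X⟧, PowerSeries.coeff 0 u = 1 ∧ u * u = w := by
  refine ⟨PowerSeries.mk (sqrtCoeff fun n => PowerSeries.coeff n w), ?_, ?_⟩
  · rw [PowerSeries.coeff_mk, sqrtCoeff]
  · have h0 : PowerSeries.coeff 0 (PowerSeries.mk (sqrtCoeff fun n => PowerSeries.coeff n w)) =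
        1 := by rw [PowerSeries.coeff_mk, sqrtCoeff]
    ext n
    rcases n with _ | n
    · rw [PowerSeries.coeff_zero_eq_constantCoeff_apply, map_mul,
        ← PowerSeries.coeff_zero_eq_constantCoeff_apply, h0, hw, one_mul]
    · rw [coeff_succ_mul_of_one _ _ h0 h0]
      simp only [PowerSeries.coeff_mk]
      rw [sqrtCoeff, ← add_smul]
      norm_num

/-- `E` is not assumed commutative, so the difference of squares does not factor. Once the lower
coefficients agree, the two squares differ in degree `n + 1` only by twice the difference of the top
coefficients. -/
theorem sqrt_unique {u v : E⟦X⟧} (hu : PowerSeries.coeff 0 u = 1)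
    (hv : PowerSeries.coeff 0 v = 1) (h : u * u = v * v) : u = v := by
  ext n
  induction n using Nat.strong_induction_on with
  | _ n ih =>
    rcases n with _ | n
    · rw [hu, hv]
    · have h' := congrArg (PowerSeries.coeff (n + 1)) h
      rw [coeff_succ_mul_of_one _ _ hu hu, coeff_succ_mul_of_one _ _ hv hv] at h'
      rw [Finset.sum_congr rfl fun i _ => by rw [ih (i + 1) (by omega), ih (n - i) (by omega)]] at h'
      have h2 : (2 : ℂ) • PowerSeries.coeff (n + 1) u = (2 : ℂ) • PowerSeries.coeff (n + 1) v := by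
        rw [two_smul, two_smul]
        exact add_right_cancel h'
      exact smul_right_injective _ (two_ne_zero : (2 : ℂ) ≠ 0) h2

end Sqrt

/-! ### Linear maps into power series as power series over a convolution algebra -/

section Conv

variable {C : Type*} [AddCommGroup C] [Module ℂ C] [Coalgebra ℂ C]
variable {R : Type*} [CommRing R] [Algebra ℂ R]

/-- A linear map into power series as a power series of linear maps. -/
noncomputable def convSeries (f : WithConv (C →ₗ[ℂ] R⟦X⟧)) : (WithConv (C →ₗ[ℂ] R))⟦X⟧ :=
  PowerSeries.mk fun n => WithConv.toConv
    ((PowerSeries.coeff n : R⟦X⟧ →ₗ[R] R).restrictScalars ℂ ∘ₗ f.ofConv)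

theorem coeff_convSeries (f : WithConv (C →ₗ[ℂ] R⟦X⟧)) (n : ℕ) (c : C) :
    (PowerSeries.coeff n (convSeries f)).ofConv c = PowerSeries.coeff n (f.ofConv c) := by
  simp [convSeries]

/-- A power series of linear maps as a linear map into power series. -/
noncomputable def ofConvSeries (f : (WithConv (C →ₗ[ℂ] R))⟦X⟧) : WithConv (C →ₗ[ℂ] R⟦X⟧) :=
  WithConv.toConv
    { toFun := fun c => PowerSeries.mk fun n => (PowerSeries.coeff n f).ofConv c
      map_add' := fun a b => by ext n; simp
      map_smul' := fun a b => by ext n; simp }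

theorem convSeries_ofConvSeries (f : (WithConv (C →ₗ[ℂ] R))⟦X⟧) :
    convSeries (ofConvSeries f) = f := by
  ext n c
  change (PowerSeries.coeff n (convSeries (ofConvSeries f))).ofConv c = _
  rw [coeff_convSeries]
  simp [ofConvSeries]

theorem convSeries_injective :
    Function.Injective (convSeries : WithConv (C →ₗ[ℂ] R⟦X⟧) → _) := by
  intro f g h
  apply WithConv.ofConv_injective
  ext c n
  rw [← coeff_convSeries, h, coeff_convSeries]

/-- The sum over the coproduct and the Cauchy sum are independent and can be exchanged. This carries
the square root argument over to convolution. -/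
theorem convSeries_mul (f g : WithConv (C →ₗ[ℂ] R⟦X⟧)) :
    convSeries (f * g) = convSeries f * convSeries g := by
  ext n c
  change (PowerSeries.coeff n (convSeries (f * g))).ofConv c =
    (PowerSeries.coeff n (convSeries f * convSeries g)).ofConv c
  rw [coeff_convSeries, PowerSeries.coeff_mul, WithConv.ofConv_sum, LinearMap.sum_apply]
  have h := (Coalgebra.Repr.arbitrary ℂ c).convMul_apply f g
  change (f * g).ofConv c = _ at h
  rw [h, map_sum]
  simp only [PowerSeries.coeff_mul]
  rw [Finset.sum_comm]
  refine Finset.sum_congr rfl fun p _ => ?_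
  have h' := (Coalgebra.Repr.arbitrary ℂ c).convMul_apply
    (PowerSeries.coeff p.1 (convSeries f)) (PowerSeries.coeff p.2 (convSeries g))
  refine Eq.trans (Finset.sum_congr rfl fun i _ => ?_) h'.symm
  exact congrArg₂ _ (coeff_convSeries _ _ _).symm (coeff_convSeries _ _ _).symm

theorem coeff_zero_convSeries {f : WithConv (C →ₗ[ℂ] R⟦X⟧)}
    (hf : ∀ c, PowerSeries.coeff 0 (f.ofConv c) =
      algebraMap ℂ R (Coalgebra.counit (R := ℂ) c)) :
    PowerSeries.coeff 0 (convSeries f) = 1 := by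
  apply WithConv.ofConv_injective
  ext c
  rw [coeff_convSeries, hf]
  rfl

/-- Only a coalgebra is required, because the lemma is used for `A` and for `A ⊗ A`. -/
theorem conv_sqrt_unique {f g : WithConv (C →ₗ[ℂ] R⟦X⟧)}
    (hf : ∀ c, PowerSeries.coeff 0 (f.ofConv c) = algebraMap ℂ R (Coalgebra.counit (R := ℂ) c))
    (hg : ∀ c, PowerSeries.coeff 0 (g.ofConv c) = algebraMap ℂ R (Coalgebra.counit (R := ℂ) c))
    (h : f * f = g * g) : f = g :=
  convSeries_injective (sqrt_unique (coeff_zero_convSeries hf) (coeff_zero_convSeries hg)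
    (by rw [← convSeries_mul, ← convSeries_mul, h]))

theorem conv_exists_sqrt (f : WithConv (C →ₗ[ℂ] R⟦X⟧))
    (hf : ∀ c, PowerSeries.coeff 0 (f.ofConv c) = algebraMap ℂ R (Coalgebra.counit (R := ℂ) c)) :
    ∃ g : WithConv (C →ₗ[ℂ] R⟦X⟧), (∀ c, PowerSeries.coeff 0 (g.ofConv c) =
      algebraMap ℂ R (Coalgebra.counit (R := ℂ) c)) ∧ g * g = f := by
  obtain ⟨w, hw, h⟩ := exists_sqrt (convSeries f) (coeff_zero_convSeries hf)
  refine ⟨ofConvSeries w, fun c => ?_, convSeries_injective ?_⟩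
  · rw [← coeff_convSeries, convSeries_ofConvSeries, hw]
    rfl
  · rw [convSeries_mul, convSeries_ofConvSeries, h]

end Conv

/-! ### Square roots in the group -/

namespace LoopGroup

variable {A : Type u} [CommRing A] [HopfAlgebra ℂ A]
variable {R : Type v} [CommRing R] [Algebra ℂ R]

theorem coeff_zero_hom (g : LoopGroup A R) (a : A) :
    PowerSeries.coeff 0 (g.hom a) = algebraMap ℂ R (Coalgebra.counit (R := ℂ) a) := by
  rw [PowerSeries.coeff_zero_eq_constantCoeff_apply, g.const]

theorem toLinearMap_mul (g h : LoopGroup A R) :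
    WithConv.toConv (g * h).hom.toLinearMap =
      WithConv.toConv g.hom.toLinearMap * WithConv.toConv h.hom.toLinearMap := rfl

theorem mul_self_injective {g h : LoopGroup A R} (H : g * g = h * h) : g = h := by
  have := conv_sqrt_unique (f := WithConv.toConv g.hom.toLinearMap)
    (g := WithConv.toConv h.hom.toLinearMap) g.coeff_zero_hom h.coeff_zero_hom
    (by rw [← toLinearMap_mul, H, toLinearMap_mul])
  exact LoopGroup.ext (AlgHom.toLinearMap_injective (WithConv.toConv_injective this))

/-- The convolution root f of g is at first only linear. Both f ∘ mul and mul ∘ (f ⊗ f) are square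
roots of g ∘ mul on the coalgebra `A ⊗ A`, so they agree and f is multiplicative. -/
theorem exists_mul_self (g : LoopGroup A R) : ∃ h : LoopGroup A R, h * h = g := by
  obtain ⟨f, hf, hfg⟩ := conv_exists_sqrt (WithConv.toConv g.hom.toLinearMap) g.coeff_zero_hom
  -- The element `1` is group-like, so `f 1` is a square root of `1` with constant term `1`.
  have hone : f.ofConv 1 = 1 := by
    apply sqrt_unique
    · rw [hf]; simp
    · simp
    · have : (f * f).ofConv 1 = f.ofConv 1 * f.ofConv 1 := by
        change LinearMap.mul' ℂ _ (TensorProduct.map f.ofConv f.ofConv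
          (Coalgebra.comul (R := ℂ) (1 : A))) = _
        rw [Bialgebra.comul_one, Algebra.TensorProduct.one_def]
        simp
      rw [← this, hfg, one_mul]
      exact map_one g.hom
  have hmul : f.ofConv ∘ₗ LinearMap.mul' ℂ A =
      LinearMap.mul' ℂ R⟦X⟧ ∘ₗ TensorProduct.map f.ofConv f.ofConv := by
    -- Squares can be computed before or after multiplication on either side: the product of `A` is
    -- a coalgebra map, and the product of the commutative ring `R⟦X⟧` is an algebra map.
    have h1 := LinearMap.convMul_comp_coalgHom_distrib f f (Bialgebra.mulCoalgHom ℂ A)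
    have h2 := LinearMap.algHom_comp_convMul_distrib (Algebra.TensorProduct.lmul' ℂ (S := R⟦X⟧))
      (WithConv.toConv (TensorProduct.map f.ofConv f.ofConv))
      (WithConv.toConv (TensorProduct.map f.ofConv f.ofConv))
    rw [TensorProduct.map_convMul_map] at h2
    refine WithConv.toConv_injective (conv_sqrt_unique (f := WithConv.toConv (f.ofConv ∘ₗ LinearMap.mul' ℂ A))
      (g := WithConv.toConv (LinearMap.mul' ℂ R⟦X⟧ ∘ₗ TensorProduct.map f.ofConv f.ofConv)) ?_ ?_ ?_)
    · intro c
      change PowerSeries.coeff 0 (f.ofConv (LinearMap.mul' ℂ A c)) = _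
      rw [hf]
      congr 1
      exact LinearMap.congr_fun (Bialgebra.mulCoalgHom ℂ A).counit_comp c
    · intro c
      induction c with
      | zero => simp
      | add x y hx hy => simp only [map_add, hx, hy]
      | tmul a b =>
        change PowerSeries.coeff 0 (f.ofConv a * f.ofConv b) = _
        rw [PowerSeries.coeff_zero_eq_constantCoeff_apply, map_mul,
          ← PowerSeries.coeff_zero_eq_constantCoeff_apply, hf,
          ← PowerSeries.coeff_zero_eq_constantCoeff_apply, hf, TensorProduct.counit_tmul]
        simp [mul_comm]
    · apply WithConv.ofConv_injective
      refine h1.symm.trans (Eq.trans ?_ h2)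
      rw [hfg]
      ext a b : 3
      simp [Bialgebra.mulCoalgHom]
  refine ⟨⟨AlgHom.ofLinearMap f.ofConv hone fun a b => LinearMap.congr_fun hmul (a ⊗ₜ b),
    fun a => by rw [← PowerSeries.coeff_zero_eq_constantCoeff_apply]; exact hf a⟩, ?_⟩
  apply LoopGroup.ext
  apply AlgHom.toLinearMap_injective
  exact congrArg WithConv.ofConv hfg

/-- The square root of an element of `G₁[[z⁻¹]](R)`. -/
noncomputable def sqrt (g : LoopGroup A R) : LoopGroup A R := (exists_mul_self g).choose

theorem sqrt_mul_sqrt (g : LoopGroup A R) : sqrt g * sqrt g = g := (exists_mul_self g).choose_spec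

/-- The root is obtained by choice, so naturality in `R` is not built in; it comes from uniqueness.
It is what turns √ into a morphism of schemes. -/
theorem map_sqrt {S : Type w} [CommRing S] [Algebra ℂ S] (f : R →ₐ[ℂ] S) (g : LoopGroup A R) :
    map f (sqrt g) = sqrt (map f g) :=
  mul_self_injective (by rw [← map_mul, sqrt_mul_sqrt, sqrt_mul_sqrt])

/-- An anti-automorphism still sends squares to squares, the two factors being equal. -/
theorem sigma_sqrt (θ : GroupInvolution A) (g : LoopGroup A R) :
    sigma θ R (sqrt g) = sqrt (sigma θ R g) :=
  mul_self_injective (by rw [← sigma_mul, sqrt_mul_sqrt, sqrt_mul_sqrt])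

end LoopGroup


theorem FixedRing.mk_surjective {B : Type u} [CommRing B] [Algebra ℂ B] (s : B →ₐ[ℂ] B) :
    Function.Surjective (FixedRing.mk s) :=
  Ideal.Quotient.mk_surjective

theorem FixedRing.algHom_ext {B : Type u} [CommRing B] [Algebra ℂ B] {s : B →ₐ[ℂ] B}
    {R : Type v} [CommRing R] [Algebra ℂ R] {F F' : FixedRing s →ₐ[ℂ] R}
    (h : F.comp (FixedRing.mk s) = F'.comp (FixedRing.mk s)) : F = F' := by
  ext c
  obtain ⟨b, rfl⟩ := FixedRing.mk_surjective s c
  exact DFunLike.congr_fun h b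

theorem FixedRing.lift_comp_mk {B : Type u} [CommRing B] [Algebra ℂ B] (s : B →ₐ[ℂ] B)
    {R : Type v} [CommRing R] [Algebra ℂ R] (F : B →ₐ[ℂ] R) (hF : F.comp s = F) :
    (FixedRing.lift s F hF).comp (FixedRing.mk s) = F := rfl

/-! ### Universal points of the fixed-point schemes -/

section Points

variable {A : Type u} [CommRing A] [HopfAlgebra ℂ A] (θ : GroupInvolution A)
variable {R : Type v} [CommRing R] [Algebra ℂ R]

theorem LoopGroup.map_comp {S : Type w} [CommRing S] [Algebra ℂ S] {T : Type*} [CommRing T]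
    [Algebra ℂ T] (f : R →ₐ[ℂ] S) (f' : S →ₐ[ℂ] T) (g : LoopGroup A R) :
    LoopGroup.map f' (LoopGroup.map f g) = LoopGroup.map (f'.comp f) g :=
  (LoopRing.map_comp f f' g).symm

theorem LoopGroup.map_id (g : LoopGroup A R) : LoopGroup.map (AlgHom.id ℂ R) g = g := by
  apply LoopGroup.ext'; intro a; ext n
  rw [LoopRing.coeff_map_hom, AlgHom.id_apply]

theorem LoopRing.lift_comp_omega (g : LoopGroup A R) :
    (LoopRing.lift g).comp (LoopRing.omega θ) = LoopRing.lift (LoopGroup.omega θ R g) := by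
  rw [LoopRing.omega, LoopRing.comp_lift, LoopGroup.map_omega, LoopRing.map_lift_univ]

theorem LoopRing.map_comul_univ : LoopGroup.map (LoopRing.comul A) LoopRing.univ =
    LoopGroup.map Algebra.TensorProduct.includeLeft LoopRing.univ *
      LoopGroup.map Algebra.TensorProduct.includeRight LoopRing.univ :=
  LoopRing.map_lift_univ _

theorem LoopRing.map_sigma_univ : LoopGroup.map (LoopRing.sigma θ) LoopRing.univ =
    LoopGroup.sigma θ (LoopRing A) LoopRing.univ :=
  LoopRing.map_lift_univ _

/-- The homomorphism out of `ℂ[G₁[[z⁻¹]]^σ]` corresponding to a `σ`-fixed point. -/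
noncomputable def sigmaLift (p : LoopGroup A R) (hp : LoopGroup.sigma θ R p = p) : SigmaRing θ →ₐ[ℂ] R :=
  FixedRing.lift (LoopRing.sigma θ) (LoopRing.lift p) (by rw [LoopRing.lift_comp_sigma, hp])

/-- The homomorphism out of `ℂ[G₁[[z⁻¹]]^ω]` corresponding to an `ω`-fixed point. -/
noncomputable def omegaLift (k : LoopGroup A R) (hk : LoopGroup.omega θ R k = k) : OmegaRing θ →ₐ[ℂ] R :=
  FixedRing.lift (LoopRing.omega θ) (LoopRing.lift k) (by rw [LoopRing.lift_comp_omega, hk])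

/-- The universal point of `G₁[[z⁻¹]]^ω`. -/
noncomputable def univOmega : LoopGroup A (OmegaRing θ) :=
  LoopGroup.map (FixedRing.mk (LoopRing.omega θ)) LoopRing.univ

theorem omega_univOmega : LoopGroup.omega θ _ (univOmega θ) = univOmega θ := by
  have h1 : LoopGroup.map (LoopRing.omega θ) LoopRing.univ = LoopGroup.omega θ (LoopRing A) LoopRing.univ :=
    LoopRing.map_lift_univ _
  rw [univOmega, ← LoopGroup.map_omega, ← h1, LoopGroup.map_comp, FixedRing.mk_comp]

theorem sigma_map_univSigma (F : SigmaRing θ →ₐ[ℂ] R) :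
    LoopGroup.sigma θ R (LoopGroup.map F (univSigma θ)) = LoopGroup.map F (univSigma θ) := by
  rw [← LoopGroup.map_sigma, sigma_univSigma]

theorem omega_map_univOmega (F : OmegaRing θ →ₐ[ℂ] R) :
    LoopGroup.omega θ R (LoopGroup.map F (univOmega θ)) = LoopGroup.map F (univOmega θ) := by
  rw [← LoopGroup.map_omega, omega_univOmega]

theorem map_sigmaLift (p : LoopGroup A R) (hp : LoopGroup.sigma θ R p = p) :
    LoopGroup.map (sigmaLift θ p hp) (univSigma θ) = p := by
  rw [univSigma, LoopGroup.map_comp, sigmaLift, FixedRing.lift_comp_mk, LoopRing.map_lift_univ]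

theorem map_omegaLift (k : LoopGroup A R) (hk : LoopGroup.omega θ R k = k) :
    LoopGroup.map (omegaLift θ k hk) (univOmega θ) = k := by
  rw [univOmega, LoopGroup.map_comp, omegaLift, FixedRing.lift_comp_mk, LoopRing.map_lift_univ]

variable {θ} in
-- The Yoneda principle for the σ-fixed scheme: identities between comorphisms reduce to identities
-- in the group, evaluated at the universal point.
theorem sigmaRing_algHom_ext {F F' : SigmaRing θ →ₐ[ℂ] R}
    (h : LoopGroup.map F (univSigma θ) = LoopGroup.map F' (univSigma θ)) : F = F' := by
  apply FixedRing.algHom_ext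
  apply LoopRing.algHom_ext
  rwa [univSigma, LoopGroup.map_comp, LoopGroup.map_comp] at h

variable {θ} in
theorem omegaRing_algHom_ext {F F' : OmegaRing θ →ₐ[ℂ] R}
    (h : LoopGroup.map F (univOmega θ) = LoopGroup.map F' (univOmega θ)) : F = F' := by
  apply FixedRing.algHom_ext
  apply LoopRing.algHom_ext
  rwa [univOmega, LoopGroup.map_comp, LoopGroup.map_comp] at h

/-! ### The factorization `g = p k` on points -/

/-- The `σ`-fixed factor of `g`, the square root of `g σ(g)`. -/
noncomputable def sigmaPart (g : LoopGroup A R) : LoopGroup A R := LoopGroup.sqrt (g * LoopGroup.sigma θ R g)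

/-- The `ω`-fixed factor of `g`. -/
noncomputable def omegaPart (g : LoopGroup A R) : LoopGroup A R := (sigmaPart θ g)⁻¹ * g

theorem sigma_sigmaPart (g : LoopGroup A R) : LoopGroup.sigma θ R (sigmaPart θ g) = sigmaPart θ g := by
  rw [sigmaPart, LoopGroup.sigma_sqrt, LoopGroup.sigma_mul, LoopGroup.sigma_sigma]

/-- For the σ-fixed factor p one has ω(p) = p⁻¹ and p² = g ω(g)⁻¹. Therefore ω(p⁻¹ g) = p ω(g) = p⁻¹
g. -/
theorem omega_omegaPart (g : LoopGroup A R) : LoopGroup.omega θ R (omegaPart θ g) = omegaPart θ g := by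
  have h1 := sigma_sigmaPart θ g
  have h2 : sigmaPart θ g * sigmaPart θ g = g * (LoopGroup.omega θ R g)⁻¹ := LoopGroup.sqrt_mul_sqrt _
  have h3 : LoopGroup.omega θ R (sigmaPart θ g) = (sigmaPart θ g)⁻¹ := by
    rw [← inv_inj, inv_inv]; exact h1
  rw [omegaPart, map_mul, map_inv, h3, inv_inv]
  have h4 : sigmaPart θ g * (sigmaPart θ g * LoopGroup.omega θ R g) = g := by
    rw [← mul_assoc, h2, inv_mul_cancel_right]
  exact eq_inv_mul_of_mul_eq h4

theorem sigmaPart_mul_omegaPart (g : LoopGroup A R) : sigmaPart θ g * omegaPart θ g = g :=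
  mul_inv_cancel_left _ _

/-- An ω-fixed k satisfies σ(k) = k⁻¹, so it cancels. Since square roots are unique, p is recovered
from p k, which is the uniqueness of the factorization. -/
theorem mul_sigma_of_fixed {p k : LoopGroup A R} (hp : LoopGroup.sigma θ R p = p) (hk : LoopGroup.omega θ R k = k) :
    p * k * LoopGroup.sigma θ R (p * k) = p * p := by
  rw [LoopGroup.sigma_mul, hp, show LoopGroup.sigma θ R k = k⁻¹ by rw [LoopGroup.sigma, hk]]
  group

theorem sigmaPart_mul_of_fixed {p k : LoopGroup A R} (hp : LoopGroup.sigma θ R p = p)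
    (hk : LoopGroup.omega θ R k = k) : sigmaPart θ (p * k) = p := by
  apply LoopGroup.mul_self_injective
  rw [sigmaPart, LoopGroup.sqrt_mul_sqrt, mul_sigma_of_fixed θ hp hk]

theorem omegaPart_mul_of_fixed {p k : LoopGroup A R} (hp : LoopGroup.sigma θ R p = p)
    (hk : LoopGroup.omega θ R k = k) : omegaPart θ (p * k) = k := by
  rw [omegaPart, sigmaPart_mul_of_fixed θ hp hk, inv_mul_cancel_left]

theorem map_sigmaPart {S : Type w} [CommRing S] [Algebra ℂ S] (f : R →ₐ[ℂ] S)
    (g : LoopGroup A R) : LoopGroup.map f (sigmaPart θ g) = sigmaPart θ (LoopGroup.map f g) := by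
  rw [sigmaPart, LoopGroup.map_sqrt, map_mul, LoopGroup.map_sigma, sigmaPart]

theorem map_omegaPart {S : Type w} [CommRing S] [Algebra ℂ S] (f : R →ₐ[ℂ] S)
    (g : LoopGroup A R) : LoopGroup.map f (omegaPart θ g) = omegaPart θ (LoopGroup.map f g) := by
  rw [omegaPart, map_mul, map_inv, map_sigmaPart, omegaPart]

/-- The root of a σ-fixed point is σ-fixed, so its square has the form g σ(g). This is the source of
transitivity. -/
theorem exists_eq_mul_sigma {p : LoopGroup A R} (hp : LoopGroup.sigma θ R p = p) :
    ∃ g : LoopGroup A R, g * LoopGroup.sigma θ R g = p :=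
  ⟨LoopGroup.sqrt p, by rw [LoopGroup.sigma_sqrt, hp, LoopGroup.sqrt_mul_sqrt]⟩

theorem exists_smul_one (p : LoopGroup.SigmaFixed θ R) :
    ∃ g : LoopGroup A R, g • (1 : LoopGroup.SigmaFixed θ R) = p := by
  obtain ⟨g, hg⟩ := exists_eq_mul_sigma θ p.fixed
  refine ⟨g, LoopGroup.SigmaFixed.ext ?_⟩
  change g * 1 * LoopGroup.sigma θ R g = _
  rw [mul_one, hg]

theorem isPretransitive_sigmaFixed (R : Type v) [CommRing R] [Algebra ℂ R] :
    MulAction.IsPretransitive (LoopGroup A R) (LoopGroup.SigmaFixed θ R) := by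
  refine ⟨fun p q => ?_⟩
  obtain ⟨g, rfl⟩ := exists_smul_one θ p
  obtain ⟨h, rfl⟩ := exists_smul_one θ q
  exact ⟨h * g⁻¹, by rw [mul_smul, inv_smul_smul]⟩

theorem orbitMap_mk (g : LoopGroup A R) :
    LoopGroup.orbitMap θ R (QuotientGroup.mk g) = g • (1 : LoopGroup.SigmaFixed θ R) := rfl

/-- Injectivity: g ω(g)⁻¹ = k ω(k)⁻¹ says precisely that g⁻¹ k is ω-fixed. Surjectivity is the
square root. -/
theorem orbitMap_bijective (R : Type v) [CommRing R] [Algebra ℂ R] :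
    Function.Bijective (LoopGroup.orbitMap (A := A) θ R) := by
  constructor
  · intro q q' h
    induction q using QuotientGroup.induction_on with | _ g
    induction q' using QuotientGroup.induction_on with | _ k
    rw [orbitMap_mk, orbitMap_mk] at h
    have h' : g * 1 * (LoopGroup.omega θ R g)⁻¹ = k * 1 * (LoopGroup.omega θ R k)⁻¹ :=
      congrArg LoopGroup.SigmaFixed.val h
    rw [QuotientGroup.eq]
    change LoopGroup.omega θ R (g⁻¹ * k) = g⁻¹ * k
    rw [mul_one, mul_one, mul_inv_eq_iff_eq_mul, mul_assoc] at h'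
    rw [map_mul, map_inv, eq_inv_mul_iff_mul_eq]
    nth_rewrite 1 [h']
    group
  · intro p
    obtain ⟨g, rfl⟩ := exists_smul_one θ p
    exact ⟨QuotientGroup.mk g, rfl⟩

theorem orbitMap_smul (g : LoopGroup A R) (q : LoopGroup A R ⧸ LoopGroup.omegaFixed θ R) :
    LoopGroup.orbitMap θ R (g • q) = g • LoopGroup.orbitMap θ R q := by
  induction q using QuotientGroup.induction_on with | _ h
  rw [orbitMap_mk, ← mul_smul, ← orbitMap_mk]
  rfl

/-! ### The corresponding statements for coordinate rings -/

theorem map_mulComorphism_univ : LoopGroup.map (mulComorphism θ) LoopRing.univ =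
    LoopGroup.map Algebra.TensorProduct.includeLeft (univSigma θ) *
      LoopGroup.map Algebra.TensorProduct.includeRight (univOmega θ) := by
  rw [mulComorphism, LoopRing.map_comp, LoopRing.map_comul_univ, map_mul, univSigma, univOmega]
  simp only [LoopGroup.map_comp, Algebra.TensorProduct.map_comp_includeLeft,
    Algebra.TensorProduct.map_comp_includeRight]

/-- The comorphism of the factorization `g ↦ (p, k)`. -/
noncomputable def factorComorphism : SigmaRing θ ⊗[ℂ] OmegaRing θ →ₐ[ℂ] LoopRing A :=
  Algebra.TensorProduct.productMap
    (sigmaLift θ (sigmaPart θ LoopRing.univ) (sigma_sigmaPart θ _))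
    (omegaLift θ (omegaPart θ LoopRing.univ) (omega_omegaPart θ _))

/-- The inverse is given by the factorization of the universal point. Both composites are computed
on universal points, using that the factors commute with base change. -/
theorem mulComorphism_bijective : Function.Bijective (mulComorphism θ) := by
  have h1 : (factorComorphism θ).comp (mulComorphism θ) = AlgHom.id ℂ _ := by
    apply LoopRing.algHom_ext
    rw [LoopRing.map_comp, map_mulComorphism_univ, map_mul, LoopGroup.map_comp,
      LoopGroup.map_comp, factorComorphism, Algebra.TensorProduct.productMap_left,
      Algebra.TensorProduct.productMap_right, map_sigmaLift, map_omegaLift,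
      sigmaPart_mul_omegaPart, LoopGroup.map_id]
  have h2 : (mulComorphism θ).comp (factorComorphism θ) = AlgHom.id ℂ _ := by
    apply Algebra.TensorProduct.ext
    · apply sigmaRing_algHom_ext
      change LoopGroup.map (((mulComorphism θ).comp (factorComorphism θ)).comp
        Algebra.TensorProduct.includeLeft) _ = LoopGroup.map Algebra.TensorProduct.includeLeft _
      rw [factorComorphism, AlgHom.comp_assoc, Algebra.TensorProduct.productMap_left,
        ← LoopGroup.map_comp, map_sigmaLift, map_sigmaPart, map_mulComorphism_univ,
        sigmaPart_mul_of_fixed θ (sigma_map_univSigma θ _)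
          (omega_map_univOmega θ _)]
    · apply omegaRing_algHom_ext
      change LoopGroup.map (((mulComorphism θ).comp (factorComorphism θ)).comp
        Algebra.TensorProduct.includeRight) _ = LoopGroup.map Algebra.TensorProduct.includeRight _
      rw [factorComorphism, AlgHom.comp_assoc, Algebra.TensorProduct.productMap_right,
        ← LoopGroup.map_comp, map_omegaLift, map_omegaPart, map_mulComorphism_univ,
        omegaPart_mul_of_fixed θ (sigma_map_univSigma θ _)
          (omega_map_univOmega θ _)]
  exact Function.bijective_iff_has_inverse.2
    ⟨factorComorphism θ, DFunLike.congr_fun h1, DFunLike.congr_fun h2⟩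

theorem map_orbitComorphism : LoopGroup.map (orbitComorphism θ) (univSigma θ) =
    LoopRing.univ * LoopGroup.sigma θ _ LoopRing.univ := by
  rw [univSigma, LoopGroup.map_comp, orbitComorphism, FixedRing.lift_comp_mk,
    LoopRing.map_lift_univ]

theorem map_coaction : LoopGroup.map (coaction θ) (univSigma θ) =
    LoopGroup.map Algebra.TensorProduct.includeLeft LoopRing.univ *
      LoopGroup.map Algebra.TensorProduct.includeRight (univSigma θ) *
      LoopGroup.sigma θ _ (LoopGroup.map Algebra.TensorProduct.includeLeft LoopRing.univ) := by
  rw [univSigma, LoopGroup.map_comp, coaction, FixedRing.lift_comp_mk, LoopRing.map_lift_univ,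
    univSigma]

/-- The comorphism of the section `p ↦ √p` of the orbit map. -/
noncomputable def sectionComorphism : LoopRing A →ₐ[ℂ] SigmaRing θ :=
  LoopRing.lift (LoopGroup.sqrt (univSigma θ))

/-- On points: √p σ(√p) = p when p is σ-fixed. -/
theorem sectionComorphism_comp_orbitComorphism :
    (sectionComorphism θ).comp (orbitComorphism θ) = AlgHom.id ℂ _ := by
  apply sigmaRing_algHom_ext
  rw [← LoopGroup.map_comp, map_orbitComorphism, map_mul, LoopGroup.map_sigma, sectionComorphism,
    LoopRing.map_lift_univ, LoopGroup.sigma_sqrt, sigma_univSigma, LoopGroup.sqrt_mul_sqrt,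
    LoopGroup.map_id]

theorem orbitComorphism_injective : Function.Injective (orbitComorphism θ) :=
  Function.LeftInverse.injective (g := sectionComorphism θ)
    (DFunLike.congr_fun (sectionComorphism_comp_orbitComorphism θ))

theorem map_right_translation : LoopGroup.map ((Algebra.TensorProduct.map (AlgHom.id ℂ (LoopRing A))
      (FixedRing.mk (LoopRing.omega θ))).comp (LoopRing.comul A)) LoopRing.univ =
    LoopGroup.map Algebra.TensorProduct.includeLeft LoopRing.univ *
      LoopGroup.map Algebra.TensorProduct.includeRight (univOmega θ) := by
  rw [LoopRing.map_comp, LoopRing.map_comul_univ, map_mul, univOmega]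
  simp only [LoopGroup.map_comp, Algebra.TensorProduct.map_comp_includeLeft,
    Algebra.TensorProduct.map_comp_includeRight, AlgHom.comp_id]

/-- For k in the ω-fixed subgroup, g k σ(k) σ(g) = g σ(g). -/
theorem orbitComorphism_mem (c : SigmaRing θ) : orbitComorphism θ c ∈ invariants θ := by
  have h : ((Algebra.TensorProduct.map (AlgHom.id ℂ (LoopRing A))
      (FixedRing.mk (LoopRing.omega θ))).comp (LoopRing.comul A)).comp (orbitComorphism θ) =
      (Algebra.TensorProduct.includeLeft : LoopRing A →ₐ[ℂ] LoopRing A ⊗[ℂ] OmegaRing θ).comp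
        (orbitComorphism θ) := by
    apply sigmaRing_algHom_ext
    rw [← LoopGroup.map_comp, map_orbitComorphism, map_mul, LoopGroup.map_sigma,
      map_right_translation, ← LoopGroup.map_comp, map_orbitComorphism, map_mul,
      LoopGroup.map_sigma, LoopGroup.sigma_mul]
    rw [show LoopGroup.sigma θ (LoopRing A ⊗[ℂ] OmegaRing θ) (LoopGroup.map
      Algebra.TensorProduct.includeRight (univOmega θ)) = (LoopGroup.map
      Algebra.TensorProduct.includeRight (univOmega θ))⁻¹ from
      congrArg _ (omega_map_univOmega θ _)]
    group
  exact DFunLike.congr_fun h c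

/-- An invariant f satisfies f(g) = f(p k) = f(p), and p = √(g σ(g)) depends only on the image of g
under the orbit map. -/
theorem orbitComorphism_section {f : LoopRing A} (hf : f ∈ invariants θ) :
    orbitComorphism θ (sectionComorphism θ f) = f := by
  have h1 : (orbitComorphism θ).comp (sectionComorphism θ) =
      LoopRing.lift (sigmaPart θ LoopRing.univ) := by
    rw [sectionComorphism, LoopRing.comp_lift, LoopGroup.map_sqrt, map_orbitComorphism, sigmaPart]
  -- This is f(p k) = f(g) for all f. For an invariant f the coproduct restricted to k is `f ⊗ₜ 1`,
  -- so the left side becomes f(p).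
  have h2 : ((Algebra.TensorProduct.productMap (LoopRing.lift (sigmaPart θ LoopRing.univ))
      (omegaLift θ (omegaPart θ LoopRing.univ) (omega_omegaPart θ _))).comp
      (Algebra.TensorProduct.map (AlgHom.id ℂ (LoopRing A))
        (FixedRing.mk (LoopRing.omega θ)))).comp (LoopRing.comul A) =
      AlgHom.id ℂ (LoopRing A) := by
    apply LoopRing.algHom_ext
    rw [AlgHom.comp_assoc, ← LoopGroup.map_comp, map_right_translation, map_mul,
      LoopGroup.map_comp, LoopGroup.map_comp, Algebra.TensorProduct.productMap_left,
      Algebra.TensorProduct.productMap_right, map_omegaLift, LoopRing.map_lift_univ,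
      sigmaPart_mul_omegaPart, LoopGroup.map_id]
  have hf' : Algebra.TensorProduct.map (AlgHom.id ℂ (LoopRing A))
      (FixedRing.mk (LoopRing.omega θ)) (LoopRing.comul A f) = f ⊗ₜ 1 := hf
  have h3 := DFunLike.congr_fun h2 f
  simp only [AlgHom.comp_apply, hf', Algebra.TensorProduct.productMap_apply_tmul, map_one,
    mul_one, AlgHom.id_apply] at h3
  exact (DFunLike.congr_fun h1 f).trans h3

/-- On points: (g h) σ(g h) = g (h σ(h)) σ(g). -/
theorem comul_orbitComorphism (c : SigmaRing θ) :
    LoopRing.comul A (orbitComorphism θ c) =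
      Algebra.TensorProduct.map (AlgHom.id ℂ (LoopRing A)) (orbitComorphism θ)
        (coaction θ c) := by
  have h : (LoopRing.comul A).comp (orbitComorphism θ) =
      (Algebra.TensorProduct.map (AlgHom.id ℂ (LoopRing A)) (orbitComorphism θ)).comp
        (coaction θ) := by
    apply sigmaRing_algHom_ext
    rw [← LoopGroup.map_comp, ← LoopGroup.map_comp, map_orbitComorphism, map_coaction, map_mul,
      map_mul, map_mul, LoopGroup.map_sigma, LoopGroup.map_sigma, LoopRing.map_comul_univ,
      LoopGroup.map_comp, LoopGroup.map_comp, Algebra.TensorProduct.map_comp_includeLeft,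
      Algebra.TensorProduct.map_comp_includeRight, AlgHom.comp_id, LoopGroup.sigma_mul,
      ← LoopGroup.map_comp, map_orbitComorphism, map_mul, LoopGroup.map_sigma]
    simp only [mul_assoc]
  exact DFunLike.congr_fun h c

/-- Pullback along `g ↦ g σ(g)`, as an isomorphism onto the ring of invariants. -/
noncomputable def orbitEquiv : SigmaRing θ ≃ₐ[ℂ] invariants θ :=
  AlgEquiv.ofBijective ((orbitComorphism θ).codRestrict (invariants θ) (orbitComorphism_mem θ))
    ⟨fun _ _ h => orbitComorphism_injective θ (congrArg Subtype.val h),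
      fun f => ⟨sectionComorphism θ f, Subtype.ext (orbitComorphism_section θ f.2)⟩⟩

theorem coe_orbitEquiv (c : SigmaRing θ) : (orbitEquiv θ c : LoopRing A) = orbitComorphism θ c :=
  rfl

end Points


/-! ### Derivations along a homomorphism -/

section DerivAlong

variable {B : Type*} [CommRing B] [Algebra ℂ B] {S : Type*} [CommRing S] [Algebra ℂ S]

/-- `D` is a derivation along the homomorphism `φ`. -/
def IsDerivAlong (φ : B →ₐ[ℂ] S) (D : B →ₗ[ℂ] S) : Prop :=
  ∀ f g, D (f * g) = φ f * D g + φ g * D f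

theorem IsDerivAlong.map_one {φ : B →ₐ[ℂ] S} {D : B →ₗ[ℂ] S} (h : IsDerivAlong φ D) :
    D 1 = 0 := by
  have := h 1 1
  simpa using this

theorem IsDerivAlong.map_algebraMap {φ : B →ₐ[ℂ] S} {D : B →ₗ[ℂ] S} (h : IsDerivAlong φ D)
    (c : ℂ) : D (algebraMap ℂ B c) = 0 := by
  rw [Algebra.algebraMap_eq_smul_one, map_smul, h.map_one, smul_zero]

theorem IsDerivAlong.add {φ : B →ₐ[ℂ] S} {D D' : B →ₗ[ℂ] S} (h : IsDerivAlong φ D)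
    (h' : IsDerivAlong φ D') : IsDerivAlong φ (D + D') := fun f g => by
  rw [LinearMap.add_apply, h, h']; simp only [LinearMap.add_apply]; ring

theorem IsDerivAlong.smul {φ : B →ₐ[ℂ] S} {D : B →ₗ[ℂ] S} (h : IsDerivAlong φ D) (c : ℂ) :
    IsDerivAlong φ (c • D) := fun f g => by
  rw [LinearMap.smul_apply, h, smul_add]
  simp only [LinearMap.smul_apply, mul_smul_comm]

theorem IsDerivAlong.sum {ι : Type*} (s : Finset ι) {φ : B →ₐ[ℂ] S} {D : ι → B →ₗ[ℂ] S}
    (h : ∀ i ∈ s, IsDerivAlong φ (D i)) : IsDerivAlong φ (∑ i ∈ s, D i) := fun f g => by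
  simp only [LinearMap.sum_apply]
  rw [Finset.mul_sum, Finset.mul_sum, ← Finset.sum_add_distrib]
  exact Finset.sum_congr rfl fun i hi => h i hi f g

theorem IsDerivAlong.mulLeft {φ : B →ₐ[ℂ] S} {D : B →ₗ[ℂ] S} (h : IsDerivAlong φ D) (c : S) :
    IsDerivAlong φ (LinearMap.mulLeft ℂ c ∘ₗ D) := fun f g => by
  simp only [LinearMap.comp_apply, LinearMap.mulLeft_apply]
  rw [h]; ring

end DerivAlong

/-! ### Partial evaluation of tensors -/

section Slice

variable {V H : Type*} [CommRing V] [Algebra ℂ V] [CommRing H] [Algebra ℂ H]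

/-- Apply a functional to the right tensor factor. -/
noncomputable def rslice (ξ : H →ₗ[ℂ] ℂ) : V ⊗[ℂ] H →ₗ[ℂ] V :=
  (TensorProduct.rid ℂ V).toLinearMap ∘ₗ LinearMap.lTensor V ξ

/-- Apply a functional to the left tensor factor. -/
noncomputable def lslice (ξ : H →ₗ[ℂ] ℂ) : H ⊗[ℂ] V →ₗ[ℂ] V :=
  (TensorProduct.lid ℂ V).toLinearMap ∘ₗ LinearMap.rTensor V ξ

@[simp] theorem rslice_tmul (ξ : H →ₗ[ℂ] ℂ) (a : V) (b : H) :
    rslice ξ (a ⊗ₜ[ℂ] b) = ξ b • a := by simp [rslice]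

@[simp] theorem lslice_tmul (ξ : H →ₗ[ℂ] ℂ) (a : H) (b : V) :
    lslice ξ (a ⊗ₜ[ℂ] b) = ξ a • b := by simp [lslice]

/-- Composed with a coproduct, slicing by the counit is the identity. This lemma is then the Leibniz
rule of the invariant vector field attached to a point derivation. -/
theorem rslice_mul {ε : H →ₐ[ℂ] ℂ} {ξ : H →ₗ[ℂ] ℂ} (hξ : IsDerivAlong ε ξ) (s t : V ⊗[ℂ] H) :
    rslice ξ (s * t) = rslice ε.toLinearMap s * rslice ξ t +
      rslice ε.toLinearMap t * rslice ξ s := by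
  induction s with
  | zero => simp
  | add s s' h h' => rw [add_mul, map_add, h, h']; simp only [map_add]; ring
  | tmul a b =>
    induction t with
    | zero => simp
    | add t t' h h' => rw [mul_add, map_add, h, h']; simp only [map_add]; ring
    | tmul c d =>
      simp only [Algebra.TensorProduct.tmul_mul_tmul, rslice_tmul, hξ b d, AlgHom.toLinearMap_apply,
        smul_mul_smul_comm, add_smul]
      rw [mul_comm c a]

theorem lslice_mul {ε : H →ₐ[ℂ] ℂ} {ξ : H →ₗ[ℂ] ℂ} (hξ : IsDerivAlong ε ξ) (s t : H ⊗[ℂ] V) :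
    lslice ξ (s * t) = lslice ε.toLinearMap s * lslice ξ t +
      lslice ε.toLinearMap t * lslice ξ s := by
  induction s with
  | zero => simp
  | add s s' h h' => rw [add_mul, map_add, h, h']; simp only [map_add]; ring
  | tmul a b =>
    induction t with
    | zero => simp
    | add t t' h h' => rw [mul_add, map_add, h, h']; simp only [map_add]; ring
    | tmul c d =>
      simp only [Algebra.TensorProduct.tmul_mul_tmul, lslice_tmul, hξ a c, AlgHom.toLinearMap_apply,
        smul_mul_smul_comm, add_smul]
      rw [mul_comm d b]

end Slice

/-! ### Generators of the coordinate ring -/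

namespace LoopRing

variable {A : Type u} [CommRing A] [HopfAlgebra ℂ A]

theorem induction {p : LoopRing A → Prop} (hC : ∀ c, p (algebraMap ℂ _ c))
    (hgen : ∀ a n, p (gen a n)) (hadd : ∀ f g, p f → p g → p (f + g))
    (hmul : ∀ f g, p f → p g → p (f * g)) (f : LoopRing A) : p f := by
  obtain ⟨r, rfl⟩ : ∃ r, proj A r = f := Ideal.Quotient.mk_surjective f
  induction r using MvPolynomial.induction_on with
  | C c =>
    rw [← MvPolynomial.algebraMap_eq, AlgHom.commutes]
    exact hC c
  | add r s hr hs => rw [map_add]; exact hadd _ _ hr hs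
  | mul_X r i hr => rw [map_mul]; exact hmul _ _ hr (hgen i.1 i.2)

theorem derivAlong_ext {S : Type*} [CommRing S] [Algebra ℂ S] {φ : LoopRing A →ₐ[ℂ] S}
    {D D' : LoopRing A →ₗ[ℂ] S} (hD : IsDerivAlong φ D) (hD' : IsDerivAlong φ D')
    (h : ∀ a n, D (gen a n) = D' (gen a n)) : D = D' := by
  ext f
  induction f using LoopRing.induction with
  | hC c => rw [hD.map_algebraMap, hD'.map_algebraMap]
  | hgen a n => exact h a n
  | hadd f g hf hg => rw [map_add, map_add, hf, hg]
  | hmul f g hf hg => rw [hD, hD', hf, hg]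

theorem bideriv_ext {S : Type*} [CommRing S] [Algebra ℂ S] {φ : LoopRing A →ₐ[ℂ] S}
    {T T' : LoopRing A →ₗ[ℂ] LoopRing A →ₗ[ℂ] S} (h1 : ∀ f, IsDerivAlong φ (T f))
    (h2 : ∀ f, IsDerivAlong φ (T.flip f)) (h1' : ∀ f, IsDerivAlong φ (T' f))
    (h2' : ∀ f, IsDerivAlong φ (T'.flip f))
    (h : ∀ a m b n, T (gen a m) (gen b n) = T' (gen a m) (gen b n)) : T = T' := by
  have key : ∀ b n, T.flip (gen b n) = T'.flip (gen b n) := fun b n =>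
    derivAlong_ext (h2 _) (h2' _) fun a m => h a m b n
  ext f : 1
  exact derivAlong_ext (h1 f) (h1' f) fun b n => LinearMap.congr_fun (key b n) f

variable (A) in
/-- `a ↦ a⁽ⁿ⁾` as a linear map. -/
noncomputable def genL (n : ℕ) : A →ₗ[ℂ] LoopRing A where
  toFun a := gen a n
  map_add' a b := gen_add a b n
  map_smul' c a := gen_smul c a n

@[simp] theorem genL_apply (n : ℕ) (a : A) : genL A n a = gen a n := rfl

variable (A) in
/-- The counit: evaluation at the identity of the group. -/
noncomputable def eps : LoopRing A →ₐ[ℂ] ℂ := lift 1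

theorem eps_gen (a : A) (n : ℕ) :
    eps A (gen a n) = if n = 0 then Coalgebra.counit (R := ℂ) a else 0 := by
  rw [eps, lift_gen]
  change PowerSeries.coeff n (algebraMap ℂ ℂ⟦X⟧ _) = _
  rw [PowerSeries.algebraMap_apply, PowerSeries.coeff_C]
  rfl

theorem map_eps_univ : LoopGroup.map (eps A) univ = 1 := map_lift_univ _

theorem comul_gen (a : A) (n : ℕ) : comul A (gen a n) =
    ∑ p ∈ Finset.HasAntidiagonal.antidiagonal n,
      TensorProduct.map (genL A p.1) (genL A p.2) (Coalgebra.comul (R := ℂ) a) := by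
  rw [comul, lift_gen]
  have h := convSeries_mul
    (WithConv.toConv (LoopGroup.map (Algebra.TensorProduct.includeLeft :
      LoopRing A →ₐ[ℂ] LoopRing A ⊗[ℂ] LoopRing A) (univ (A := A))).hom.toLinearMap)
    (WithConv.toConv (LoopGroup.map (Algebra.TensorProduct.includeRight :
      LoopRing A →ₐ[ℂ] LoopRing A ⊗[ℂ] LoopRing A) (univ (A := A))).hom.toLinearMap)
  have h' := congrArg (fun F => (PowerSeries.coeff n F).ofConv a) h
  simp only [coeff_convSeries, PowerSeries.coeff_mul, WithConv.ofConv_sum,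
    LinearMap.sum_apply] at h'
  refine h'.trans (Finset.sum_congr rfl fun p _ => ?_)
  change LinearMap.mul' ℂ _ (TensorProduct.map _ _ (Coalgebra.comul (R := ℂ) a)) = _
  generalize Coalgebra.comul (R := ℂ) a = s
  induction s with
  | zero => simp
  | add s t hs ht => simp only [map_add, hs, ht]
  | tmul b c =>
    simp only [TensorProduct.map_tmul, LinearMap.mul'_apply, coeff_convSeries, genL_apply]
    change PowerSeries.coeff p.1 ((LoopGroup.map
        (Algebra.TensorProduct.includeLeft : LoopRing A →ₐ[ℂ] LoopRing A ⊗[ℂ] LoopRing A)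
        univ).hom b) *
      PowerSeries.coeff p.2 ((LoopGroup.map
        (Algebra.TensorProduct.includeRight : LoopRing A →ₐ[ℂ] LoopRing A ⊗[ℂ] LoopRing A)
        univ).hom c) = _
    rw [coeff_map_hom, coeff_map_hom, coeff_univ, coeff_univ]
    simp

theorem rslice_eps_comul (f : LoopRing A) : rslice (eps A).toLinearMap (comul A f) = f := by
  have h : (Algebra.TensorProduct.productMap (AlgHom.id ℂ (LoopRing A))
      ((Algebra.ofId ℂ (LoopRing A)).comp (eps A))).comp (comul A) = AlgHom.id ℂ _ := by
    apply algHom_ext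
    rw [map_comp, map_comul_univ, map_mul, LoopGroup.map_comp, LoopGroup.map_comp,
      Algebra.TensorProduct.productMap_left, Algebra.TensorProduct.productMap_right,
      ← LoopGroup.map_comp, map_eps_univ, map_one, mul_one]
  refine Eq.trans ?_ (DFunLike.congr_fun h f)
  rw [AlgHom.comp_apply]
  generalize comul A f = s
  induction s with
  | zero => simp
  | add s t hs ht => simp only [map_add, hs, ht]
  | tmul b c =>
    simp [Algebra.smul_def, mul_comm, Algebra.ofId_apply]

theorem lslice_eps_comul (f : LoopRing A) : lslice (eps A).toLinearMap (comul A f) = f := by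
  have h : (Algebra.TensorProduct.productMap ((Algebra.ofId ℂ (LoopRing A)).comp (eps A))
      (AlgHom.id ℂ (LoopRing A))).comp (comul A) = AlgHom.id ℂ _ := by
    apply algHom_ext
    rw [map_comp, map_comul_univ, map_mul, LoopGroup.map_comp, LoopGroup.map_comp,
      Algebra.TensorProduct.productMap_left, Algebra.TensorProduct.productMap_right,
      ← LoopGroup.map_comp, map_eps_univ, map_one, one_mul]
  refine Eq.trans ?_ (DFunLike.congr_fun h f)
  rw [AlgHom.comp_apply]
  generalize comul A f = s
  induction s with
  | zero => simp
  | add s t hs ht => simp only [map_add, hs, ht]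
  | tmul b c =>
    simp [Algebra.smul_def, mul_comm, Algebra.ofId_apply]

/-! ### Derivations from their values on generators -/

/-- The dual number `x + y ε`. -/
def dualMk {S : Type*} (x y : S) : DualNumber S := (x, y)

@[simp] theorem fst_dualMk {S : Type*} (x y : S) : TrivSqZeroExt.fst (dualMk x y) = x := rfl

@[simp] theorem snd_dualMk {S : Type*} (x y : S) : TrivSqZeroExt.snd (dualMk x y) = y := rfl

/-- The derivation along a homomorphism to `S` given by a point over the dual numbers `S[ε]`. -/
noncomputable def dualDeriv {S : Type*} [CommRing S] [Algebra ℂ S]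
    (G : LoopGroup A (DualNumber S)) : LoopRing A →ₗ[ℂ] S :=
  (TrivSqZeroExt.sndHom S S).restrictScalars ℂ ∘ₗ (lift G).toLinearMap

theorem dualDeriv_apply {S : Type*} [CommRing S] [Algebra ℂ S]
    (G : LoopGroup A (DualNumber S)) (f : LoopRing A) :
    dualDeriv G f = TrivSqZeroExt.snd (lift G f) := rfl

theorem dualDeriv_gen {S : Type*} [CommRing S] [Algebra ℂ S]
    (G : LoopGroup A (DualNumber S)) (a : A) (n : ℕ) :
    dualDeriv G (gen a n) = TrivSqZeroExt.snd (PowerSeries.coeff n (G.hom a)) := by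
  rw [dualDeriv_apply, lift_gen]

/-- The ε-part of a homomorphism into dual numbers is a derivation along its reduction. Derivations
of the presented ring thus arise from points over dual numbers. -/
theorem dualDeriv_isDerivAlong {S : Type*} [CommRing S] [Algebra ℂ S]
    {G : LoopGroup A (DualNumber S)} {φ : LoopRing A →ₐ[ℂ] S}
    (h : ∀ a n, φ (gen a n) = TrivSqZeroExt.fst (PowerSeries.coeff n (G.hom a))) :
    IsDerivAlong φ (dualDeriv G) := by
  have hφ : φ = (TrivSqZeroExt.fstHom ℂ S S).comp (lift G) := by
    apply algHom_ext
    apply LoopGroup.ext'; intro a; ext n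
    rw [coeff_map_hom, coeff_map_hom, coeff_univ, h, AlgHom.comp_apply, lift_gen]
    rfl
  intro f g
  rw [dualDeriv_apply, map_mul, TrivSqZeroExt.snd_mul, hφ]
  rw [op_smul_eq_smul]
  rfl

/-- The map `a ↦ ∑ (a⁽ⁿ⁾ + d n a ε) tⁿ`. -/
noncomputable def deformationL (d : ℕ → A →ₗ[ℂ] LoopRing A) :
    A →ₗ[ℂ] (DualNumber (LoopRing A))⟦X⟧ where
  toFun a := PowerSeries.mk fun n => dualMk (gen a n) (d n a)
  map_add' a b := by
    ext n : 1
    rw [map_add, PowerSeries.coeff_mk, PowerSeries.coeff_mk, PowerSeries.coeff_mk]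
    apply TrivSqZeroExt.ext
    · exact gen_add a b n
    · exact map_add (d n) a b
  map_smul' c a := by
    ext n : 1
    change _ = c • PowerSeries.coeff n (PowerSeries.mk fun n => dualMk (gen a n) (d n a))
    rw [PowerSeries.coeff_mk, PowerSeries.coeff_mk]
    apply TrivSqZeroExt.ext
    · exact gen_smul c a n
    · exact map_smul (d n) c a

theorem coeff_deformationL (d : ℕ → A →ₗ[ℂ] LoopRing A) (a : A) (n : ℕ) :
    PowerSeries.coeff n (deformationL d a) = dualMk (gen a n) (d n a) := by
  change PowerSeries.coeff n (PowerSeries.mk fun n => dualMk (gen a n) (d n a)) = _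
  rw [PowerSeries.coeff_mk]

/-- The first order deformation of the universal point given by `a ↦ ∑ d n a tⁿ`. -/
noncomputable def deformation (d : ℕ → A →ₗ[ℂ] LoopRing A) (h0 : ∀ a, d 0 a = 0)
    (h1 : ∀ n, d n 1 = 0)
    (hmul : ∀ n a b, d n (a * b) = ∑ p ∈ Finset.HasAntidiagonal.antidiagonal n,
      (gen a p.1 * d p.2 b + gen b p.2 * d p.1 a)) :
    LoopGroup A (DualNumber (LoopRing A)) where
  hom := AlgHom.ofLinearMap (deformationL d)
    (by
      ext n : 1
      rw [coeff_deformationL, PowerSeries.coeff_one, gen_one, h1]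
      split_ifs <;> rfl)
    (fun a b => by
      ext n : 1
      rw [PowerSeries.coeff_mul]
      simp only [coeff_deformationL]
      apply TrivSqZeroExt.ext
      · rw [TrivSqZeroExt.fst_sum, fst_dualMk, gen_mul]
        rfl
      · rw [TrivSqZeroExt.snd_sum, snd_dualMk, hmul]
        refine Finset.sum_congr rfl fun p _ => ?_
        rw [TrivSqZeroExt.snd_mul, op_smul_eq_smul]
        rfl)
  const := fun a => by
    rw [← PowerSeries.coeff_zero_eq_constantCoeff_apply]
    change PowerSeries.coeff 0 (deformationL d a) = _
    rw [coeff_deformationL, h0, gen_zero]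
    rfl

/-- The derivation of the coordinate ring with `a⁽ⁿ⁾ ↦ d n a`. -/
noncomputable def mkDeriv (d : ℕ → A →ₗ[ℂ] LoopRing A) (h0 : ∀ a, d 0 a = 0)
    (h1 : ∀ n, d n 1 = 0)
    (hmul : ∀ n a b, d n (a * b) = ∑ p ∈ Finset.HasAntidiagonal.antidiagonal n,
      (gen a p.1 * d p.2 b + gen b p.2 * d p.1 a)) : LoopRing A →ₗ[ℂ] LoopRing A :=
  dualDeriv (deformation d h0 h1 hmul)

theorem coeff_deformation (d : ℕ → A →ₗ[ℂ] LoopRing A) (h0 : ∀ a, d 0 a = 0)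
    (h1 : ∀ n, d n 1 = 0)
    (hmul : ∀ n a b, d n (a * b) = ∑ p ∈ Finset.HasAntidiagonal.antidiagonal n,
      (gen a p.1 * d p.2 b + gen b p.2 * d p.1 a)) (a : A) (n : ℕ) :
    PowerSeries.coeff n ((deformation d h0 h1 hmul).hom a) = dualMk (gen a n) (d n a) :=
  coeff_deformationL d a n

theorem mkDeriv_gen (d : ℕ → A →ₗ[ℂ] LoopRing A) (h0 : ∀ a, d 0 a = 0)
    (h1 : ∀ n, d n 1 = 0)
    (hmul : ∀ n a b, d n (a * b) = ∑ p ∈ Finset.HasAntidiagonal.antidiagonal n,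
      (gen a p.1 * d p.2 b + gen b p.2 * d p.1 a)) (a : A) (n : ℕ) :
    mkDeriv d h0 h1 hmul (gen a n) = d n a := by
  rw [mkDeriv, dualDeriv_gen, coeff_deformation]
  rfl

theorem mkDeriv_isDerivAlong (d : ℕ → A →ₗ[ℂ] LoopRing A) (h0 : ∀ a, d 0 a = 0)
    (h1 : ∀ n, d n 1 = 0)
    (hmul : ∀ n a b, d n (a * b) = ∑ p ∈ Finset.HasAntidiagonal.antidiagonal n,
      (gen a p.1 * d p.2 b + gen b p.2 * d p.1 a)) :
    IsDerivAlong (AlgHom.id ℂ _) (mkDeriv d h0 h1 hmul) :=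
  dualDeriv_isDerivAlong fun a n => by rw [coeff_deformation]; rfl

/-! ### Tangent vectors and left invariant vector fields -/

/-- `tangentVec` as a linear map. -/
noncomputable def tangentL (x : LieAlg A) (n : ℕ) : LoopRing A →ₗ[ℂ] ℂ :=
  dualDeriv (tangentPoint x n)

theorem tangentL_apply (x : LieAlg A) (n : ℕ) (f : LoopRing A) :
    tangentL x n f = tangentVec x n f := rfl

theorem coeff_tangentPoint (x : LieAlg A) (n : ℕ) (a : A) (m : ℕ) :
    PowerSeries.coeff m ((tangentPoint x n).hom a) =
      dualMk (if m = 0 then Coalgebra.counit (R := ℂ) a else 0)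
        (if m = n + 1 then x.eval a else 0) := by
  change PowerSeries.coeff m (algebraMap ℂ (DualNumber ℂ)⟦X⟧ (Coalgebra.counit (R := ℂ) a) +
        algebraMap ℂ (DualNumber ℂ)⟦X⟧ (x.eval a) * epsPow (n + 1)) = _
  rw [map_add, PowerSeries.algebraMap_apply, PowerSeries.algebraMap_apply, PowerSeries.coeff_C_mul,
    PowerSeries.coeff_C, epsPow, PowerSeries.coeff_monomial]
  apply TrivSqZeroExt.ext
  · rw [TrivSqZeroExt.fst_add, TrivSqZeroExt.fst_mul]
    split_ifs <;> simp [TrivSqZeroExt.algebraMap_eq_inl]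
  · rw [TrivSqZeroExt.snd_add, TrivSqZeroExt.snd_mul]
    split_ifs <;> simp [TrivSqZeroExt.algebraMap_eq_inl]

theorem tangentL_gen (x : LieAlg A) (n : ℕ) (a : A) (m : ℕ) :
    tangentL x n (gen a m) = if m = n + 1 then x.eval a else 0 := by
  rw [tangentL, dualDeriv_gen, coeff_tangentPoint]
  rfl

theorem tangentL_isDerivAlong (x : LieAlg A) (n : ℕ) : IsDerivAlong (eps A) (tangentL x n) :=
  dualDeriv_isDerivAlong fun a m => by rw [coeff_tangentPoint, eps_gen]; rfl

end LoopRing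

/-! ### Invariant vector fields on `G` -/

section Fields

variable {A : Type u} [CommRing A] [HopfAlgebra ℂ A]

/-- The functional of a tangent vector, as a linear map. -/
def evalL : LieAlg A →ₗ[ℂ] A →ₗ[ℂ] ℂ where
  toFun x := x.eval
  map_add' _ _ := rfl
  map_smul' _ _ := rfl

@[simp] theorem evalL_apply (x : LieAlg A) (a : A) : evalL x a = x.eval a := rfl

theorem evalL_injective : Function.Injective (evalL (A := A)) := fun _ _ h =>
  Subtype.ext (WithConv.ofConv_injective h)

theorem eval_isDerivAlong (x : LieAlg A) :
    IsDerivAlong (Bialgebra.counitAlgHom ℂ A) x.eval := fun a b => by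
  rw [x.eval_mul, mul_comm (x.eval a)]
  rfl

/-- By the Leibniz rule a point derivation is determined by its values on finitely many algebra
generators. -/
instance [Algebra.FiniteType ℂ A] : FiniteDimensional ℂ (LieAlg A) := by
  obtain ⟨s, hs⟩ := (inferInstance : Algebra.FiniteType ℂ A).out
  let r : LieAlg A →ₗ[ℂ] (s → ℂ) := LinearMap.pi fun a => LinearMap.flip evalL a.1
  refine FiniteDimensional.of_injective r fun x y h => evalL_injective ?_
  ext a
  have ha : a ∈ Algebra.adjoin ℂ (s : Set A) := by rw [hs]; trivial
  induction ha using Algebra.adjoin_induction with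
  | mem a ha => exact congrFun h ⟨a, ha⟩
  | algebraMap c =>
    exact ((eval_isDerivAlong x).map_algebraMap c).trans ((eval_isDerivAlong y).map_algebraMap c).symm
  | add a b _ _ ha hb => rw [map_add, map_add, ha, hb]
  | mul a b _ _ ha hb =>
    simp only [evalL_apply] at ha hb
    rw [evalL_apply, evalL_apply, x.eval_mul, y.eval_mul, ha, hb]

/-- The left invariant vector field `a ↦ ∑ a₁ x(a₂)`. -/
noncomputable def leftField (x : LieAlg A) : A →ₗ[ℂ] A := rslice x.eval ∘ₗ Coalgebra.comul

/-- The right invariant vector field `a ↦ ∑ x(a₁) a₂`. -/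
noncomputable def rightField (x : LieAlg A) : A →ₗ[ℂ] A := lslice x.eval ∘ₗ Coalgebra.comul

theorem rslice_counit (a : A) :
    rslice (Bialgebra.counitAlgHom ℂ A).toLinearMap (Coalgebra.comul (R := ℂ) a) = a := by
  have h := Coalgebra.lTensor_counit_comul (R := ℂ) a
  change TensorProduct.rid ℂ A (LinearMap.lTensor A Coalgebra.counit _) = a
  rw [h, TensorProduct.rid_tmul, one_smul]

theorem lslice_counit (a : A) :
    lslice (Bialgebra.counitAlgHom ℂ A).toLinearMap (Coalgebra.comul (R := ℂ) a) = a := by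
  have h := Coalgebra.rTensor_counit_comul (R := ℂ) a
  change TensorProduct.lid ℂ A (LinearMap.rTensor A Coalgebra.counit _) = a
  rw [h, TensorProduct.lid_tmul, one_smul]

theorem leftField_mul (x : LieAlg A) (a b : A) :
    leftField x (a * b) = a * leftField x b + b * leftField x a := by
  rw [leftField, LinearMap.comp_apply, Bialgebra.comul_mul, rslice_mul (eval_isDerivAlong x),
    rslice_counit, rslice_counit]
  rfl

theorem rightField_mul (x : LieAlg A) (a b : A) :
    rightField x (a * b) = a * rightField x b + b * rightField x a := by
  rw [rightField, LinearMap.comp_apply, Bialgebra.comul_mul, lslice_mul (eval_isDerivAlong x),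
    lslice_counit, lslice_counit]
  rfl

theorem leftField_one (x : LieAlg A) : leftField x 1 = 0 := by
  have := leftField_mul x 1 1
  simpa using this

theorem rightField_one (x : LieAlg A) : rightField x 1 = 0 := by
  have := rightField_mul x 1 1
  simpa using this

variable (A) in
/-- `leftField` as a bilinear map. -/
noncomputable def leftFieldL : LieAlg A →ₗ[ℂ] A →ₗ[ℂ] A where
  toFun := leftField
  map_add' x y := by
    ext a
    simp only [leftField, LinearMap.comp_apply, LinearMap.add_apply]
    generalize Coalgebra.comul (R := ℂ) a = s
    induction s with
    | zero => simp
    | add s t hs ht => simp only [map_add, hs, ht]; ring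
    | tmul b c =>
      rw [rslice_tmul, rslice_tmul, rslice_tmul, ← add_smul]
      rfl
  map_smul' r x := by
    ext a
    simp only [leftField, LinearMap.comp_apply, LinearMap.smul_apply]
    generalize Coalgebra.comul (R := ℂ) a = s
    induction s with
    | zero => simp
    | add s t hs ht => simp only [map_add, hs, ht, smul_add]
    | tmul b c =>
      rw [rslice_tmul, rslice_tmul, ← mul_smul]
      rfl

variable (A) in
/-- `rightField` as a bilinear map. -/
noncomputable def rightFieldL : LieAlg A →ₗ[ℂ] A →ₗ[ℂ] A where
  toFun := rightField
  map_add' x y := by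
    ext a
    simp only [rightField, LinearMap.comp_apply, LinearMap.add_apply]
    generalize Coalgebra.comul (R := ℂ) a = s
    induction s with
    | zero => simp
    | add s t hs ht => simp only [map_add, hs, ht]; ring
    | tmul b c =>
      rw [lslice_tmul, lslice_tmul, lslice_tmul, ← add_smul]
      rfl
  map_smul' r x := by
    ext a
    simp only [rightField, LinearMap.comp_apply, LinearMap.smul_apply]
    generalize Coalgebra.comul (R := ℂ) a = s
    induction s with
    | zero => simp
    | add s t hs ht => simp only [map_add, hs, ht, smul_add]
    | tmul b c =>
      rw [lslice_tmul, lslice_tmul, ← mul_smul]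
      rfl

end Fields

namespace LoopRing

variable {A : Type u} [CommRing A] [HopfAlgebra ℂ A]

/-- The left invariant vector field on `G₁[[z⁻¹]]` with value `x z⁻ⁿ⁻¹` at the identity. -/
noncomputable def loopField (x : LieAlg A) (n : ℕ) : LoopRing A →ₗ[ℂ] LoopRing A :=
  rslice (tangentL x n) ∘ₗ (comul A).toLinearMap

theorem loopField_apply (x : LieAlg A) (n : ℕ) (f : LoopRing A) :
    loopField x n f = rslice (tangentL x n) (comul A f) := rfl

theorem loopField_isDerivAlong (x : LieAlg A) (n : ℕ) :
    IsDerivAlong (AlgHom.id ℂ _) (loopField x n) := fun f g => by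
  rw [loopField_apply, map_mul, rslice_mul (tangentL_isDerivAlong x n), rslice_eps_comul,
    rslice_eps_comul]
  rfl

/-- Every left invariant field strictly lowers the order in t, here by `n + 1`. This is the local
nilpotence exploited below. -/
theorem loopField_gen (x : LieAlg A) (n : ℕ) (a : A) (m : ℕ) : loopField x n (gen a m) =
    if n + 1 ≤ m then gen (leftField x a) (m - (n + 1)) else 0 := by
  have key : ∀ (p q : ℕ) (s : A ⊗[ℂ] A), rslice (tangentL x n)
      (TensorProduct.map (genL A p) (genL A q) s) =
      if q = n + 1 then gen (rslice x.eval s) p else 0 := by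
    intro p q s
    induction s with
    | zero =>
      rw [map_zero, map_zero, map_zero, ← genL_apply, map_zero, ite_self]
    | add s t hs ht =>
      rw [map_add, map_add, map_add, hs, ht, gen_add]
      split_ifs <;> simp
    | tmul b c =>
      rw [TensorProduct.map_tmul, rslice_tmul, genL_apply, genL_apply, tangentL_gen, rslice_tmul,
        gen_smul]
      split_ifs <;> simp
  rw [loopField_apply, comul_gen, map_sum]
  simp only [key]
  rw [Finset.sum_ite, Finset.sum_const_zero, add_zero]
  split_ifs with h
  · rw [Finset.sum_eq_single (m - (n + 1), n + 1)]
    · rfl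
    · rintro ⟨p, q⟩ hp hne
      simp only [Finset.mem_filter, Finset.HasAntidiagonal.mem_antidiagonal] at hp
      exact absurd (Prod.ext (by dsimp; omega) hp.2) hne
    · intro hn
      refine absurd ?_ hn
      rw [Finset.mem_filter, Finset.HasAntidiagonal.mem_antidiagonal]
      exact ⟨by dsimp; omega, rfl⟩
  · apply Finset.sum_eq_zero
    rintro ⟨p, q⟩ hp
    simp only [Finset.mem_filter, Finset.HasAntidiagonal.mem_antidiagonal] at hp
    omega

/-! ### The Euler derivation -/

variable (A) in
/-- The derivation multiplying functions of degree `n` by `n`. -/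
noncomputable def euler : LoopRing A →ₗ[ℂ] LoopRing A :=
  mkDeriv (fun n => (n : ℂ) • genL A n) (fun a => by simp)
    (fun n => by
      rw [LinearMap.smul_apply, genL_apply, gen_one]
      split_ifs with h <;> simp [h])
    (fun n a b => by
      rw [LinearMap.smul_apply, genL_apply, gen_mul, Finset.smul_sum]
      refine Finset.sum_congr rfl fun p hp => ?_
      rw [← Finset.HasAntidiagonal.mem_antidiagonal.1 hp]
      simp only [LinearMap.smul_apply, genL_apply, Nat.cast_add, add_smul, mul_smul_comm]
      rw [mul_comm (gen b p.2), add_comm])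

theorem euler_gen (a : A) (n : ℕ) : euler A (gen a n) = (n : ℂ) • gen a n := by
  rw [euler, mkDeriv_gen]
  rfl

theorem euler_isDerivAlong : IsDerivAlong (AlgHom.id ℂ _) (euler A) := mkDeriv_isDerivAlong _ _ _ _

/-- The substitution `t ↦ c t` in power series. -/
noncomputable def scaleVar {S : Type v} [CommRing S] [Algebra ℂ S] (c : S) : S⟦X⟧ →ₐ[ℂ] S⟦X⟧ :=
  { PowerSeries.rescale c with
    commutes' := fun r => by
      change PowerSeries.rescale c (algebraMap ℂ S⟦X⟧ r) = _
      rw [PowerSeries.algebraMap_apply]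
      ext n
      rw [PowerSeries.coeff_rescale, PowerSeries.coeff_C]
      split_ifs with h <;> simp [h] }

theorem coeff_scaleVar {S : Type v} [CommRing S] [Algebra ℂ S] (c : S) (f : S⟦X⟧) (n : ℕ) :
    PowerSeries.coeff n (scaleVar c f) = c ^ n * PowerSeries.coeff n f :=
  PowerSeries.coeff_rescale _ _ _

/-- The point `g(c t)`. -/
noncomputable def scalePoint {S : Type v} [CommRing S] [Algebra ℂ S] (c : S)
    (g : LoopGroup A S) : LoopGroup A S where
  hom := (scaleVar c).comp g.hom
  const a := by
    rw [← PowerSeries.coeff_zero_eq_constantCoeff_apply, AlgHom.comp_apply, coeff_scaleVar,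
      pow_zero, one_mul, LoopGroup.coeff_zero_hom]

/-- The homomorphism with `a⁽ⁿ⁾ ↦ Tⁿ a⁽ⁿ⁾`. -/
noncomputable def scaling : LoopRing A →ₐ[ℂ] Polynomial (LoopRing A) :=
  lift (scalePoint Polynomial.X (LoopGroup.map Polynomial.CAlgHom univ))

theorem scaling_gen (a : A) (n : ℕ) :
    scaling (gen a n) = Polynomial.X ^ n * Polynomial.C (gen a n) := by
  rw [scaling, lift_gen, scalePoint, AlgHom.comp_apply, coeff_scaleVar, coeff_map_hom, coeff_univ]
  rfl

theorem gen_algHom_ext {R : Type*} [CommRing R] [Algebra ℂ R] {F F' : LoopRing A →ₐ[ℂ] R}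
    (h : ∀ a n, F (gen a n) = F' (gen a n)) : F = F' := by
  apply algHom_ext
  apply LoopGroup.ext'; intro a; ext n
  rw [coeff_map_hom, coeff_map_hom, coeff_univ, h]

theorem eval_one_scaling (f : LoopRing A) : (scaling f).eval 1 = f := by
  have h : ((Polynomial.aeval (R := LoopRing A) 1).restrictScalars ℂ).comp scaling =
      AlgHom.id ℂ (LoopRing A) :=
    gen_algHom_ext fun a n => by
      rw [AlgHom.comp_apply, scaling_gen]
      simp
  have h' := DFunLike.congr_fun h f
  rwa [AlgHom.comp_apply, AlgHom.restrictScalars_apply, Polynomial.coe_aeval_eq_eval] at h'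

theorem eval_zero_scaling (f : LoopRing A) :
    (scaling f).eval 0 = algebraMap ℂ _ (eps A f) := by
  have h : ((Polynomial.aeval (R := LoopRing A) 0).restrictScalars ℂ).comp scaling =
      (Algebra.ofId ℂ (LoopRing A)).comp (eps A) :=
    gen_algHom_ext fun a n => by
      rw [AlgHom.comp_apply, scaling_gen, AlgHom.comp_apply, eps_gen]
      rcases n with _ | n
      · simp [gen_zero, Algebra.ofId_apply]
      · simp
  have h' := DFunLike.congr_fun h f
  rwa [AlgHom.comp_apply, AlgHom.restrictScalars_apply, Polynomial.coe_aeval_eq_eval] at h'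

/-- The Euler derivation is the infinitesimal generator of loop rotation. Both sides are derivations
along `scaling`, so generators suffice. -/
theorem X_mul_derivative_scaling (f : LoopRing A) :
    Polynomial.X * Polynomial.derivative (scaling f) = scaling (euler A f) := by
  have h := derivAlong_ext (φ := scaling (A := A))
    (D := LinearMap.mulLeft ℂ Polynomial.X ∘ₗ Polynomial.derivative.restrictScalars ℂ ∘ₗ
      scaling.toLinearMap) (D' := scaling.toLinearMap ∘ₗ euler A)
    (fun f g => by
      simp only [LinearMap.comp_apply, AlgHom.toLinearMap_apply, map_mul,
        LinearMap.restrictScalars_apply, Polynomial.derivative_mul, LinearMap.mulLeft_apply]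
      ring)
    (fun f g => by
      simp only [LinearMap.comp_apply, AlgHom.toLinearMap_apply]
      rw [euler_isDerivAlong]
      simp)
    (fun a n => by
      simp only [LinearMap.comp_apply, AlgHom.toLinearMap_apply,
        LinearMap.restrictScalars_apply, LinearMap.mulLeft_apply]
      rw [euler_gen, map_smul, scaling_gen, Algebra.smul_def, IsScalarTower.algebraMap_apply ℂ (LoopRing A)]
      rcases n with _ | n
      · simp
      · rw [Polynomial.derivative_mul, Polynomial.derivative_X_pow, Polynomial.derivative_C]
        simp only [Nat.add_sub_cancel, mul_zero, add_zero, pow_succ]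
        simp
        ring)
  exact LinearMap.congr_fun h f

/-- The rotated function `scaling f` is a polynomial in the rotation parameter with zero derivative,
hence constant in characteristic zero. Its value at 1 is f, its value at 0 is f(e). -/
theorem eq_eps_of_euler_eq_zero {f : LoopRing A} (h : euler A f = 0) :
    f = algebraMap ℂ _ (eps A f) := by
  have h1 : Polynomial.derivative (scaling f) = 0 := by
    have := X_mul_derivative_scaling f
    rw [h, map_zero] at this
    exact (Polynomial.isRegular_X.left.mul_left_eq_zero_iff).1 this
  rw [← eval_zero_scaling]
  nth_rewrite 1 [← eval_one_scaling f]
  have : IsAddTorsionFree (LoopRing A) := ⟨fun n hn x y h => by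
    refine smul_right_injective (LoopRing A) (Nat.cast_ne_zero.2 hn : (n : ℂ) ≠ 0) ?_
    simpa only [Nat.cast_smul_eq_nsmul] using h⟩
  have h2 := Polynomial.derivative_eq_zero.1 h1
  rw [Polynomial.eq_C_of_natDegree_eq_zero h2]
  simp

end LoopRing

/-- Point derivations with values in `R` are combinations of a basis of the Lie algebra. -/
theorem exists_eq_sum_eval {A : Type u} [CommRing A] [HopfAlgebra ℂ A] {ι : Type*} [Fintype ι]
    (b : Module.Basis ι ℂ (LieAlg A)) {R : Type v} [CommRing R] [Algebra ℂ R] (D : A →ₗ[ℂ] R)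
    (hD : IsDerivAlong ((Algebra.ofId ℂ R).comp (Bialgebra.counitAlgHom ℂ A)) D) :
    ∃ y : ι → R, ∀ a, D a = ∑ i, (b i).eval a • y i := by
  classical
  have hli : LinearIndependent ℂ fun i => (b i).eval :=
    b.linearIndependent.map' evalL (LinearMap.ker_eq_bot.2 evalL_injective)
  -- Dual elements exist because linearly independent functionals are jointly surjective onto `ι →
  -- ℂ`: a functional vanishing on a proper image would be a linear relation.
  obtain ⟨e, he⟩ : ∃ e : ι → A, ∀ i j, (b i).eval (e j) = if i = j then 1 else 0 := by
    have hsurj : Function.Surjective (LinearMap.pi fun i => (b i).eval : A →ₗ[ℂ] (ι → ℂ)) := by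
      rw [← LinearMap.range_eq_top]
      by_contra hne
      obtain ⟨f, hf, hle⟩ := Submodule.exists_le_ker_of_lt_top _ (lt_top_iff_ne_top.2 hne)
      apply hf
      have h0 : ∑ i, f (Pi.single i 1) • (b i).eval = 0 := by
        ext a
        have h1 : f (fun i => (b i).eval a) = 0 := hle ⟨a, rfl⟩
        rw [LinearMap.pi_apply_eq_sum_univ f] at h1
        refine Eq.trans ?_ h1
        simp only [LinearMap.sum_apply, LinearMap.smul_apply, smul_eq_mul]
        refine Finset.sum_congr rfl fun i _ => ?_
        rw [mul_comm]
        congr 2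
        ext j
        rw [Pi.single_apply]
        exact if_congr eq_comm rfl rfl
      have h2 := Fintype.linearIndependent_iff.1 hli _ h0
      ext i
      simpa using h2 i
    choose e he using fun j => hsurj (Pi.single j 1)
    refine ⟨e, fun i j => ?_⟩
    have := congrFun (he j) i
    rw [LinearMap.pi_apply] at this
    rw [this, Pi.single_apply]
  refine ⟨fun i => D (e i), fun a => ?_⟩
  -- Linear functionals on `R` separate elements, and composing `D` with one gives an ordinary
  -- element of the Lie algebra. This reduces the claim to scalar values.
  rw [← sub_eq_zero, ← Module.forall_dual_apply_eq_zero_iff ℂ]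
  intro l
  let x : LieAlg A := ⟨WithConv.toConv (l ∘ₗ D), fun a a' => by
    change l (D (a * a')) = _ * l (D a') + l (D a) * _
    rw [hD]
    simp only [AlgHom.comp_apply, Algebra.ofId_apply, ← Algebra.smul_def, map_add, map_smul,
      smul_eq_mul]
    rw [mul_comm (l (D a))]
    rfl⟩
  have hx : ∀ a, x.eval a = l (D a) := fun a => rfl
  have hsum : ∀ a, x.eval a = ∑ i, b.repr x i * (b i).eval a := fun a => by
    conv_lhs => rw [← b.sum_repr x, ← evalL_apply, map_sum, LinearMap.sum_apply]
    simp
  have hc : ∀ i, b.repr x i = l (D (e i)) := fun j => by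
    rw [← hx, hsum]
    simp [he]
  rw [map_sub, ← hx, hsum, map_sum, sub_eq_zero]
  refine Finset.sum_congr rfl fun i _ => ?_
  rw [hc, map_smul, smul_eq_mul, mul_comm]

/-! ### The logarithmic derivative, and functions killed by invariant fields -/

namespace LoopRing

variable {A : Type u} [CommRing A] [HopfAlgebra ℂ A]

variable (A) in
/-- `a ↦ d/dt a(g(t))` for the universal point `g`. -/
noncomputable def univDeriv : A →ₗ[ℂ] (LoopRing A)⟦X⟧ :=
  ((PowerSeries.derivative (LoopRing A)).toLinearMap.restrictScalars ℂ) ∘ₗ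
    (univ (A := A)).hom.toLinearMap

theorem coeff_univDeriv (a : A) (n : ℕ) :
    PowerSeries.coeff n (univDeriv A a) = ((n + 1 : ℕ) : ℂ) • gen a (n + 1) := by
  change PowerSeries.coeff n (PowerSeries.derivative _ (univ.hom a)) = _
  rw [PowerSeries.coeff_derivative, coeff_univ, Algebra.smul_def, mul_comm]
  simp

variable (A) in
/-- The logarithmic derivative `g⁻¹ dg/dt` of the universal point `g`. -/
noncomputable def logDeriv : WithConv (A →ₗ[ℂ] (LoopRing A)⟦X⟧) :=
  WithConv.toConv (univ (A := A))⁻¹.hom.toLinearMap * WithConv.toConv (univDeriv A)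

theorem univ_mul_logDeriv :
    WithConv.toConv (univ (A := A)).hom.toLinearMap * logDeriv A =
      WithConv.toConv (univDeriv A) := by
  rw [logDeriv, ← mul_assoc, ← LoopGroup.toLinearMap_mul, mul_inv_cancel]
  exact one_mul _

/-- The series g⁻¹ dg/dt takes values in the Lie algebra. Before the coproduct is inserted, the map
`W` on `A ⊗ A` is a derivation along `G`, and `G` composed with the coproduct is evaluation of g⁻¹ g
= e, the counit. -/
theorem logDeriv_isDerivAlong : IsDerivAlong
    ((Algebra.ofId ℂ (LoopRing A)⟦X⟧).comp (Bialgebra.counitAlgHom ℂ A)) (logDeriv A).ofConv := by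
  let W : A ⊗[ℂ] A →ₗ[ℂ] (LoopRing A)⟦X⟧ := LinearMap.mul' ℂ _ ∘ₗ
    TensorProduct.map (univ (A := A))⁻¹.hom.toLinearMap (univDeriv A)
  let G : A ⊗[ℂ] A →ₐ[ℂ] (LoopRing A)⟦X⟧ :=
    Algebra.TensorProduct.productMap (univ (A := A))⁻¹.hom (univ (A := A)).hom
  have hW : ∀ s t, W (s * t) = G s * W t + G t * W s := by
    intro s t
    induction s with
    | zero => simp
    | add s s' h h' => rw [add_mul, map_add, h, h']; simp only [map_add]; ring
    | tmul a b =>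
      induction t with
      | zero => simp
      | add t t' h h' => rw [mul_add, map_add, h, h']; simp only [map_add]; ring
      | tmul c d =>
        simp only [W, G, univDeriv, LinearMap.comp_apply, Algebra.TensorProduct.tmul_mul_tmul,
          TensorProduct.map_tmul, LinearMap.mul'_apply, AlgHom.toLinearMap_apply, map_mul,
          Algebra.TensorProduct.productMap_apply_tmul, LinearMap.restrictScalars_apply]
        change _ * (PowerSeries.derivative (LoopRing A)) _ = _ * (_ * (PowerSeries.derivative (LoopRing A)) _) +
          _ * (_ * (PowerSeries.derivative (LoopRing A)) _)
        rw [Derivation.leibniz, smul_eq_mul, smul_eq_mul]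
        ring
  have hG : ∀ a, G (Coalgebra.comul (R := ℂ) a) =
      (Algebra.ofId ℂ (LoopRing A)⟦X⟧).comp (Bialgebra.counitAlgHom ℂ A) a := by
    intro a
    have h := congrArg (fun g : LoopGroup A (LoopRing A) => g.hom a)
      (inv_mul_cancel (univ (A := A)))
    refine Eq.trans ?_ h
    change G _ = LinearMap.mul' ℂ _ (TensorProduct.map _ _ (Coalgebra.comul (R := ℂ) a))
    generalize Coalgebra.comul (R := ℂ) a = s
    induction s with
    | zero => simp
    | add s t hs ht => simp only [map_add, hs, ht]
    | tmul b c => simp [G]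
  intro a b
  change W (Coalgebra.comul (a * b)) = _ * W (Coalgebra.comul b) + _ * W (Coalgebra.comul a)
  rw [Bialgebra.comul_mul, hW, hG, hG]

theorem exists_logDeriv_coeff {ι : Type*} [Fintype ι] (b : Module.Basis ι ℂ (LieAlg A)) :
    ∃ y : ℕ → ι → LoopRing A, ∀ n a,
      PowerSeries.coeff n ((logDeriv A).ofConv a) = ∑ i, (b i).eval a • y n i := by
  have h : ∀ n, ∃ y : ι → LoopRing A, ∀ a,
      PowerSeries.coeff n ((logDeriv A).ofConv a) = ∑ i, (b i).eval a • y i := fun n =>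
    exists_eq_sum_eval b ((PowerSeries.coeff n : (LoopRing A)⟦X⟧ →ₗ[LoopRing A] _).restrictScalars
      ℂ ∘ₗ (logDeriv A).ofConv) (fun a b => by
      simp only [LinearMap.comp_apply, LinearMap.restrictScalars_apply]
      rw [logDeriv_isDerivAlong a b, map_add]
      simp only [AlgHom.comp_apply, Algebra.ofId_apply, PowerSeries.algebraMap_apply,
        PowerSeries.coeff_C_mul])
  choose y hy using h
  exact ⟨y, hy⟩

/-- From t dg/dt = g · t (g⁻¹ dg/dt), expanding g⁻¹ dg/dt in a basis of the Lie algebra writes the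
Euler field through left invariant fields. The sum is infinite but locally finite; asking for all
large `N` lets the bound pass to sums and products. -/
theorem exists_euler_eq [Algebra.FiniteType ℂ A] :
    ∃ y : ℕ → Fin (Module.finrank ℂ (LieAlg A)) → LoopRing A,
      ∀ f, ∃ N₀, ∀ N ≥ N₀, euler A f = ∑ n ∈ Finset.range N, ∑ i,
        y n i * loopField (Module.finBasis ℂ (LieAlg A) i) n f := by
  obtain ⟨y, hy⟩ := exists_logDeriv_coeff (Module.finBasis ℂ (LieAlg A))
  refine ⟨y, fun f => ?_⟩
  have hder : ∀ N, IsDerivAlong (AlgHom.id ℂ (LoopRing A)) (∑ n ∈ Finset.range N, ∑ i,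
      LinearMap.mulLeft ℂ (y n i) ∘ₗ loopField (Module.finBasis ℂ (LieAlg A) i) n) := fun N =>
    IsDerivAlong.sum _ fun n _ => IsDerivAlong.sum _ fun i _ =>
      (loopField_isDerivAlong _ _).mulLeft _
  suffices h : ∃ N₀, ∀ N ≥ N₀, euler A f = (∑ n ∈ Finset.range N, ∑ i,
      LinearMap.mulLeft ℂ (y n i) ∘ₗ loopField (Module.finBasis ℂ (LieAlg A) i) n) f by
    simpa only [LinearMap.sum_apply, LinearMap.comp_apply, LinearMap.mulLeft_apply] using h
  induction f using LoopRing.induction with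
  | hC c =>
    exact ⟨0, fun N _ => by rw [euler_isDerivAlong.map_algebraMap, (hder N).map_algebraMap]⟩
  | hadd f g hf hg =>
    obtain ⟨M, hM⟩ := hf
    obtain ⟨N, hN⟩ := hg
    exact ⟨max M N, fun K hK => by
      rw [map_add, map_add, hM K (le_of_max_le_left hK), hN K (le_of_max_le_right hK)]⟩
  | hmul f g hf hg =>
    obtain ⟨M, hM⟩ := hf
    obtain ⟨N, hN⟩ := hg
    exact ⟨max M N, fun K hK => by
      rw [euler_isDerivAlong, (hder K), hM K (le_of_max_le_left hK),
        hN K (le_of_max_le_right hK)]⟩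
  | hgen a m =>
    -- Fields with index at least `m` lower the order by more than `m`, so they kill a⁽ᵐ⁾.
    refine ⟨m, fun N hN => ?_⟩
    simp only [LinearMap.sum_apply, LinearMap.comp_apply, LinearMap.mulLeft_apply, loopField_gen,
      euler_gen]
    obtain ⟨k, rfl⟩ := Nat.exists_eq_add_of_le hN
    rw [Finset.sum_range_add, Finset.sum_eq_zero (s := Finset.range k), add_zero]
    · rcases m with _ | m
      · simp
      -- The coefficient of tᵐ in g · (g⁻¹ dg/dt) = dg/dt, whose right side is (m + 1) a⁽ᵐ⁺¹⁾.
      · have h := congrArg (fun F => (PowerSeries.coeff m (convSeries F)).ofConv a)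
          (univ_mul_logDeriv (A := A))
        simp only [convSeries_mul, PowerSeries.coeff_mul, WithConv.ofConv_sum,
          LinearMap.sum_apply, coeff_convSeries, coeff_univDeriv] at h
        rw [← h, ← Finset.Nat.sum_antidiagonal_eq_sum_range_succ_mk
          (f := fun p : ℕ × ℕ => ∑ i, y p.1 i * if p.1 + 1 ≤ m + 1 then
            gen (leftField (Module.finBasis ℂ (LieAlg A) i) a) (m + 1 - (p.1 + 1)) else 0),
          ← Finset.Nat.sum_antidiagonal_swap]
        refine Finset.sum_congr rfl fun p hp => ?_
        have hp' := Finset.HasAntidiagonal.mem_antidiagonal.1 hp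
        change LinearMap.mul' ℂ _ (TensorProduct.map _ _ (Coalgebra.comul (R := ℂ) a)) = _
        have key : ∀ s : A ⊗[ℂ] A, LinearMap.mul' ℂ (LoopRing A) (TensorProduct.map
            (PowerSeries.coeff p.2 (convSeries (WithConv.toConv
              (univ (A := A)).hom.toLinearMap))).ofConv
            (PowerSeries.coeff p.1 (convSeries (logDeriv A))).ofConv s) =
            ∑ i, y p.1 i * gen (rslice (Module.finBasis ℂ (LieAlg A) i).eval s) p.2 := by
          intro s
          induction s with
          | zero => simp [← genL_apply]
          | add s t hs ht =>
            rw [map_add, map_add, hs, ht, ← Finset.sum_add_distrib]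
            refine Finset.sum_congr rfl fun i _ => ?_
            rw [map_add, gen_add, mul_add]
          | tmul b c =>
            rw [TensorProduct.map_tmul, LinearMap.mul'_apply, coeff_convSeries, coeff_convSeries,
              hy, Finset.mul_sum]
            refine Finset.sum_congr rfl fun i _ => ?_
            rw [rslice_tmul, gen_smul, mul_smul_comm, mul_smul_comm, mul_comm]
            change _ • (_ * PowerSeries.coeff p.2 (univ.hom b)) = _
            rw [coeff_univ]
        refine (key _).trans ?_
        refine Finset.sum_congr rfl fun i _ => ?_
        rw [if_pos (by omega), show m + 1 - (p.1 + 1) = p.2 by omega]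
        rfl
    · intro n _
      refine Finset.sum_eq_zero fun i _ => ?_
      rw [if_neg (by omega), mul_zero]

/-- A function annihilated by all left invariant vector fields is constant. -/
theorem eq_eps_of_loopField_eq_zero [Algebra.FiniteType ℂ A] {f : LoopRing A}
    (h : ∀ x n, loopField x n f = 0) : f = algebraMap ℂ _ (eps A f) := by
  apply eq_eps_of_euler_eq_zero
  obtain ⟨y, hy⟩ := exists_euler_eq (A := A)
  obtain ⟨N, hN⟩ := hy f
  rw [hN N le_rfl]
  simp [h]

theorem eq_zero_of_loopField_eq_zero [Algebra.FiniteType ℂ A] {f : LoopRing A}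
    (h : ∀ x n, loopField x n f = 0) (h0 : eps A f = 0) : f = 0 := by
  rw [eq_eps_of_loopField_eq_zero h, h0, map_zero]

/-! ### The filtration by order of nilpotency -/

variable (A) in
/-- The functions annihilated by all products of `d` left invariant vector fields. -/
noncomputable def nilSub : ℕ → Submodule ℂ (LoopRing A)
  | 0 => ⊥
  | d + 1 => ⨅ (x : LieAlg A) (n : ℕ), (nilSub d).comap (loopField x n)

theorem mem_nilSub_succ {d : ℕ} {f : LoopRing A} :
    f ∈ nilSub A (d + 1) ↔ ∀ x n, loopField x n f ∈ nilSub A d := by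
  simp [nilSub]

theorem nilSub_le_succ (d : ℕ) : nilSub A d ≤ nilSub A (d + 1) := by
  induction d with
  | zero => exact bot_le
  | succ d ih => exact fun f hf => mem_nilSub_succ.2 fun x n => ih (mem_nilSub_succ.1 hf x n)

theorem nilSub_mono : Monotone (nilSub A) := monotone_nat_of_le_succ nilSub_le_succ

theorem mul_mem_nilSub {d e : ℕ} {f g : LoopRing A} (hf : f ∈ nilSub A d) (hg : g ∈ nilSub A e) :
    f * g ∈ nilSub A (d + e) := by
  induction hk : d + e generalizing d e f g with
  | zero =>
    obtain rfl : d = 0 := by omega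
    rw [show f = 0 from hf, zero_mul]
    exact Submodule.zero_mem _
  | succ k ih =>
    refine mem_nilSub_succ.2 fun x n => ?_
    rw [loopField_isDerivAlong]
    refine Submodule.add_mem _ ?_ ?_
    · rcases e with _ | e
      · rw [show g = 0 from hg, map_zero, mul_zero]; exact Submodule.zero_mem _
      · exact ih hf (mem_nilSub_succ.1 hg x n) (by omega)
    · rcases d with _ | d
      · rw [show f = 0 from hf, map_zero, mul_zero]; exact Submodule.zero_mem _
      · exact ih hg (mem_nilSub_succ.1 hf x n) (by omega)

/-- Each field lowers the order by at least one, so `m + 1` of them annihilate a function of order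
`m`. -/
theorem gen_mem_nilSub (a : A) (m : ℕ) : gen a m ∈ nilSub A (m + 1) := by
  induction m using Nat.strong_induction_on generalizing a with
  | _ m ih =>
    refine mem_nilSub_succ.2 fun x n => ?_
    rw [loopField_gen]
    split_ifs with h
    · exact nilSub_mono (by omega) (ih _ (by omega) _)
    · exact Submodule.zero_mem _

theorem exists_mem_nilSub (f : LoopRing A) : ∃ d, f ∈ nilSub A d := by
  induction f using LoopRing.induction with
  | hC c =>
    refine ⟨1, mem_nilSub_succ.2 fun x n => ?_⟩
    rw [(loopField_isDerivAlong x n).map_algebraMap]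
    exact Submodule.zero_mem _
  | hgen a m => exact ⟨_, gen_mem_nilSub a m⟩
  | hadd f g hf hg =>
    obtain ⟨d, hd⟩ := hf
    obtain ⟨e, he⟩ := hg
    exact ⟨max d e, Submodule.add_mem _ (nilSub_mono (le_max_left _ _) hd)
      (nilSub_mono (le_max_right _ _) he)⟩
  | hmul f g hf hg =>
    obtain ⟨d, hd⟩ := hf
    obtain ⟨e, he⟩ := hg
    exact ⟨d + e, mul_mem_nilSub hd he⟩

/-- Induction on the total order of nilpotency of the arguments: by the hypothesis `hT`, every field
sends `T f g` to values of smaller total order, which vanish. So `T f g` is constant, and its value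
at e is zero. -/
theorem bilinear_eq_zero [Algebra.FiniteType ℂ A]
    (T : LoopRing A →ₗ[ℂ] LoopRing A →ₗ[ℂ] LoopRing A)
    (hT : ∀ x n f g, loopField x n (T f g) = T (loopField x n f) g + T f (loopField x n g))
    (h0 : ∀ f g, eps A (T f g) = 0) : T = 0 := by
  have key : ∀ k d e f g, d + e = k → f ∈ nilSub A d → g ∈ nilSub A e → T f g = 0 := by
    intro k
    induction k with
    | zero =>
      intro d e f g hk hf hg
      obtain rfl : d = 0 := by omega
      rw [show f = 0 from hf, map_zero, LinearMap.zero_apply]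
    | succ k ih =>
      intro d e f g hk hf hg
      refine eq_zero_of_loopField_eq_zero (fun x n => ?_) (h0 _ _)
      rcases d with _ | d
      · rw [show f = 0 from hf, map_zero, LinearMap.zero_apply, map_zero]
      rcases e with _ | e
      · rw [show g = 0 from hg, map_zero, map_zero]
      rw [hT, ih d (e + 1) _ _ (by omega) (mem_nilSub_succ.1 hf x n) hg,
        ih (d + 1) e _ _ (by omega) hf (mem_nilSub_succ.1 hg x n), add_zero]
  ext f g
  obtain ⟨d, hd⟩ := exists_mem_nilSub f
  obtain ⟨e, he⟩ := exists_mem_nilSub g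
  exact key _ d e f g rfl hd he

/-- The same induction with three arguments. Only vanishing at zero arguments enters, so `T` may be
a bare function; it will be the Jacobiator. -/
theorem trilinear_eq_zero [Algebra.FiniteType ℂ A]
    (T : LoopRing A → LoopRing A → LoopRing A → LoopRing A)
    (h1 : ∀ g h, T 0 g h = 0) (h2 : ∀ f h, T f 0 h = 0) (h3 : ∀ f g, T f g 0 = 0)
    (hT : ∀ x n f g h, loopField x n (T f g h) = T (loopField x n f) g h +
      T f (loopField x n g) h + T f g (loopField x n h))
    (h0 : ∀ f g h, eps A (T f g h) = 0) (f g h : LoopRing A) : T f g h = 0 := by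
  have key : ∀ k c d e f g h, c + d + e = k → f ∈ nilSub A c → g ∈ nilSub A d →
      h ∈ nilSub A e → T f g h = 0 := by
    intro k
    induction k with
    | zero =>
      intro c d e f g h hk hf hg hh
      obtain rfl : c = 0 := by omega
      rw [show f = 0 from hf, h1]
    | succ k ih =>
      intro c d e f g h hk hf hg hh
      refine eq_zero_of_loopField_eq_zero (fun x n => ?_) (h0 _ _ _)
      rcases c with _ | c
      · rw [show f = 0 from hf, h1, map_zero]
      rcases d with _ | d
      · rw [show g = 0 from hg, h2, map_zero]
      rcases e with _ | e
      · rw [show h = 0 from hh, h3, map_zero]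
      rw [hT, ih c (d + 1) (e + 1) _ _ _ (by omega) (mem_nilSub_succ.1 hf x n) hg hh,
        ih (c + 1) d (e + 1) _ _ _ (by omega) hf (mem_nilSub_succ.1 hg x n) hh,
        ih (c + 1) (d + 1) e _ _ _ (by omega) hf hg (mem_nilSub_succ.1 hh x n), add_zero, add_zero]
  obtain ⟨c, hc⟩ := exists_mem_nilSub f
  obtain ⟨d, hd⟩ := exists_mem_nilSub g
  obtain ⟨e, he⟩ := exists_mem_nilSub h
  exact key _ c d e f g h rfl hc hd he

end LoopRing

/-! ### Invariant fields in the convolution algebra -/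

section Conv

variable {A : Type u} [CommRing A] [HopfAlgebra ℂ A] {V : Type v} [CommRing V] [Algebra ℂ V]

variable (V) in
/-- A functional as a map with scalar values in the convolution algebra. -/
noncomputable def scalarConv (x : A →ₗ[ℂ] ℂ) : WithConv (A →ₗ[ℂ] V) :=
  WithConv.toConv (Algebra.linearMap ℂ V ∘ₗ x)

/-- Left invariant fields are right convolutions by a tangent vector, and right invariant fields are
left convolutions. Their commutation relations then follow from associativity. -/
theorem toConv_comp_leftField (f : A →ₗ[ℂ] V) (x : LieAlg A) :
    WithConv.toConv (f ∘ₗ leftField x) = WithConv.toConv f * scalarConv V x.eval := by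
  apply WithConv.ofConv_injective
  ext a
  change f (rslice x.eval (Coalgebra.comul (R := ℂ) a)) =
    LinearMap.mul' ℂ _ (TensorProduct.map _ _ (Coalgebra.comul (R := ℂ) a))
  generalize Coalgebra.comul (R := ℂ) a = s
  induction s with
  | zero => simp
  | add s t hs ht => simp only [map_add, hs, ht]
  | tmul b c =>
    rw [rslice_tmul, map_smul, TensorProduct.map_tmul, LinearMap.mul'_apply, mul_comm,
      Algebra.smul_def]
    rfl

theorem toConv_comp_rightField (f : A →ₗ[ℂ] V) (x : LieAlg A) :
    WithConv.toConv (f ∘ₗ rightField x) = scalarConv V x.eval * WithConv.toConv f := by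
  apply WithConv.ofConv_injective
  ext a
  change f (lslice x.eval (Coalgebra.comul (R := ℂ) a)) =
    LinearMap.mul' ℂ _ (TensorProduct.map _ _ (Coalgebra.comul (R := ℂ) a))
  generalize Coalgebra.comul (R := ℂ) a = s
  induction s with
  | zero => simp
  | add s t hs ht => simp only [map_add, hs, ht]
  | tmul b c =>
    rw [lslice_tmul, map_smul, TensorProduct.map_tmul, LinearMap.mul'_apply, Algebra.smul_def]
    rfl

theorem toConv_leftField (x : LieAlg A) :
    WithConv.toConv (leftField x) = WithConv.toConv LinearMap.id * scalarConv A x.eval := by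
  rw [← toConv_comp_leftField, LinearMap.id_comp]

theorem toConv_rightField (x : LieAlg A) :
    WithConv.toConv (rightField x) = scalarConv A x.eval * WithConv.toConv LinearMap.id := by
  rw [← toConv_comp_rightField, LinearMap.id_comp]

theorem scalarConv_mul (x y : WithConv (A →ₗ[ℂ] ℂ)) :
    scalarConv V x.ofConv * scalarConv V y.ofConv = scalarConv V (x * y).ofConv :=
  WithConv.ofConv_injective
    (LinearMap.algHom_comp_convMul_distrib (Algebra.ofId ℂ V) x y).symm

theorem scalarConv_self (x : A →ₗ[ℂ] ℂ) : scalarConv ℂ x = WithConv.toConv x := rfl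

theorem eval_lie (x y : LieAlg A) (a : A) :
    ⁅x, y⁆.eval a = x.eval (leftField y a) - x.eval (rightField y a) := by
  have h1 := toConv_comp_leftField x.eval y
  have h2 := toConv_comp_rightField x.eval y
  rw [scalarConv_self] at h1 h2
  have h1' := congrArg (fun F : WithConv (A →ₗ[ℂ] ℂ) => F.ofConv a) h1
  have h2' := congrArg (fun F : WithConv (A →ₗ[ℂ] ℂ) => F.ofConv a) h2
  dsimp only [LinearMap.comp_apply] at h1' h2'
  rw [h1', h2']
  rfl

theorem leftField_lie (x y : LieAlg A) (a : A) :
    leftField ⁅x, y⁆ a = leftField x (leftField y a) - leftField y (leftField x a) := by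
  have h : ∀ x y : LieAlg A, WithConv.toConv (leftField x ∘ₗ leftField y) =
      WithConv.toConv LinearMap.id * scalarConv A (x.1 * y.1).ofConv := fun x y => by
    rw [toConv_comp_leftField, toConv_leftField, mul_assoc, LieAlg.eval, LieAlg.eval,
      scalarConv_mul]
  have h' : WithConv.toConv (leftField ⁅x, y⁆) =
      WithConv.toConv (leftField x ∘ₗ leftField y) -
        WithConv.toConv (leftField y ∘ₗ leftField x) := by
    rw [h, h, toConv_leftField, ← mul_sub]
    congr 1
    apply WithConv.ofConv_injective
    ext b
    exact map_sub (algebraMap ℂ A) _ _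
  exact congrArg (fun F : WithConv (A →ₗ[ℂ] A) => F.ofConv a) h'

theorem leftField_rightField (x y : LieAlg A) (a : A) :
    leftField x (rightField y a) = rightField y (leftField x a) := by
  have h : WithConv.toConv (leftField x ∘ₗ rightField y) =
      WithConv.toConv (rightField y ∘ₗ leftField x) := by
    rw [toConv_comp_leftField, toConv_comp_rightField, toConv_leftField, toConv_rightField,
      mul_assoc]
  exact congrArg (fun F : WithConv (A →ₗ[ℂ] A) => F.ofConv a) h

theorem derivation_comp_conv (D : A →ₗ[ℂ] A) (hD : ∀ a b, D (a * b) = a * D b + b * D a)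
    (f g : A →ₗ[ℂ] A) :
    D ∘ₗ (WithConv.toConv f * WithConv.toConv g).ofConv =
      (WithConv.toConv (D ∘ₗ f) * WithConv.toConv g +
        WithConv.toConv f * WithConv.toConv (D ∘ₗ g)).ofConv := by
  ext a
  change D (LinearMap.mul' ℂ _ (TensorProduct.map _ _ (Coalgebra.comul (R := ℂ) a))) =
    LinearMap.mul' ℂ _ (TensorProduct.map _ _ (Coalgebra.comul (R := ℂ) a)) +
    LinearMap.mul' ℂ _ (TensorProduct.map _ _ (Coalgebra.comul (R := ℂ) a))
  generalize Coalgebra.comul (R := ℂ) a = s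
  induction s with
  | zero => simp
  | add s t hs ht => simp only [map_add, hs, ht]; ring
  | tmul b c => simp [hD]; ring

theorem derivation_comp_convOne (D : A →ₗ[ℂ] A) (hD : D 1 = 0) :
    D ∘ₗ (1 : WithConv (A →ₗ[ℂ] A)).ofConv = 0 := by
  ext a
  change D (algebraMap ℂ A _) = 0
  rw [Algebra.algebraMap_eq_smul_one, map_smul, hD, smul_zero]

/-- Apply the field to id * S = 1 and cancel id by convolving with S on the left. Inversion thus
exchanges left and right fields up to sign. -/
theorem leftField_antipode (x : LieAlg A) (a : A) :
    leftField x (HopfAlgebra.antipode ℂ a) = -HopfAlgebra.antipode ℂ (rightField x a) := by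
  have h := derivation_comp_conv (leftField x) (leftField_mul x) LinearMap.id
    (HopfAlgebra.antipode ℂ)
  rw [LinearMap.id_mul_antipode, derivation_comp_convOne _ (leftField_one x),
    LinearMap.comp_id, toConv_leftField] at h
  have h1 : WithConv.toConv (LinearMap.id : A →ₗ[ℂ] A) *
      (scalarConv A x.eval * WithConv.toConv (HopfAlgebra.antipode ℂ) +
        WithConv.toConv (leftField x ∘ₗ HopfAlgebra.antipode ℂ)) = 0 := by
    rw [mul_add, ← mul_assoc]
    exact WithConv.ofConv_injective h.symm
  have h2 := congrArg (WithConv.toConv (HopfAlgebra.antipode ℂ (A := A)) * ·) h1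
  simp only [← mul_assoc, LinearMap.antipode_mul_id, one_mul, mul_zero] at h2
  rw [← toConv_comp_rightField] at h2
  have h3 := congrArg (fun F : WithConv (A →ₗ[ℂ] A) => F.ofConv a) h2
  exact eq_neg_of_add_eq_zero_right h3

theorem rightField_antipode (x : LieAlg A) (a : A) :
    rightField x (HopfAlgebra.antipode ℂ a) = -HopfAlgebra.antipode ℂ (leftField x a) := by
  have h := derivation_comp_conv (rightField x) (rightField_mul x) (HopfAlgebra.antipode ℂ)
    LinearMap.id
  rw [LinearMap.antipode_mul_id, derivation_comp_convOne _ (rightField_one x),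
    LinearMap.comp_id, toConv_rightField] at h
  have h1 : (WithConv.toConv (rightField x ∘ₗ HopfAlgebra.antipode ℂ) +
      WithConv.toConv (HopfAlgebra.antipode ℂ) * scalarConv A x.eval) *
        WithConv.toConv (LinearMap.id : A →ₗ[ℂ] A) = 0 := by
    rw [add_mul, mul_assoc]
    exact WithConv.ofConv_injective h.symm
  have h2 := congrArg (· * WithConv.toConv (HopfAlgebra.antipode ℂ (A := A))) h1
  simp only [mul_assoc, LinearMap.id_mul_antipode, mul_one, zero_mul] at h2
  rw [← toConv_comp_leftField] at h2
  have h3 := congrArg (fun F : WithConv (A →ₗ[ℂ] A) => F.ofConv a) h2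
  exact eq_neg_of_add_eq_zero_left h3

theorem leftField_involution (θ : GroupInvolution A) (x : LieAlg A) (a : A) :
    leftField x (θ.toHom a) = θ.toHom (leftField (θ.onLie x) a) := by
  have h : Coalgebra.comul (R := ℂ) (θ.toHom a) =
      TensorProduct.map (θ.toHom : A →ₗ[ℂ] A) (θ.toHom : A →ₗ[ℂ] A) (Coalgebra.comul (R := ℂ) a) :=
    (CoalgHomClass.map_comp_comul_apply θ.toHom a).symm
  rw [leftField, LinearMap.comp_apply, h, leftField, LinearMap.comp_apply]
  generalize Coalgebra.comul (R := ℂ) a = s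
  induction s with
  | zero => simp
  | add s t hs ht => simp only [map_add, hs, ht]
  | tmul b c =>
    rw [TensorProduct.map_tmul, rslice_tmul, rslice_tmul, map_smul]
    rfl

theorem rightField_involution (θ : GroupInvolution A) (x : LieAlg A) (a : A) :
    rightField x (θ.toHom a) = θ.toHom (rightField (θ.onLie x) a) := by
  have h : Coalgebra.comul (R := ℂ) (θ.toHom a) =
      TensorProduct.map (θ.toHom : A →ₗ[ℂ] A) (θ.toHom : A →ₗ[ℂ] A) (Coalgebra.comul (R := ℂ) a) :=
    (CoalgHomClass.map_comp_comul_apply θ.toHom a).symm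
  rw [rightField, LinearMap.comp_apply, h, rightField, LinearMap.comp_apply]
  generalize Coalgebra.comul (R := ℂ) a = s
  induction s with
  | zero => simp
  | add s t hs ht => simp only [map_add, hs, ht]
  | tmul b c =>
    rw [TensorProduct.map_tmul, lslice_tmul, lslice_tmul, map_smul]
    rfl

theorem counit_leftField (x : LieAlg A) (a : A) :
    Coalgebra.counit (R := ℂ) (leftField x a) = x.eval a := by
  have h := toConv_comp_leftField (Coalgebra.counit (R := ℂ)) x
  rw [scalarConv_self] at h
  exact congrArg (fun F : WithConv (A →ₗ[ℂ] ℂ) => F.ofConv a) (h.trans (one_mul _))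

theorem counit_rightField (x : LieAlg A) (a : A) :
    Coalgebra.counit (R := ℂ) (rightField x a) = x.eval a := by
  have h := toConv_comp_rightField (Coalgebra.counit (R := ℂ)) x
  rw [scalarConv_self] at h
  exact congrArg (fun F : WithConv (A →ₗ[ℂ] ℂ) => F.ofConv a) (h.trans (mul_one _))

theorem comul_leftField (x : LieAlg A) (a : A) :
    Coalgebra.comul (R := ℂ) (leftField x a) =
      TensorProduct.map LinearMap.id (leftField x) (Coalgebra.comul (R := ℂ) a) := by
  have h : ∀ s : A ⊗[ℂ] (A ⊗[ℂ] A), TensorProduct.map LinearMap.id (rslice x.eval) s =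
      rslice x.eval ((TensorProduct.assoc ℂ A A A).symm s) := by
    intro s
    induction s with
    | zero => simp
    | add s t hs ht => simp only [map_add, hs, ht]
    | tmul a s =>
      induction s with
      | zero => simp
      | add s t hs ht => simp only [TensorProduct.tmul_add, map_add, hs, ht]
      | tmul b c => simp
  have h2 : ∀ s : A ⊗[ℂ] A, Coalgebra.comul (R := ℂ) (rslice x.eval s) =
      rslice x.eval (LinearMap.rTensor A Coalgebra.comul s) := by
    intro s
    induction s with
    | zero => simp
    | add s t hs ht => simp only [map_add, hs, ht]
    | tmul b c => simp
  rw [leftField, LinearMap.comp_apply, h2, ← Coalgebra.coassoc_symm_apply, ← h]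
  generalize Coalgebra.comul (R := ℂ) a = s
  induction s with
  | zero => simp
  | add s t hs ht => simp only [map_add, hs, ht]
  | tmul b c => simp

theorem comul_rightField (x : LieAlg A) (a : A) :
    Coalgebra.comul (R := ℂ) (rightField x a) =
      TensorProduct.map (rightField x) LinearMap.id (Coalgebra.comul (R := ℂ) a) := by
  have h : ∀ s : (A ⊗[ℂ] A) ⊗[ℂ] A, TensorProduct.map (lslice x.eval) LinearMap.id s =
      lslice x.eval (TensorProduct.assoc ℂ A A A s) := by
    intro s
    induction s with
    | zero => simp
    | add s t hs ht => simp only [map_add, hs, ht]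
    | tmul s a =>
      induction s with
      | zero => simp
      | add s t hs ht => simp only [TensorProduct.add_tmul, map_add, hs, ht]
      | tmul b c => simp [TensorProduct.smul_tmul']
  have h2 : ∀ s : A ⊗[ℂ] A, Coalgebra.comul (R := ℂ) (lslice x.eval s) =
      lslice x.eval (LinearMap.lTensor A Coalgebra.comul s) := by
    intro s
    induction s with
    | zero => simp
    | add s t hs ht => simp only [map_add, hs, ht]
    | tmul b c => simp
  rw [rightField, LinearMap.comp_apply, h2, ← Coalgebra.coassoc_apply, ← h]
  generalize Coalgebra.comul (R := ℂ) a = s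
  induction s with
  | zero => simp
  | add s t hs ht => simp only [map_add, hs, ht]
  | tmul b c => simp

/-- Both sides apply x to the middle leg of the iterated coproduct. On functions of a product g h,
the left field in g equals the right field in h; this is the cancellation behind multiplicativity.
-/
theorem map_leftField_id_comul (x : LieAlg A) (a : A) :
    TensorProduct.map (leftField x) LinearMap.id (Coalgebra.comul (R := ℂ) a) =
      TensorProduct.map LinearMap.id (rightField x) (Coalgebra.comul (R := ℂ) a) := by
  have h1 : ∀ s : A ⊗[ℂ] A, TensorProduct.map (leftField x) LinearMap.id s =
      TensorProduct.map (rslice x.eval) LinearMap.id (LinearMap.rTensor A Coalgebra.comul s) := by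
    intro s
    rw [LinearMap.rTensor, ← LinearMap.comp_apply, ← TensorProduct.map_comp]
    rfl
  have h2 : ∀ s : A ⊗[ℂ] A, TensorProduct.map LinearMap.id (rightField x) s =
      TensorProduct.map LinearMap.id (lslice x.eval) (LinearMap.lTensor A Coalgebra.comul s) := by
    intro s
    rw [LinearMap.lTensor, ← LinearMap.comp_apply, ← TensorProduct.map_comp]
    rfl
  rw [h1, h2, ← Coalgebra.coassoc_apply]
  generalize LinearMap.rTensor A Coalgebra.comul (Coalgebra.comul (R := ℂ) a) = s
  induction s with
  | zero => simp
  | add s t hs ht => simp only [map_add, hs, ht]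
  | tmul s a =>
    induction s with
    | zero => simp
    | add s t hs ht => simp only [TensorProduct.add_tmul, map_add, hs, ht]
    | tmul b c => simp [TensorProduct.smul_tmul]

end Conv

/-! ### The Casimir element -/

section Casimir

variable {A : Type u} [CommRing A] [HopfAlgebra ℂ A] {ι : Type w} [Fintype ι]

/-- `∑ e' i ⊗ e i` is the Casimir element of the form `κ`. -/
structure IsDualPair (κ : LinearMap.BilinForm ℂ (LieAlg A)) (e e' : ι → LieAlg A) : Prop where
  symm : ∀ x y, κ x y = κ y x
  left : ∀ y, ∑ i, κ y (e i) • e' i = y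
  right : ∀ y, ∑ i, κ y (e' i) • e i = y

theorem exists_isDualPair [Algebra.FiniteType ℂ A] {κ : LinearMap.BilinForm ℂ (LieAlg A)}
    (hκ_nondeg : κ.Nondegenerate) (hκ_symm : ∀ x y, κ x y = κ y x) :
    ∃ e e' : Fin (Module.finrank ℂ (LieAlg A)) → LieAlg A, IsDualPair κ e e' := by
  classical
  let b := Module.finBasis ℂ (LieAlg A)
  refine ⟨b, κ.dualBasis hκ_nondeg b, hκ_symm, fun y => ?_, fun y => ?_⟩
  · have h := (κ.dualBasis hκ_nondeg b).sum_repr y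
    simpa only [LinearMap.BilinForm.dualBasis_repr_apply] using h
  · have h := (κ.dualBasis hκ_nondeg (κ.dualBasis hκ_nondeg b)).sum_repr y
    rw [LinearMap.BilinForm.dualBasis_dualBasis hκ_nondeg ⟨hκ_symm⟩] at h
    have h' : ∀ i, b.repr y i = κ y (κ.dualBasis hκ_nondeg b i) := fun i => by
      rw [← LinearMap.BilinForm.dualBasis_repr_apply hκ_nondeg,
        LinearMap.BilinForm.dualBasis_dualBasis hκ_nondeg ⟨hκ_symm⟩]
    simpa only [h'] using h

variable {κ : LinearMap.BilinForm ℂ (LieAlg A)} {e e' : ι → LieAlg A}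
variable {V : Type v} [AddCommGroup V] [Module ℂ V]

/-- Under κ the Casimir tensor corresponds to the identity map, so an operator on one leg may be
moved to the other as its adjoint. -/
theorem IsDualPair.sum_adjoint (h : IsDualPair κ e e') (β : LieAlg A →ₗ[ℂ] LieAlg A →ₗ[ℂ] V)
    {φ ψ : LieAlg A → LieAlg A} (hφ : ∀ x y, κ (φ x) y = κ x (ψ y)) :
    ∑ i, β (φ (e' i)) (e i) = ∑ i, β (e' i) (ψ (e i)) := by
  have h1 : ∀ i, β (φ (e' i)) (e i) = ∑ j, κ (e' i) (ψ (e j)) • β (e' j) (e i) := fun i => by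
    conv_lhs => rw [← h.left (φ (e' i))]
    simp [hφ]
  have h2 : ∀ j, β (e' j) (ψ (e j)) = ∑ i, κ (e' i) (ψ (e j)) • β (e' j) (e i) := fun j => by
    conv_lhs => rw [← h.right (ψ (e j))]
    simp [h.symm (ψ (e j))]
  simp only [h1, h2]
  exact Finset.sum_comm

theorem IsDualPair.sum_symm (h : IsDualPair κ e e') (β : LieAlg A →ₗ[ℂ] LieAlg A →ₗ[ℂ] V) :
    ∑ i, β (e' i) (e i) = ∑ i, β (e i) (e' i) := by
  have h1 : ∀ i, β (e' i) (e i) = ∑ j, κ (e' i) (e' j) • β (e j) (e i) := fun i => by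
    conv_lhs => rw [← h.right (e' i)]
    simp
  have h2 : ∀ j, β (e j) (e' j) = ∑ i, κ (e' i) (e' j) • β (e j) (e i) := fun j => by
    conv_lhs => rw [← h.right (e' j)]
    simp [h.symm (e' j)]
  simp only [h1, h2]
  exact Finset.sum_comm

end Casimir


namespace LoopRing

variable {A : Type u} [CommRing A] [HopfAlgebra ℂ A]

/-! ### Biderivations with prescribed values on generators -/

/-- For fixed b⁽ⁿ⁾ the values prescribe a derivation in the first argument. Skew symmetry turns the
hypotheses on the first argument into relations between these derivations as b and n vary, which are
exactly what is needed to extend to the second argument. -/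
theorem exists_biderivation (q : ℕ → ℕ → A →ₗ[ℂ] A →ₗ[ℂ] LoopRing A)
    (hzero : ∀ n, q 0 n = 0) (hone : ∀ m n b, q m n 1 b = 0)
    (hmul : ∀ m n a a' b, q m n (a * a') b = ∑ p ∈ Finset.HasAntidiagonal.antidiagonal m,
      (gen a p.1 * q p.2 n a' b + gen a' p.2 * q p.1 n a b))
    (hskew : ∀ m n a b, q m n a b = -q n m b a) :
    ∃ P : LoopRing A →ₗ[ℂ] LoopRing A →ₗ[ℂ] LoopRing A,
      (∀ f, IsDerivAlong (AlgHom.id ℂ _) (P f)) ∧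
      (∀ f, IsDerivAlong (AlgHom.id ℂ _) (P.flip f)) ∧
      ∀ a m b n, P (gen a m) (gen b n) = q m n a b := by
  let D : A → ℕ → LoopRing A →ₗ[ℂ] LoopRing A := fun b n =>
    mkDeriv (fun m => (q m n).flip b) (fun a => by simp [hzero])
      (fun m => hone m n b) (fun m a a' => hmul m n a a' b)
  have hD : ∀ b n, IsDerivAlong (AlgHom.id ℂ _) (D b n) := fun b n =>
    mkDeriv_isDerivAlong _ _ _ _
  have hDgen : ∀ b n a m, D b n (gen a m) = q m n a b := fun b n a m => mkDeriv_gen _ _ _ _ _ _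
  have hDadd : ∀ b b' n, D (b + b') n = D b n + D b' n := fun b b' n =>
    derivAlong_ext (hD _ _) ((hD _ _).add (hD _ _)) fun a m => by simp [hDgen]
  have hDsmul : ∀ (c : ℂ) b n, D (c • b) n = c • D b n := fun c b n =>
    derivAlong_ext (hD _ _) ((hD _ _).smul c) fun a m => by simp [hDgen]
  have hDzero : ∀ b, D b 0 = 0 := fun b =>
    derivAlong_ext (hD _ _) (fun f g => by simp) fun a m => by
      rw [hDgen, hskew, hzero]; simp
  have hDone : ∀ n, D 1 n = 0 := fun n =>
    derivAlong_ext (hD _ _) (fun f g => by simp) fun a m => by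
      rw [hDgen, hskew, hone]; simp
  have hDmul : ∀ n b b', D (b * b') n = ∑ p ∈ Finset.HasAntidiagonal.antidiagonal n,
      (LinearMap.mulLeft ℂ (gen b p.1) ∘ₗ D b' p.2 +
        LinearMap.mulLeft ℂ (gen b' p.2) ∘ₗ D b p.1) := fun n b b' =>
    derivAlong_ext (hD _ _) (IsDerivAlong.sum _ fun p _ =>
      ((hD _ _).mulLeft _).add ((hD _ _).mulLeft _)) fun a m => by
        simp only [LinearMap.sum_apply, LinearMap.add_apply, LinearMap.comp_apply,
          LinearMap.mulLeft_apply, hDgen]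
        rw [hskew, hmul, ← Finset.sum_neg_distrib]
        refine Finset.sum_congr rfl fun p _ => ?_
        rw [hskew m p.2, hskew m p.1]
        ring
  let D' : LoopRing A → ℕ → A →ₗ[ℂ] LoopRing A := fun f n =>
    { toFun := fun b => D b n f
      map_add' := fun b b' => by rw [hDadd]; rfl
      map_smul' := fun c b => by rw [hDsmul]; rfl }
  let P : LoopRing A → LoopRing A →ₗ[ℂ] LoopRing A := fun f =>
    mkDeriv (D' f) (fun b => congrArg (fun F : LoopRing A →ₗ[ℂ] LoopRing A => F f) (hDzero b))
      (fun n => congrArg (fun F : LoopRing A →ₗ[ℂ] LoopRing A => F f) (hDone n))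
      (fun n b b' => by
        have h := congrArg (fun F : LoopRing A →ₗ[ℂ] LoopRing A => F f) (hDmul n b b')
        rw [LinearMap.sum_apply] at h
        refine h.trans ?_
        simp only [LinearMap.add_apply, LinearMap.comp_apply, LinearMap.mulLeft_apply]
        rfl)
  have hP : ∀ f, IsDerivAlong (AlgHom.id ℂ _) (P f) := fun f => mkDeriv_isDerivAlong _ _ _ _
  have hPgen : ∀ f b n, P f (gen b n) = D b n f := fun f b n => mkDeriv_gen _ _ _ _ _ _
  let PL : LoopRing A →ₗ[ℂ] LoopRing A →ₗ[ℂ] LoopRing A :=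
    { toFun := P
      map_add' := fun f g => derivAlong_ext (hP _) ((hP _).add (hP _)) fun a m => by
        simp [hPgen]
      map_smul' := fun c f => derivAlong_ext (hP _) ((hP _).smul c) fun a m => by
        simp [hPgen] }
  refine ⟨PL, hP, fun h f g => ?_, fun a m b n => (hPgen _ _ _).trans (hDgen _ _ _ _)⟩
  have : P (f * g) = LinearMap.mulLeft ℂ f ∘ₗ P g + LinearMap.mulLeft ℂ g ∘ₗ P f :=
    derivAlong_ext (hP _) (((hP _).mulLeft _).add ((hP _).mulLeft _)) fun a m => by
      simp only [LinearMap.add_apply, LinearMap.comp_apply, LinearMap.mulLeft_apply, hPgen]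
      exact hD _ _ f g
  exact congrArg (fun F : LoopRing A →ₗ[ℂ] LoopRing A => F h) this

/-! ### The bracket on generators -/

/-- In generating series in u and t, the shifted difference encodes multiplication by t - u.
Identities involving the denominator u - t can thus be checked after clearing it, given the row of
index 0. -/
theorem eq_of_shift_eq {M : Type*} [AddCommGroup M] {Z Z' : ℕ → ℕ → M}
    (h0 : ∀ n, Z 0 n = Z' 0 n)
    (h : ∀ m n, Z (m + 1) n - Z m (n + 1) = Z' (m + 1) n - Z' m (n + 1)) (m n : ℕ) :
    Z m n = Z' m n := by
  induction m generalizing n with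
  | zero => exact h0 n
  | succ m ih =>
    have := h m n
    rwa [ih, sub_left_inj] at this

variable {ι : Type w} [Fintype ι] (e e' : ι → LieAlg A)

/-- The difference of the left and right invariant bivector fields of the Casimir element. -/
noncomputable def casimirDiff (a b : A) : A :=
  ∑ i, (leftField (e' i) a * leftField (e i) b - rightField (e' i) a * rightField (e i) b)

/-- The coefficient of `uᵐ tⁿ` in the Casimir difference of `a(g(u))` and `b(g(t))`. -/
noncomputable def casimirCoeff (m n : ℕ) : A →ₗ[ℂ] A →ₗ[ℂ] LoopRing A :=
  ∑ i, ((LinearMap.mul ℂ (LoopRing A)).compl₁₂ (genL A m ∘ₗ leftField (e' i))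
      (genL A n ∘ₗ leftField (e i)) -
    (LinearMap.mul ℂ (LoopRing A)).compl₁₂ (genL A m ∘ₗ rightField (e' i))
      (genL A n ∘ₗ rightField (e i)))

theorem casimirCoeff_apply (m n : ℕ) (a b : A) : casimirCoeff e e' m n a b =
    ∑ i, (gen (leftField (e' i) a) m * gen (leftField (e i) b) n -
      gen (rightField (e' i) a) m * gen (rightField (e i) b) n) := by
  simp [casimirCoeff, LinearMap.sum_apply]

/-- Setting u = t: this is the obstruction to dividing the Casimir series by u - t. -/
theorem sum_casimirCoeff (k : ℕ) (a b : A) :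
    ∑ p ∈ Finset.HasAntidiagonal.antidiagonal k, casimirCoeff e e' p.1 p.2 a b =
      gen (casimirDiff e e' a b) k := by
  simp only [casimirCoeff_apply]
  rw [Finset.sum_comm, ← genL_apply, casimirDiff, map_sum]
  refine Finset.sum_congr rfl fun i _ => ?_
  rw [map_sub, genL_apply, genL_apply, gen_mul, gen_mul, Finset.sum_sub_distrib]

theorem casimirCoeff_one (m n : ℕ) (b : A) : casimirCoeff e e' m n 1 b = 0 := by
  rw [casimirCoeff_apply]
  simp only [leftField_one, rightField_one]
  simp [← genL_apply]

theorem casimirCoeff_mul (m n : ℕ) (a a' b : A) : casimirCoeff e e' m n (a * a') b =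
    ∑ p ∈ Finset.HasAntidiagonal.antidiagonal m,
      (gen a p.1 * casimirCoeff e e' p.2 n a' b + gen a' p.2 * casimirCoeff e e' p.1 n a b) := by
  have hL : ∀ (D : A →ₗ[ℂ] A), D (a * a') = a * D a' + a' * D a → gen (D (a * a')) m =
      ∑ p ∈ Finset.HasAntidiagonal.antidiagonal m,
        (gen a p.1 * gen (D a') p.2 + gen a' p.2 * gen (D a) p.1) := by
    intro D hD
    rw [hD, gen_add, gen_mul, gen_mul, Finset.sum_add_distrib]
    congr 1
    exact (Finset.Nat.sum_antidiagonal_swap (n := m) (f := fun p => gen a' p.1 * gen (D a) p.2)).symm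
  simp only [casimirCoeff_apply, Finset.mul_sum]
  simp only [← Finset.sum_add_distrib]
  rw [Finset.sum_comm]
  refine Finset.sum_congr rfl fun i _ => ?_
  rw [hL _ (leftField_mul _ _ _), hL _ (rightField_mul _ _ _), Finset.sum_mul, Finset.sum_mul,
    ← Finset.sum_sub_distrib]
  exact Finset.sum_congr rfl fun p _ => by ring

/-- The bracket of `a⁽ᵐ⁾` and `b⁽ⁿ⁾`. -/
noncomputable def genBracket : ℕ → ℕ → A →ₗ[ℂ] A →ₗ[ℂ] LoopRing A
  | 0, _ => 0
  | m + 1, n => genBracket m (n + 1) - casimirCoeff e e' m n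

theorem genBracket_zero (n : ℕ) : genBracket e e' 0 n = 0 := rfl

/-- Let Q(u, t) and C(u, t) be the generating series of `genBracket` and `casimirCoeff`. With
vanishing row and column of index 0 (the column is `genBracket_snd_zero`), the recursion reads (u -
t) Q = u t C. For u = z⁻¹, t = w⁻¹ this is Q = C / (w - z), the rational r-matrix bracket. -/
theorem genBracket_succ (m n : ℕ) (a b : A) : genBracket e e' (m + 1) n a b =
    genBracket e e' m (n + 1) a b - casimirCoeff e e' m n a b := rfl

theorem genBracket_eq_sum (m n : ℕ) (a b : A) : genBracket e e' m n a b =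
    -∑ j ∈ Finset.range m, casimirCoeff e e' (m - 1 - j) (n + j) a b := by
  induction m generalizing n with
  | zero => simp [genBracket_zero]
  | succ m ih =>
    rw [genBracket_succ, ih, Finset.sum_range_succ', neg_add']
    congr 2
    exact Finset.sum_congr rfl fun j _ => by
      rw [Nat.add_assoc, Nat.add_comm 1 j, Nat.sub_sub, Nat.add_sub_cancel, Nat.add_comm 1 j]

theorem genBracket_one (m n : ℕ) (b : A) : genBracket e e' m n 1 b = 0 := by
  rw [genBracket_eq_sum]
  simp [casimirCoeff_one]

theorem genBracket_mul (m n : ℕ) (a a' b : A) : genBracket e e' m n (a * a') b =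
    ∑ p ∈ Finset.HasAntidiagonal.antidiagonal m,
      (gen a p.1 * genBracket e e' p.2 n a' b + gen a' p.2 * genBracket e e' p.1 n a b) := by
  refine eq_of_shift_eq (Z := fun m n => genBracket e e' m n (a * a') b)
    (Z' := fun m n => ∑ p ∈ Finset.HasAntidiagonal.antidiagonal m,
      (gen a p.1 * genBracket e e' p.2 n a' b + gen a' p.2 * genBracket e e' p.1 n a b))
    (fun n => by simp [genBracket_zero]) (fun m n => ?_) m n
  -- Each antidiagonal of `m + 1` is peeled at the end where the bracket has first index 0, so the
  -- boundary term vanishes and the rest is a shifted antidiagonal of `m`.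
  rw [Finset.sum_add_distrib, Finset.sum_add_distrib,
    Finset.Nat.sum_antidiagonal_succ' (n := m)
      (f := fun p => gen a p.1 * genBracket e e' p.2 n a' b),
    Finset.Nat.sum_antidiagonal_succ (n := m)
      (f := fun p => gen a' p.2 * genBracket e e' p.1 n a b)]
  simp only [genBracket_zero, genBracket_succ, casimirCoeff_mul, LinearMap.zero_apply, mul_zero,
    mul_sub, Finset.sum_sub_distrib, Finset.sum_add_distrib]
  ring

section Invariant

variable {e e'} {κ : LinearMap.BilinForm ℂ (LieAlg A)}

theorem casimirCoeff_swap (hd : IsDualPair κ e e') (m n : ℕ) (a b : A) :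
    casimirCoeff e e' m n a b = casimirCoeff e e' n m b a := by
  have h := fun (F : LieAlg A →ₗ[ℂ] A →ₗ[ℂ] A) => hd.sum_symm
    ((LinearMap.mul ℂ (LoopRing A)).compl₁₂ (genL A m ∘ₗ F.flip a) (genL A n ∘ₗ F.flip b))
  have h1 := h (leftFieldL A)
  have h2 := h (rightFieldL A)
  rw [casimirCoeff_apply, casimirCoeff_apply, Finset.sum_sub_distrib, Finset.sum_sub_distrib]
  congr 1
  · exact h1.trans (Finset.sum_congr rfl fun i _ => mul_comm (gen _ m) (gen _ n))
  · exact h2.trans (Finset.sum_congr rfl fun i _ => mul_comm (gen _ m) (gen _ n))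

/-- A left field commutes with the right fields, and its commutators with the left fields add up to
the action of ad y on the Casimir tensor, which is zero by invariance of κ. -/
theorem leftField_casimirDiff (hd : IsDualPair κ e e')
    (hκ_inv : ∀ x y w, κ ⁅x, y⁆ w = κ x ⁅y, w⁆) (y : LieAlg A) (a b : A) :
    leftField y (casimirDiff e e' a b) =
      casimirDiff e e' (leftField y a) b + casimirDiff e e' a (leftField y b) := by
  have hadj : ∀ x w, κ ⁅y, x⁆ w = κ x (-⁅y, w⁆) := fun x w => by
    rw [← lie_skew, map_neg, LinearMap.neg_apply, hκ_inv, map_neg]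
  have h := hd.sum_adjoint ((LinearMap.mul ℂ A).compl₁₂ ((leftFieldL A).flip a)
    ((leftFieldL A).flip b)) hadj
  have h' : ∑ i, (leftField ⁅y, e' i⁆ a * leftField (e i) b +
      leftField (e' i) a * leftField ⁅y, e i⁆ b) = 0 := by
    rw [Finset.sum_add_distrib]
    refine (congrArg (· + _) h).trans ?_
    rw [← Finset.sum_add_distrib]
    refine Finset.sum_eq_zero fun i _ => ?_
    rw [map_neg]
    exact neg_add_cancel _
  rw [casimirDiff, casimirDiff, casimirDiff, map_sum, ← Finset.sum_add_distrib, ← sub_eq_zero,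
    ← Finset.sum_sub_distrib, ← h']
  refine Finset.sum_congr rfl fun i _ => ?_
  rw [map_sub, leftField_mul, leftField_mul, leftField_rightField, leftField_rightField,
    leftField_lie, leftField_lie]
  ring

/-- The coefficients vanish at e, and invariant fields send them to lower coefficients of the same
kind, so induction on `k` applies. Vanishing in `A` is not claimed: for disconnected G the form need
only be invariant under the Lie algebra. -/
theorem gen_casimirDiff [Algebra.FiniteType ℂ A] (hd : IsDualPair κ e e')
    (hκ_inv : ∀ x y w, κ ⁅x, y⁆ w = κ x ⁅y, w⁆) (k : ℕ) (a b : A) :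
    gen (casimirDiff e e' a b) k = 0 := by
  have hε : Coalgebra.counit (R := ℂ) (casimirDiff e e' a b) = 0 := by
    simp only [casimirDiff, map_sum, map_sub, Bialgebra.counit_mul, counit_leftField,
      counit_rightField, sub_self, Finset.sum_const_zero]
  induction k using Nat.strong_induction_on generalizing a b with
  | _ k ih =>
    refine eq_zero_of_loopField_eq_zero (fun x n => ?_) ?_
    · rw [loopField_gen]
      split_ifs with h
      · have hε' : ∀ a b, Coalgebra.counit (R := ℂ) (casimirDiff e e' a b) = 0 := fun a b => by
          simp only [casimirDiff, map_sum, map_sub, Bialgebra.counit_mul, counit_leftField,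
            counit_rightField, sub_self, Finset.sum_const_zero]
        rw [leftField_casimirDiff hd hκ_inv, gen_add, ih _ (by omega) _ _ (hε' _ _),
          ih _ (by omega) _ _ (hε' _ _), add_zero]
      · rfl
    · rw [eps_gen, hε, ite_self]

/-- The column of index 0 collects a full antidiagonal of Casimir coefficients, that is, the
diagonal value u = t. It must vanish because b⁽⁰⁾ is a constant. -/
theorem genBracket_snd_zero [Algebra.FiniteType ℂ A] (hd : IsDualPair κ e e')
    (hκ_inv : ∀ x y w, κ ⁅x, y⁆ w = κ x ⁅y, w⁆) (m : ℕ) (a b : A) :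
    genBracket e e' m 0 a b = 0 := by
  rw [genBracket_eq_sum]
  cases m with
  | zero => simp
  | succ m =>
    have h := sum_casimirCoeff e e' m a b
    rw [gen_casimirDiff hd hκ_inv, ← Finset.Nat.sum_antidiagonal_swap,
      Finset.Nat.sum_antidiagonal_eq_sum_range_succ_mk] at h
    simpa using h

/-- The Casimir series is symmetric and u - t is antisymmetric. The initial condition of the
recursion is the vanishing column. -/
theorem genBracket_skew [Algebra.FiniteType ℂ A] (hd : IsDualPair κ e e')
    (hκ_inv : ∀ x y w, κ ⁅x, y⁆ w = κ x ⁅y, w⁆) (m n : ℕ) (a b : A) :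
    genBracket e e' m n a b = -genBracket e e' n m b a := by
  refine eq_of_shift_eq (Z := fun m n => genBracket e e' m n a b)
    (Z' := fun m n => -genBracket e e' n m b a) (fun n => ?_) (fun m n => ?_) m n
  · simp [genBracket_zero, genBracket_snd_zero hd hκ_inv]
  · simp only [genBracket_succ, casimirCoeff_swap hd n m b a]
    ring

theorem exists_loopBracket [Algebra.FiniteType ℂ A] (hd : IsDualPair κ e e')
    (hκ_inv : ∀ x y w, κ ⁅x, y⁆ w = κ x ⁅y, w⁆) :
    ∃ P : LoopRing A →ₗ[ℂ] LoopRing A →ₗ[ℂ] LoopRing A,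
      (∀ f, IsDerivAlong (AlgHom.id ℂ _) (P f)) ∧
      (∀ f, IsDerivAlong (AlgHom.id ℂ _) (P.flip f)) ∧
      ∀ a m b n, P (gen a m) (gen b n) = genBracket e e' m n a b :=
  exists_biderivation _ (genBracket_zero e e') (genBracket_one e e') (genBracket_mul e e')
    (genBracket_skew hd hκ_inv)

end Invariant

end LoopRing

/-! ### Biderivations -/

section Bideriv

variable {B : Type u} [CommRing B] [Algebra ℂ B] {C : Type v} [CommRing C] [Algebra ℂ C]
variable {S : Type w} [CommRing S] [Algebra ℂ S]

/-- A bilinear map is a derivation along `φ` in each argument. -/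
structure IsBideriv (φ : B →ₐ[ℂ] S) (T : B →ₗ[ℂ] B →ₗ[ℂ] S) : Prop where
  snd : ∀ f, IsDerivAlong φ (T f)
  fst : ∀ f, IsDerivAlong φ (T.flip f)

theorem IsBideriv.map_mul {φ : B →ₐ[ℂ] S} {T : B →ₗ[ℂ] B →ₗ[ℂ] S} (h : IsBideriv φ T)
    (f g g' : B) : T f (g * g') = φ g * T f g' + φ g' * T f g := h.snd f g g'

theorem IsBideriv.mul_map {φ : B →ₐ[ℂ] S} {T : B →ₗ[ℂ] B →ₗ[ℂ] S} (h : IsBideriv φ T)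
    (f f' g : B) : T (f * f') g = φ f * T f' g + φ f' * T f g := h.fst g f f'

theorem IsBideriv.flip {φ : B →ₐ[ℂ] S} {T : B →ₗ[ℂ] B →ₗ[ℂ] S} (h : IsBideriv φ T) :
    IsBideriv φ T.flip := ⟨h.fst, h.snd⟩

theorem IsBideriv.zero (φ : B →ₐ[ℂ] S) : IsBideriv φ (0 : B →ₗ[ℂ] B →ₗ[ℂ] S) :=
  ⟨fun _ _ _ => by simp, fun _ _ _ => by simp⟩

theorem IsBideriv.add {φ : B →ₐ[ℂ] S} {T T' : B →ₗ[ℂ] B →ₗ[ℂ] S} (h : IsBideriv φ T)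
    (h' : IsBideriv φ T') : IsBideriv φ (T + T') :=
  ⟨fun f => (h.snd f).add (h'.snd f), fun f => (h.fst f).add (h'.fst f)⟩

theorem IsBideriv.smul {φ : B →ₐ[ℂ] S} {T : B →ₗ[ℂ] B →ₗ[ℂ] S} (h : IsBideriv φ T) (c : ℂ) :
    IsBideriv φ (c • T) :=
  ⟨fun f => (h.snd f).smul c, fun f => (h.fst f).smul c⟩

theorem IsBideriv.sum {ι : Type*} (s : Finset ι) {φ : B →ₐ[ℂ] S} {T : ι → B →ₗ[ℂ] B →ₗ[ℂ] S}
    (h : ∀ i ∈ s, IsBideriv φ (T i)) : IsBideriv φ (∑ i ∈ s, T i) := by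
  classical
  induction s using Finset.induction_on with
  | empty => rw [Finset.sum_empty]; exact IsBideriv.zero φ
  | insert i s hi ih =>
    rw [Finset.sum_insert hi]
    exact (h i (Finset.mem_insert_self i s)).add
      (ih fun j hj => h j (Finset.mem_insert_of_mem hj))

theorem IsBideriv.compHom {φ : B →ₐ[ℂ] S} {T : B →ₗ[ℂ] B →ₗ[ℂ] S} (h : IsBideriv φ T)
    {S' : Type*} [CommRing S'] [Algebra ℂ S'] (F : S →ₐ[ℂ] S') :
    IsBideriv (F.comp φ) (T.compr₂ F.toLinearMap) :=
  ⟨fun f g g' => by simp [h.map_mul], fun f g g' => by simp [h.mul_map]⟩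

theorem IsBideriv.precomp {φ : C →ₐ[ℂ] S} {T : C →ₗ[ℂ] C →ₗ[ℂ] S} (h : IsBideriv φ T)
    (F : B →ₐ[ℂ] C) : IsBideriv (φ.comp F) (T.compl₁₂ F.toLinearMap F.toLinearMap) :=
  ⟨fun f g g' => by simp [h.map_mul], fun f g g' => by simp [h.mul_map]⟩

@[simp] theorem prodBracket_tmul (P : B →ₗ[ℂ] B →ₗ[ℂ] B) (Q : C →ₗ[ℂ] C →ₗ[ℂ] C) (b b' : B)
    (c c' : C) : prodBracket P Q (b ⊗ₜ[ℂ] c) (b' ⊗ₜ[ℂ] c') =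
      P b b' ⊗ₜ[ℂ] (c * c') + (b * b') ⊗ₜ[ℂ] Q c c' := rfl

theorem prodBracket_flip (P : B →ₗ[ℂ] B →ₗ[ℂ] B) (Q : C →ₗ[ℂ] C →ₗ[ℂ] C) :
    (prodBracket P Q).flip = prodBracket P.flip Q.flip := by
  ext b c b' c'
  simp [mul_comm]

theorem prodBracket_isDerivAlong {P : B →ₗ[ℂ] B →ₗ[ℂ] B} {Q : C →ₗ[ℂ] C →ₗ[ℂ] C}
    (hP : ∀ f, IsDerivAlong (AlgHom.id ℂ B) (P f)) (hQ : ∀ f, IsDerivAlong (AlgHom.id ℂ C) (Q f))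
    (s : B ⊗[ℂ] C) : IsDerivAlong (AlgHom.id ℂ (B ⊗[ℂ] C)) (prodBracket P Q s) := by
  intro t t'
  simp only [AlgHom.id_apply]
  induction s with
  | zero => simp
  | add s s' hs hs' => simp only [map_add, LinearMap.add_apply, hs, hs']; ring
  | tmul b c =>
    induction t with
    | zero => simp
    | add t u ht hu => rw [add_mul, map_add, ht, hu, map_add]; ring
    | tmul b' c' =>
      induction t' with
      | zero => simp
      | add t u ht hu => rw [mul_add, map_add, ht, hu, map_add]; ring
      | tmul b'' c'' =>
        have h1 := hP b b' b''
        have h2 := hQ c c' c''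
        simp only [AlgHom.id_apply] at h1 h2
        simp only [Algebra.TensorProduct.tmul_mul_tmul, prodBracket_tmul, h1, h2,
          TensorProduct.tmul_add, TensorProduct.add_tmul, mul_add]
        rw [show c' * (c * c'') = c * (c' * c'') by ring,
          show c'' * (c * c') = c * (c' * c'') by ring,
          show b' * (b * b'') = b * (b' * b'') by ring,
          show b'' * (b * b') = b * (b' * b'') by ring]
        abel

theorem IsBideriv.prod {P : B →ₗ[ℂ] B →ₗ[ℂ] B} {Q : C →ₗ[ℂ] C →ₗ[ℂ] C}
    (hP : IsBideriv (AlgHom.id ℂ B) P) (hQ : IsBideriv (AlgHom.id ℂ C) Q) :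
    IsBideriv (AlgHom.id ℂ (B ⊗[ℂ] C)) (prodBracket P Q) :=
  ⟨prodBracket_isDerivAlong hP.snd hQ.snd, fun s => by
    rw [prodBracket_flip]
    exact prodBracket_isDerivAlong hP.fst hQ.fst s⟩

end Bideriv

namespace LoopRing

variable {A : Type u} [CommRing A] [HopfAlgebra ℂ A]

theorem IsBideriv.ext_gen {S : Type*} [CommRing S] [Algebra ℂ S] {φ : LoopRing A →ₐ[ℂ] S}
    {T T' : LoopRing A →ₗ[ℂ] LoopRing A →ₗ[ℂ] S} (hT : IsBideriv φ T) (hT' : IsBideriv φ T')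
    (h : ∀ a m b n, T (gen a m) (gen b n) = T' (gen a m) (gen b n)) : T = T' :=
  bideriv_ext hT.snd hT.fst hT'.snd hT'.fst h

variable {ι : Type w} [Fintype ι] {e e' : ι → LieAlg A}

variable (e e') in
/-- The biderivation with the given values on generators. -/
structure IsLoopBracket (P : LoopRing A →ₗ[ℂ] LoopRing A →ₗ[ℂ] LoopRing A) : Prop where
  bideriv : IsBideriv (AlgHom.id ℂ _) P
  gen_gen : ∀ a m b n, P (gen a m) (gen b n) = genBracket e e' m n a b

variable {κ : LinearMap.BilinForm ℂ (LieAlg A)}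
  {P : LoopRing A →ₗ[ℂ] LoopRing A →ₗ[ℂ] LoopRing A}

theorem IsLoopBracket.skew [Algebra.FiniteType ℂ A] (hP : IsLoopBracket e e' P)
    (hd : IsDualPair κ e e') (hκ_inv : ∀ x y w, κ ⁅x, y⁆ w = κ x ⁅y, w⁆) (f h : LoopRing A) :
    P f h = -P h f := by
  have key : P = (-1 : ℂ) • P.flip :=
    IsBideriv.ext_gen hP.bideriv (hP.bideriv.flip.smul _) fun a m b n => by
      rw [LinearMap.smul_apply, LinearMap.smul_apply, LinearMap.flip_apply, hP.gen_gen,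
        hP.gen_gen, neg_one_smul, genBracket_skew hd hκ_inv]
  have := congrArg (fun F : LoopRing A →ₗ[ℂ] LoopRing A →ₗ[ℂ] LoopRing A => F f h) key
  simpa using this

/-! ### The Euler identity -/

theorem euler_casimirCoeff (m n : ℕ) (a b : A) : euler A (casimirCoeff e e' m n a b) =
    ((m : ℂ) + n) • casimirCoeff e e' m n a b := by
  rw [casimirCoeff_apply, map_sum, Finset.smul_sum]
  refine Finset.sum_congr rfl fun i _ => ?_
  have h : ∀ c c' : A, euler A (gen c m * gen c' n) = ((m : ℂ) + n) • (gen c m * gen c' n) :=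
    fun c c' => by
      rw [euler_isDerivAlong, euler_gen, euler_gen]
      simp only [AlgHom.id_apply, mul_smul_comm, add_smul]
      rw [mul_comm (gen c' n), add_comm]
  rw [map_sub, h, h, smul_sub]

/-- The Casimir coefficient of index (m, n) has degree m + n but enters brackets of total index m +
n + 1, whence the degree -1. -/
theorem euler_genBracket (m n : ℕ) (a b : A) : euler A (genBracket e e' m n a b) =
    ((m : ℂ) + n - 1) • genBracket e e' m n a b := by
  refine eq_of_shift_eq (Z := fun m n => euler A (genBracket e e' m n a b))
    (Z' := fun m n : ℕ => ((m : ℂ) + n - 1) • genBracket e e' m n a b)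
    (fun n => by simp [genBracket_zero]) (fun m n => ?_) m n
  rw [← map_sub]
  simp only [genBracket_succ, Nat.cast_add, Nat.cast_one]
  rw [sub_sub_cancel_left, map_neg, euler_casimirCoeff, show (m : ℂ) + 1 + n - 1 = m + n by ring,
    show (m : ℂ) + (n + 1) - 1 = m + n by ring, smul_sub]
  abel

theorem IsLoopBracket.euler_apply (hP : IsLoopBracket e e' P) (f h : LoopRing A) :
    euler A (P f h) = P (euler A f) h + P f (euler A h) - P f h := by
  have hE := euler_isDerivAlong (A := A)
  have hb : IsBideriv (AlgHom.id ℂ _) (P.compr₂ (euler A) - P ∘ₗ euler A -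
      P.compl₂ (euler A)) := by
    constructor
    · intro f g g'
      simp [hP.bideriv.map_mul, hE _ _]
      ring
    · intro f g g'
      simp [hP.bideriv.mul_map, hE _ _]
      ring
  have key := IsBideriv.ext_gen hb (hP.bideriv.smul (-1)) fun a m b n => by
    simp only [LinearMap.sub_apply, LinearMap.compr₂_apply, LinearMap.comp_apply,
      LinearMap.compl₂_apply, LinearMap.smul_apply, euler_gen, map_smul, hP.gen_gen,
      euler_genBracket]
    rw [← sub_smul, ← sub_smul]
    congr 1
    ring
  have := congrArg (fun F : LoopRing A →ₗ[ℂ] LoopRing A →ₗ[ℂ] LoopRing A => F f h) key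
  simp only [LinearMap.sub_apply, LinearMap.compr₂_apply, LinearMap.comp_apply,
      LinearMap.compl₂_apply, LinearMap.smul_apply, neg_one_smul, LinearMap.neg_apply] at this
  linear_combination this

/-! ### The anti-automorphism is Poisson -/

theorem sigma_gen (θ : GroupInvolution A) (a : A) (n : ℕ) : sigma θ (gen a n) =
    ((-1 : ℂ) ^ n) • gen (θ.toHom (HopfAlgebra.antipode ℂ a)) n := by
  rw [sigma, lift_gen]
  change PowerSeries.coeff n (LoopGroup.negVar _ (univ.hom (θ.toHom (HopfAlgebra.antipode ℂ a)))) = _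
  rw [LoopGroup.coeff_negVar, coeff_univ, Algebra.smul_def, map_pow, map_neg, map_one]

/-- The antipode exchanges left and right fields. Its signs cancel in each product, but the exchange
reverses the difference and produces the minus sign; ω preserves the Casimir tensor because it
preserves κ. -/
theorem sigma_casimirCoeff (θ : GroupInvolution A) (hd : IsDualPair κ e e')
    (hκ_omega : ∀ x y, κ (θ.onLie x) (θ.onLie y) = κ x y) (m n : ℕ) (a b : A) :
    sigma θ (casimirCoeff e e' m n a b) = -((-1 : ℂ) ^ (m + n)) •
      casimirCoeff e e' m n (θ.toHom (HopfAlgebra.antipode ℂ a))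
        (θ.toHom (HopfAlgebra.antipode ℂ b)) := by
  have hinv : ∀ x : LieAlg A, θ.onLie (θ.onLie x) = x := fun x => by
    apply evalL_injective
    ext a
    exact congrArg x.eval (θ.invol a)
  have hadj : ∀ x y, κ (θ.onLie x) y = κ x (θ.onLie y) := fun x y => by
    rw [← hκ_omega, hinv]
  have hS : ∀ (x : LieAlg A) (a : A), θ.toHom (HopfAlgebra.antipode ℂ (leftField x a)) =
      -rightField (θ.onLie x) (θ.toHom (HopfAlgebra.antipode ℂ a)) := fun x a => by
    rw [rightField_involution, hinv, rightField_antipode, map_neg, neg_neg]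
  have hS' : ∀ (x : LieAlg A) (a : A), θ.toHom (HopfAlgebra.antipode ℂ (rightField x a)) =
      -leftField (θ.onLie x) (θ.toHom (HopfAlgebra.antipode ℂ a)) := fun x a => by
    rw [leftField_involution, hinv, leftField_antipode, map_neg, neg_neg]
  set a' := θ.toHom (HopfAlgebra.antipode ℂ a)
  set b' := θ.toHom (HopfAlgebra.antipode ℂ b)
  have hsum : ∀ F : LieAlg A →ₗ[ℂ] A →ₗ[ℂ] A,
      ∑ i, gen (F (θ.onLie (e' i)) a') m * gen (F (θ.onLie (e i)) b') n =
      ∑ i, gen (F (e' i) a') m * gen (F (e i) b') n := fun F => by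
    have h2 : ∀ β : LieAlg A →ₗ[ℂ] LieAlg A →ₗ[ℂ] LoopRing A,
        ∑ i, β (θ.onLie (e' i)) (θ.onLie (e i)) = ∑ i, β (e' i) (e i) := fun β => by
      let ω : LieAlg A →ₗ[ℂ] LieAlg A :=
        { toFun := θ.onLie, map_add' := fun _ _ => rfl, map_smul' := fun _ _ => rfl }
      have h := hd.sum_adjoint (β.compl₂ ω) (φ := θ.onLie) (ψ := θ.onLie) hadj
      refine h.trans (Finset.sum_congr rfl fun i _ => ?_)
      exact congrArg (β (e' i)) (hinv (e i))
    exact h2 ((LinearMap.mul ℂ (LoopRing A)).compl₁₂ (genL A m ∘ₗ F.flip a')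
      (genL A n ∘ₗ F.flip b'))
  have hneg : ∀ (c : A) (k : ℕ), gen (-c) k = -gen c k := fun c k => map_neg (genL A k) c
  rw [casimirCoeff_apply, casimirCoeff_apply, Finset.sum_sub_distrib, map_sub, map_sum, map_sum,
    Finset.sum_sub_distrib]
  have h1 := hsum (leftFieldL A)
  have h2 := hsum (rightFieldL A)
  change ∑ i, gen (leftField _ a') m * gen (leftField _ b') n =
    ∑ i, gen (leftField _ a') m * gen (leftField _ b') n at h1
  change ∑ i, gen (rightField _ a') m * gen (rightField _ b') n =
    ∑ i, gen (rightField _ a') m * gen (rightField _ b') n at h2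
  rw [← h1, ← h2, neg_smul, ← smul_neg, neg_sub, smul_sub, Finset.smul_sum, Finset.smul_sum]
  congr 1
  · refine Finset.sum_congr rfl fun i _ => ?_
    rw [map_mul, sigma_gen, sigma_gen, hS, hS, hneg, hneg, smul_mul_smul_comm, neg_mul_neg,
      pow_add]
  · refine Finset.sum_congr rfl fun i _ => ?_
    rw [map_mul, sigma_gen, sigma_gen, hS', hS', hneg, hneg, smul_mul_smul_comm, neg_mul_neg,
      pow_add]

/-- The remaining minus sign is absorbed by the recursion, which shifts the total index by one: z ↦
-z negates 1/(w - z). The two sign changes cancel, so σ is Poisson rather than anti-Poisson. -/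
theorem sigma_genBracket (θ : GroupInvolution A) (hd : IsDualPair κ e e')
    (hκ_omega : ∀ x y, κ (θ.onLie x) (θ.onLie y) = κ x y) (m n : ℕ) (a b : A) :
    sigma θ (genBracket e e' m n a b) = ((-1 : ℂ) ^ (m + n)) •
      genBracket e e' m n (θ.toHom (HopfAlgebra.antipode ℂ a))
        (θ.toHom (HopfAlgebra.antipode ℂ b)) := by
  refine eq_of_shift_eq (Z := fun m n => sigma θ (genBracket e e' m n a b))
    (Z' := fun m n : ℕ => ((-1 : ℂ) ^ (m + n)) •
      genBracket e e' m n (θ.toHom (HopfAlgebra.antipode ℂ a))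
        (θ.toHom (HopfAlgebra.antipode ℂ b)))
    (fun n => by simp [genBracket_zero]) (fun m n => ?_) m n
  rw [← map_sub]
  simp only [genBracket_succ]
  rw [sub_sub_cancel_left, map_neg, sigma_casimirCoeff θ hd hκ_omega, show m + 1 + n =
    (m + n) + 1 by ring, show m + (n + 1) = (m + n) + 1 by ring, ← smul_sub, sub_sub_cancel_left,
    pow_succ]
  simp

theorem IsLoopBracket.sigma_isPoissonHom (hP : IsLoopBracket e e' P) (θ : GroupInvolution A)
    (hd : IsDualPair κ e e') (hκ_omega : ∀ x y, κ (θ.onLie x) (θ.onLie y) = κ x y) :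
    IsPoissonHom P P (sigma θ) := by
  intro f h
  have key := IsBideriv.ext_gen (hP.bideriv.compHom (sigma θ)) (hP.bideriv.precomp (sigma θ))
    fun a m b n => by
      simp only [LinearMap.compr₂_apply, LinearMap.compl₁₂_apply, AlgHom.toLinearMap_apply]
      rw [hP.gen_gen, sigma_genBracket θ hd hκ_omega, sigma_gen, sigma_gen, map_smul, map_smul,
        LinearMap.smul_apply, hP.gen_gen, smul_smul, ← pow_add, add_comm n m]
  exact congrArg (fun F : LoopRing A →ₗ[ℂ] LoopRing A →ₗ[ℂ] LoopRing A => F f h) key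

end LoopRing
namespace LoopRing

variable {A : Type u} [CommRing A] [HopfAlgebra ℂ A]

/-! ### Multiplicativity of the bracket -/

variable (A) in
/-- The map `a ⊗ a' ↦ gen a p ⊗ gen a' p'`. -/
noncomputable def genL₂ (p p' : ℕ) : A ⊗[ℂ] A →ₗ[ℂ] LoopRing A ⊗[ℂ] LoopRing A :=
  TensorProduct.map (genL A p) (genL A p')

theorem genL₂_tmul (p p' : ℕ) (a a' : A) : genL₂ A p p' (a ⊗ₜ[ℂ] a') = gen a p ⊗ₜ[ℂ] gen a' p' :=
  rfl

/-- The product of the coefficients of `a` and `b` of the given orders. -/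
noncomputable def genMul (p q : ℕ) : A →ₗ[ℂ] A →ₗ[ℂ] LoopRing A :=
  (LinearMap.mul ℂ (LoopRing A)).compl₁₂ (genL A p) (genL A q)

theorem genMul_apply (p q : ℕ) (a b : A) : genMul p q a b = gen a p * gen b q := rfl

/-- The bracket on `A ⊗ A` with values in `B ⊗ B` defined by brackets `X` on generators. -/
noncomputable def tensorCoeff (X : ℕ → ℕ → A →ₗ[ℂ] A →ₗ[ℂ] LoopRing A) (m n : ℕ) :
    A ⊗[ℂ] A →ₗ[ℂ] A ⊗[ℂ] A →ₗ[ℂ] LoopRing A ⊗[ℂ] LoopRing A :=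
  ∑ p ∈ Finset.HasAntidiagonal.antidiagonal m, ∑ q ∈ Finset.HasAntidiagonal.antidiagonal n,
    (TensorProduct.map₂ (X p.1 q.1) (genMul p.2 q.2) +
      TensorProduct.map₂ (genMul p.1 q.1) (X p.2 q.2))

theorem tensorCoeff_tmul (X : ℕ → ℕ → A →ₗ[ℂ] A →ₗ[ℂ] LoopRing A) (m n : ℕ) (a a' b b' : A) :
    tensorCoeff X m n (a ⊗ₜ[ℂ] a') (b ⊗ₜ[ℂ] b') =
    ∑ p ∈ Finset.HasAntidiagonal.antidiagonal m, ∑ q ∈ Finset.HasAntidiagonal.antidiagonal n,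
      X p.1 q.1 a b ⊗ₜ[ℂ] (gen a' p.2 * gen b' q.2) +
    ∑ p ∈ Finset.HasAntidiagonal.antidiagonal m, ∑ q ∈ Finset.HasAntidiagonal.antidiagonal n,
      (gen a p.1 * gen b q.1) ⊗ₜ[ℂ] X p.2 q.2 a' b' := by
  simp only [tensorCoeff, LinearMap.sum_apply, LinearMap.add_apply, TensorProduct.map₂_apply_tmul,
    TensorProduct.map_tmul, genMul_apply, Finset.sum_add_distrib]

theorem tensor_bilinear_ext {M : Type*} [AddCommGroup M] [Module ℂ M]
    {T T' : A ⊗[ℂ] A →ₗ[ℂ] A ⊗[ℂ] A →ₗ[ℂ] M}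
    (h : ∀ a a' b b', T (a ⊗ₜ[ℂ] a') (b ⊗ₜ[ℂ] b') = T' (a ⊗ₜ[ℂ] a') (b ⊗ₜ[ℂ] b')) : T = T' := by
  ext a a' b b'
  exact h a a' b b'

variable {ι : Type w} [Fintype ι] {e e' : ι → LieAlg A}
variable {κ : LinearMap.BilinForm ℂ (LieAlg A)}
  {P : LoopRing A →ₗ[ℂ] LoopRing A →ₗ[ℂ] LoopRing A}

theorem IsLoopBracket.prodBracket_comul_gen (hP : IsLoopBracket e e' P) (m n : ℕ) (a b : A) :
    prodBracket P P (comul A (gen a m)) (comul A (gen b n)) =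
      tensorCoeff (genBracket e e') m n (Coalgebra.comul (R := ℂ) a)
        (Coalgebra.comul (R := ℂ) b) := by
  have h : ∑ p ∈ Finset.HasAntidiagonal.antidiagonal m,
      ∑ q ∈ Finset.HasAntidiagonal.antidiagonal n,
        (prodBracket P P).compl₁₂ (genL₂ A p.1 p.2) (genL₂ A q.1 q.2) =
      tensorCoeff (genBracket e e') m n := tensor_bilinear_ext fun a a' b b' => by
    simp only [tensorCoeff_tmul, LinearMap.sum_apply, LinearMap.compl₁₂_apply, genL₂_tmul,
      prodBracket_tmul, hP.gen_gen, Finset.sum_add_distrib]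
  rw [← h, comul_gen, comul_gen, map_sum, LinearMap.sum_apply]
  simp only [map_sum, LinearMap.sum_apply]
  rw [Finset.sum_comm]
  rfl

theorem tensorCoeff_genBracket_zero (n : ℕ) :
    tensorCoeff (genBracket e e') 0 n = 0 := tensor_bilinear_ext fun a a' b b' => by
  simp [tensorCoeff_tmul, genBracket_zero]

/-- The recursion survives the double Cauchy product because both the row and the column of index 0
vanish, leaving no boundary terms. -/
theorem tensorCoeff_genBracket_succ [Algebra.FiniteType ℂ A] (hd : IsDualPair κ e e')
    (hκ_inv : ∀ x y w, κ ⁅x, y⁆ w = κ x ⁅y, w⁆) (m n : ℕ) :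
    tensorCoeff (genBracket e e') (m + 1) n = tensorCoeff (genBracket e e') m (n + 1) -
      tensorCoeff (casimirCoeff e e') m n := tensor_bilinear_ext fun a a' b b' => by
  simp only [LinearMap.sub_apply, tensorCoeff_tmul]
  rw [add_sub_add_comm]
  congr 1
  · rw [Finset.Nat.sum_antidiagonal_succ]
    simp only [Finset.Nat.sum_antidiagonal_succ (n := n), genBracket_snd_zero hd hκ_inv,
      genBracket_zero, genBracket_succ, LinearMap.zero_apply, TensorProduct.zero_tmul,
      Finset.sum_const_zero, zero_add, TensorProduct.sub_tmul, Finset.sum_sub_distrib]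
  · rw [Finset.Nat.sum_antidiagonal_succ']
    simp only [Finset.Nat.sum_antidiagonal_succ' (n := n), genBracket_snd_zero hd hκ_inv,
      genBracket_zero, genBracket_succ, LinearMap.zero_apply, TensorProduct.tmul_zero,
      Finset.sum_const_zero, zero_add, TensorProduct.tmul_sub, Finset.sum_sub_distrib]

theorem tensorCoeff_casimirCoeff (m n : ℕ) :
    tensorCoeff (casimirCoeff e e') m n =
    ∑ p ∈ Finset.HasAntidiagonal.antidiagonal m, ∑ q ∈ Finset.HasAntidiagonal.antidiagonal n,
      ∑ i, ((LinearMap.mul ℂ _).compl₁₂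
          (genL₂ A p.1 p.2 ∘ₗ TensorProduct.map (leftField (e' i)) LinearMap.id)
          (genL₂ A q.1 q.2 ∘ₗ TensorProduct.map (leftField (e i)) LinearMap.id) -
        (LinearMap.mul ℂ _).compl₁₂
          (genL₂ A p.1 p.2 ∘ₗ TensorProduct.map (rightField (e' i)) LinearMap.id)
          (genL₂ A q.1 q.2 ∘ₗ TensorProduct.map (rightField (e i)) LinearMap.id) +
        ((LinearMap.mul ℂ _).compl₁₂
          (genL₂ A p.1 p.2 ∘ₗ TensorProduct.map LinearMap.id (leftField (e' i)))
          (genL₂ A q.1 q.2 ∘ₗ TensorProduct.map LinearMap.id (leftField (e i))) -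
        (LinearMap.mul ℂ _).compl₁₂
          (genL₂ A p.1 p.2 ∘ₗ TensorProduct.map LinearMap.id (rightField (e' i)))
          (genL₂ A q.1 q.2 ∘ₗ TensorProduct.map LinearMap.id (rightField (e i))))) := by
  refine tensor_bilinear_ext fun a a' b b' => ?_
  simp only [tensorCoeff_tmul, LinearMap.sum_apply, LinearMap.add_apply, LinearMap.sub_apply,
    LinearMap.compl₁₂_apply, LinearMap.comp_apply, TensorProduct.map_tmul, genL₂_tmul,
    LinearMap.mul_apply', Algebra.TensorProduct.tmul_mul_tmul, LinearMap.id_apply,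
    casimirCoeff_apply, TensorProduct.sum_tmul, TensorProduct.tmul_sum, TensorProduct.sub_tmul,
    TensorProduct.tmul_sub, Finset.sum_add_distrib]

/-- On a product g h the left fields act on h and the right fields on g. The extra terms on the
right side, left fields on g and right fields on h, cancel by `map_leftField_id_comul`. -/
theorem comul_casimirCoeff (m n : ℕ) (a b : A) : comul A (casimirCoeff e e' m n a b) =
    tensorCoeff (casimirCoeff e e') m n (Coalgebra.comul (R := ℂ) a)
      (Coalgebra.comul (R := ℂ) b) := by
  have hL : ∀ x (c : A) k, comul A (gen (leftField x c) k) =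
      ∑ p ∈ Finset.HasAntidiagonal.antidiagonal k, genL₂ A p.1 p.2
        (TensorProduct.map LinearMap.id (leftField x) (Coalgebra.comul (R := ℂ) c)) :=
    fun x c k => by rw [comul_gen, comul_leftField]; rfl
  have hR : ∀ x (c : A) k, comul A (gen (rightField x c) k) =
      ∑ p ∈ Finset.HasAntidiagonal.antidiagonal k, genL₂ A p.1 p.2
        (TensorProduct.map (rightField x) LinearMap.id (Coalgebra.comul (R := ℂ) c)) :=
    fun x c k => by rw [comul_gen, comul_rightField]; rfl
  rw [tensorCoeff_casimirCoeff, casimirCoeff_apply, map_sum]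
  simp only [LinearMap.sum_apply, LinearMap.add_apply, LinearMap.sub_apply,
    LinearMap.compl₁₂_apply, LinearMap.comp_apply, LinearMap.mul_apply', map_sub, map_mul, hL, hR,
    map_leftField_id_comul]
  rw [Finset.sum_congr rfl fun p _ => Finset.sum_comm, Finset.sum_comm]
  refine Finset.sum_congr rfl fun i _ => ?_
  rw [Finset.sum_mul_sum, Finset.sum_mul_sum, ← Finset.sum_sub_distrib]
  refine Finset.sum_congr rfl fun p _ => ?_
  rw [← Finset.sum_sub_distrib]
  exact Finset.sum_congr rfl fun q _ => by abel

theorem comul_genBracket [Algebra.FiniteType ℂ A] (hd : IsDualPair κ e e')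
    (hκ_inv : ∀ x y w, κ ⁅x, y⁆ w = κ x ⁅y, w⁆) (m n : ℕ) (a b : A) :
    comul A (genBracket e e' m n a b) =
      tensorCoeff (genBracket e e') m n (Coalgebra.comul (R := ℂ) a)
        (Coalgebra.comul (R := ℂ) b) := by
  refine eq_of_shift_eq (Z := fun m n => comul A (genBracket e e' m n a b))
    (Z' := fun m n => tensorCoeff (genBracket e e') m n (Coalgebra.comul (R := ℂ) a)
        (Coalgebra.comul (R := ℂ) b))
    (fun n => by simp [genBracket_zero, tensorCoeff_genBracket_zero]) (fun m n => ?_) m n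
  rw [← map_sub]
  simp only [genBracket_succ, tensorCoeff_genBracket_succ hd hκ_inv, LinearMap.sub_apply]
  rw [sub_sub_cancel_left, sub_sub_cancel_left, map_neg, comul_casimirCoeff]

theorem IsLoopBracket.comul_isPoissonHom [Algebra.FiniteType ℂ A] (hP : IsLoopBracket e e' P)
    (hd : IsDualPair κ e e') (hκ_inv : ∀ x y w, κ ⁅x, y⁆ w = κ x ⁅y, w⁆) :
    IsPoissonHom P (prodBracket P P) (comul A) := by
  intro f h
  have key := IsBideriv.ext_gen (hP.bideriv.compHom (comul A))
    ((hP.bideriv.prod hP.bideriv).precomp (comul A)) fun a m b n => by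
      simp only [LinearMap.compr₂_apply, LinearMap.compl₁₂_apply, AlgHom.toLinearMap_apply]
      rw [hP.gen_gen, hP.prodBracket_comul_gen, comul_genBracket hd hκ_inv]
  exact congrArg (fun F : LoopRing A →ₗ[ℂ] LoopRing A →ₗ[ℂ] _ => F f h) key

end LoopRing

/-! ### Differentials at the identity -/

section Differential

variable {A : Type u} [CommRing A] [HopfAlgebra ℂ A]

theorem Laurent.zpow_mul (k l : ℤ) : Laurent.zpow k * Laurent.zpow l = Laurent.zpow (k + l) := by
  have h := HahnSeries.single_mul_single (R := ℂ) (a := -k) (b := -l) (r := 1) (s := 1)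
  refine h.trans ?_
  rw [Laurent.zpow, mul_one, neg_add]

theorem Laurent.zcoeff_zpow (k l : ℤ) :
    Laurent.zcoeff k (Laurent.zpow l) = if k = l then 1 else 0 := by
  rw [Laurent.zcoeff, Laurent.zpow, HahnSeries.coeff_single]
  simp only [neg_inj]

theorem Laurent.zcoeff_add (k : ℤ) (f g : Laurent) :
    Laurent.zcoeff k (f + g) = Laurent.zcoeff k f + Laurent.zcoeff k g := rfl

theorem Laurent.zcoeff_smul (k : ℤ) (c : ℂ) (f : Laurent) :
    Laurent.zcoeff k (c • f) = c * Laurent.zcoeff k f := by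
  have h : c • f = algebraMap ℂ Laurent c * f := Algebra.smul_def c f
  have h' : algebraMap ℂ Laurent c = (HahnSeries.C c : LaurentSeries ℂ) := by
    change HahnSeries.ofPowerSeries ℤ ℂ (algebraMap ℂ ℂ⟦X⟧ c) = _
    rw [PowerSeries.algebraMap_apply, HahnSeries.ofPowerSeries_C]
    rfl
  rw [h, h', Laurent.zcoeff]
  exact HahnSeries.coeff_single_zero_mul

theorem loopForm_add (κ : LinearMap.BilinForm ℂ (LieAlg A)) (X Y Z : LoopLie A) :
    loopForm κ X (Y + Z) = loopForm κ X Y + loopForm κ X Z := by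
  rw [loopForm, map_add, Laurent.zcoeff_add, neg_add]
  rfl

theorem loopForm_smul (κ : LinearMap.BilinForm ℂ (LieAlg A)) (X Y : LoopLie A) (c : ℂ) :
    loopForm κ X (c • Y) = c * loopForm κ X Y := by
  have h : LinearMap.BilinForm.baseChange Laurent κ X (c • Y) =
      c • LinearMap.BilinForm.baseChange Laurent κ X Y := by
    rw [← algebraMap_smul Laurent c Y, map_smul, algebraMap_smul]
  rw [loopForm, h, Laurent.zcoeff_smul, ← mul_neg]
  rfl

theorem loopForm_zero (κ : LinearMap.BilinForm ℂ (LieAlg A)) (X : LoopLie A) :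
    loopForm κ X 0 = 0 := by
  have := loopForm_smul κ X 0 0
  rwa [zero_smul, zero_mul] at this

theorem loopForm_zpow (κ : LinearMap.BilinForm ℂ (LieAlg A)) (x y : LieAlg A) (k p : ℕ) :
    loopForm κ (zpow x (-(k + 1 : ℤ))) (zpow y p) = if p = k then -κ x y else 0 := by
  rw [loopForm, zpow, zpow, LinearMap.BilinForm.baseChange_tmul, mul_comm, Laurent.zpow_mul,
    Laurent.zcoeff_smul, Laurent.zcoeff_zpow]
  by_cases h : p = k
  · subst h
    rw [if_pos rfl, if_pos (by ring), mul_one]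
  · rw [if_neg h, if_neg (by omega), mul_zero, neg_zero]

/-- The element `∑ c p zᵖ` of `𝔤[z]`. -/
noncomputable def polySum : (ℕ →₀ LieAlg A) →ₗ[ℂ] LoopLie A :=
  Finsupp.lsum ℂ fun p => TensorProduct.mk ℂ Laurent (LieAlg A) (Laurent.zpow p)

theorem polySum_single (p : ℕ) (x : LieAlg A) : polySum (Finsupp.single p x) = zpow x p := by
  rw [polySum, Finsupp.lsum_single]
  rfl

theorem exists_polySum_eq {ξ : LoopLie A} (h : ξ ∈ polyLie A) : ∃ c, polySum c = ξ := by
  have : polyLie A ≤ LinearMap.range (polySum (A := A)) :=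
    Submodule.span_le.2 (by
      rintro _ ⟨x, m, rfl⟩
      exact ⟨_, polySum_single m x⟩)
  exact this h

theorem zpow_lie (x y : LieAlg A) (p q : ℕ) : ⁅zpow x p, zpow y q⁆ = zpow ⁅x, y⁆ (p + q : ℕ) := by
  rw [zpow, zpow, LieAlgebra.ExtendScalars.bracket_tmul, Laurent.zpow_mul, Nat.cast_add]
  rfl

theorem lie_mem_polyLie {ξ η : LoopLie A} (hξ : ξ ∈ polyLie A) (hη : η ∈ polyLie A) :
    ⁅ξ, η⁆ ∈ polyLie A := by
  obtain ⟨c, rfl⟩ := exists_polySum_eq hξ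
  obtain ⟨d, rfl⟩ := exists_polySum_eq hη
  clear hξ hη
  induction c using Finsupp.induction_linear with
  | zero => rw [map_zero, zero_lie]; exact Submodule.zero_mem _
  | add c c' h h' => rw [map_add, add_lie]; exact Submodule.add_mem _ h h'
  | single p x =>
    induction d using Finsupp.induction_linear with
    | zero => rw [map_zero, lie_zero]; exact Submodule.zero_mem _
    | add c c' h h' => rw [map_add, lie_add]; exact Submodule.add_mem _ h h'
    | single q y =>
      rw [polySum_single, polySum_single, zpow_lie]
      exact Submodule.subset_span ⟨_, _, rfl⟩

theorem loopForm_polySum (κ : LinearMap.BilinForm ℂ (LieAlg A)) (x : LieAlg A) (k : ℕ)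
    (c : ℕ →₀ LieAlg A) : loopForm κ (zpow x (-(k + 1 : ℤ))) (polySum c) = -κ x (c k) := by
  induction c using Finsupp.induction_linear with
  | zero => simp [loopForm_zero]
  | add c c' h h' => rw [map_add, loopForm_add, h, h', Finsupp.add_apply, map_add, neg_add]
  | single p y =>
    rw [polySum_single, loopForm_zpow, Finsupp.single_apply]
    split_ifs <;> simp

theorem loopForm_lie_polySum (κ : LinearMap.BilinForm ℂ (LieAlg A)) (x : LieAlg A) (k : ℕ)
    (c d : ℕ →₀ LieAlg A) : loopForm κ (zpow x (-(k + 1 : ℤ))) ⁅polySum c, polySum d⁆ =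
      -∑ p ∈ Finset.HasAntidiagonal.antidiagonal k, κ x ⁅c p.1, d p.2⁆ := by
  induction c using Finsupp.induction_linear with
  | zero => simp [loopForm_zero]
  | add c c' h h' =>
    rw [map_add, add_lie, loopForm_add, h, h']
    simp only [Finsupp.add_apply, add_lie, map_add, Finset.sum_add_distrib]
    ring
  | single p y =>
    induction d using Finsupp.induction_linear with
    | zero => simp [loopForm_zero]
    | add c c' h h' =>
      rw [map_add, lie_add, loopForm_add, h, h']
      simp only [Finsupp.add_apply, lie_add, map_add, Finset.sum_add_distrib]
      ring
    | single q y' =>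
      rw [polySum_single, polySum_single, zpow_lie, loopForm_zpow]
      split_ifs with h
      · rw [Finset.sum_eq_single (p, q)]
        · simp
        · rintro ⟨i, j⟩ _ hij
          rw [Finsupp.single_apply, Finsupp.single_apply]
          split_ifs with h1 h2
          · exact absurd (Prod.ext h1.symm h2.symm) hij
          all_goals simp
        · intro hn
          exact absurd (Finset.HasAntidiagonal.mem_antidiagonal.2 h) hn
      · rw [Finset.sum_eq_zero, neg_zero]
        rintro ⟨i, j⟩ hij
        have hij' : i + j = k := Finset.HasAntidiagonal.mem_antidiagonal.1 hij
        rw [Finsupp.single_apply, Finsupp.single_apply]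
        split_ifs with h1 h2
        · omega
        all_goals simp

variable {κ : LinearMap.BilinForm ℂ (LieAlg A)}

theorem IsDifferential.tangentL_eq {f : LoopRing A} {ξ : LoopLie A} (h : IsDifferential κ f ξ)
    (x : LieAlg A) (n : ℕ) :
    LoopRing.tangentL x n f = loopForm κ (zpow x (-(n + 1 : ℤ))) ξ := h.pairing x n

theorem IsDifferential.add {f g : LoopRing A} {ξ η : LoopLie A} (hf : IsDifferential κ f ξ)
    (hg : IsDifferential κ g η) : IsDifferential κ (f + g) (ξ + η) :=
  ⟨Submodule.add_mem _ hf.mem hg.mem, fun x n => by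
    rw [← LoopRing.tangentL_apply, map_add, hf.tangentL_eq, hg.tangentL_eq, loopForm_add]⟩

theorem IsDifferential.mul {f g : LoopRing A} {ξ η : LoopLie A} (hf : IsDifferential κ f ξ)
    (hg : IsDifferential κ g η) :
    IsDifferential κ (f * g) (LoopRing.eps A f • η + LoopRing.eps A g • ξ) :=
  ⟨Submodule.add_mem _ (Submodule.smul_mem _ _ hg.mem) (Submodule.smul_mem _ _ hf.mem),
    fun x n => by
      rw [← LoopRing.tangentL_apply, LoopRing.tangentL_isDerivAlong, hf.tangentL_eq,
        hg.tangentL_eq, loopForm_add, loopForm_smul, loopForm_smul]⟩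

variable {ι : Type w} [Fintype ι] {e e' : ι → LieAlg A}

/-- Every function has a differential in the polynomial part, so the linearization axiom determines
all tangent derivatives of a bracket. -/
theorem exists_isDifferential (hd : IsDualPair κ e e') (f : LoopRing A) :
    ∃ ξ, IsDifferential κ f ξ := by
  induction f using LoopRing.induction with
  | hC c =>
    refine ⟨0, Submodule.zero_mem _, fun x n => ?_⟩
    rw [← LoopRing.tangentL_apply, (LoopRing.tangentL_isDerivAlong x n).map_algebraMap,
      loopForm_zero]
  | hgen a m =>
    cases m with
    | zero =>
      refine ⟨0, Submodule.zero_mem _, fun x n => ?_⟩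
      rw [← LoopRing.tangentL_apply, LoopRing.tangentL_gen, if_neg (by omega), loopForm_zero]
    | succ p =>
      -- This is the κ-dual of the functional x ↦ x(a), placed in degree `p` because a⁽ᵖ⁺¹⁾ pairs
      -- with x z⁻ᵖ⁻¹. The sign compensates the one in the residue form.
      refine ⟨zpow (-∑ i, (e' i).eval a • e i) p, Submodule.subset_span ⟨_, _, rfl⟩,
        fun x n => ?_⟩
      rw [← LoopRing.tangentL_apply, LoopRing.tangentL_gen, loopForm_zpow, map_neg, neg_neg]
      by_cases h : p = n
      · rw [if_pos (by omega), if_pos h]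
        conv_lhs => rw [← hd.left x]
        have hl : (∑ i, κ x (e i) • e' i).eval a = ∑ i, κ x (e i) * (e' i).eval a := by
          have := congrArg (fun F : A →ₗ[ℂ] ℂ => F a) (map_sum evalL
            (fun i => κ x (e i) • e' i) Finset.univ)
          simp only [map_smul, LinearMap.sum_apply] at this
          exact this
        rw [hl, map_sum]
        exact Finset.sum_congr rfl fun i _ => by rw [map_smul, smul_eq_mul, mul_comm]
      · rw [if_neg (by omega), if_neg h]
  | hadd f g hf hg =>
    obtain ⟨ξ, hξ⟩ := hf
    obtain ⟨η, hη⟩ := hg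
    exact ⟨_, hξ.add hη⟩
  | hmul f g hf hg =>
    obtain ⟨ξ, hξ⟩ := hf
    obtain ⟨η, hη⟩ := hg
    exact ⟨_, hξ.mul hη⟩

end Differential

namespace LoopRing

variable {A : Type u} [CommRing A] [HopfAlgebra ℂ A]
variable {ι : Type w} [Fintype ι] {e e' : ι → LieAlg A}
variable {κ : LinearMap.BilinForm ℂ (LieAlg A)}
  {P : LoopRing A →ₗ[ℂ] LoopRing A →ₗ[ℂ] LoopRing A}

theorem eval_sum_smul {ι : Type*} (s : Finset ι) (c : ι → ℂ) (x : ι → LieAlg A) (a : A) :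
    (∑ i ∈ s, c i • x i).eval a = ∑ i ∈ s, c i * (x i).eval a := by
  have := congrArg (fun F : A →ₗ[ℂ] ℂ => F a) (map_sum evalL (fun i => c i • x i) s)
  simp only [map_smul, LinearMap.sum_apply] at this
  exact this

variable (e e' κ) in
/-- The linearization of the bracket, on generators. -/
noncomputable def linCoeff (x : LieAlg A) (a b : A) : ℂ :=
  ∑ i, ∑ j, κ x ⁅e i, e j⁆ * ((e' i).eval a * (e' j).eval b)

/-- Invariance of κ moves the Lie bracket onto the leg evaluated at b. The companion `linCoeff_eq'`
moves it onto the other leg, at the cost of a sign. -/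
theorem linCoeff_eq (hd : IsDualPair κ e e') (hκ_inv : ∀ x y w, κ ⁅x, y⁆ w = κ x ⁅y, w⁆)
    (x : LieAlg A) (a b : A) :
    linCoeff e e' κ x a b = ∑ i, (e' i).eval a * ⁅x, e i⁆.eval b := by
  refine Finset.sum_congr rfl fun i _ => ?_
  conv_rhs => rw [← hd.left ⁅x, e i⁆]
  rw [eval_sum_smul, Finset.mul_sum]
  exact Finset.sum_congr rfl fun j _ => by rw [hκ_inv]; ring

theorem linCoeff_eq' (hd : IsDualPair κ e e') (hκ_inv : ∀ x y w, κ ⁅x, y⁆ w = κ x ⁅y, w⁆)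
    (x : LieAlg A) (a b : A) :
    linCoeff e e' κ x a b = -∑ i, (e i).eval b * ⁅x, e' i⁆.eval a := by
  have hadj : ∀ z w, κ ⁅x, z⁆ w = κ z (-⁅x, w⁆) := fun z w => by
    rw [← lie_skew, map_neg, LinearMap.neg_apply, hκ_inv, map_neg]
  have h := hd.sum_adjoint ((LinearMap.mul ℂ ℂ).compl₁₂ ((evalL (A := A)).flip a)
    ((evalL (A := A)).flip b)) hadj
  rw [linCoeff_eq hd hκ_inv, ← neg_eq_iff_eq_neg, ← Finset.sum_neg_distrib]
  refine Eq.trans (Finset.sum_congr rfl fun i _ => ?_)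
    (h.symm.trans (Finset.sum_congr rfl fun i _ => ?_))
  · have : (-⁅x, e i⁆).eval b = -⁅x, e i⁆.eval b := rfl
    rw [← mul_neg, ← this]
    rfl
  · exact mul_comm _ _

/-- A derivative at e of a product evaluates one factor at e, which forces its index to be 0. The
left field minus the right field in the other factor is a Lie bracket with x. -/
theorem tangentL_casimirCoeff (hd : IsDualPair κ e e')
    (hκ_inv : ∀ x y w, κ ⁅x, y⁆ w = κ x ⁅y, w⁆) (x : LieAlg A) (k m n : ℕ) (a b : A) :
    tangentL x k (casimirCoeff e e' m n a b) =
      (if m = 0 ∧ n = k + 1 then linCoeff e e' κ x a b else 0) -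
        (if n = 0 ∧ m = k + 1 then linCoeff e e' κ x a b else 0) := by
  have h : ∀ u v : A, tangentL x k (gen u m * gen v n) =
      (if m = 0 ∧ n = k + 1 then Coalgebra.counit (R := ℂ) u * x.eval v else 0) +
      (if n = 0 ∧ m = k + 1 then Coalgebra.counit (R := ℂ) v * x.eval u else 0) := fun u v => by
    rw [tangentL_isDerivAlong, eps_gen, eps_gen, tangentL_gen, tangentL_gen, ite_and, ite_and]
    split_ifs <;> simp
  rw [casimirCoeff_apply, map_sum]
  have h2 : ∀ i, tangentL x k (gen (leftField (e' i) a) m * gen (leftField (e i) b) n -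
      gen (rightField (e' i) a) m * gen (rightField (e i) b) n) =
      (if m = 0 ∧ n = k + 1 then (e' i).eval a * ⁅x, e i⁆.eval b else 0) +
      (if n = 0 ∧ m = k + 1 then (e i).eval b * ⁅x, e' i⁆.eval a else 0) := fun i => by
    rw [map_sub, h, h, eval_lie, eval_lie]
    simp only [counit_leftField, counit_rightField]
    split_ifs <;> ring
  simp only [h2]
  rw [Finset.sum_add_distrib, sub_eq_add_neg]
  congr 1
  · split_ifs
    · rw [linCoeff_eq hd hκ_inv]
    · simp
  · split_ifs
    · rw [linCoeff_eq' hd hκ_inv, neg_neg]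
    · simp

/-- Along an antidiagonal of total index `k + 2` the recursion changes value only at its two ends,
so the derivative is constant in between. The ends are zero because a⁽⁰⁾ and b⁽⁰⁾ are constants. -/
theorem tangentL_genBracket (hd : IsDualPair κ e e')
    (hκ_inv : ∀ x y w, κ ⁅x, y⁆ w = κ x ⁅y, w⁆) (x : LieAlg A) (k m n : ℕ) (a b : A) :
    tangentL x k (genBracket e e' m n a b) =
      if 1 ≤ m ∧ 1 ≤ n ∧ m + n = k + 2 then -linCoeff e e' κ x a b else 0 := by
  refine eq_of_shift_eq (Z := fun m n => tangentL x k (genBracket e e' m n a b))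
    (Z' := fun m n => if 1 ≤ m ∧ 1 ≤ n ∧ m + n = k + 2 then -linCoeff e e' κ x a b else 0)
    (fun n => by simp [genBracket_zero]) (fun m n => ?_) m n
  rw [← map_sub]
  simp only [genBracket_succ]
  rw [sub_sub_cancel_left, map_neg, tangentL_casimirCoeff hd hκ_inv]
  by_cases hmn : m + n = k + 1
  · rcases Nat.eq_zero_or_pos m with hm | hm
    · rw [if_pos ⟨hm, by omega⟩, if_neg (by omega), if_pos (by omega), if_neg (by omega)]
      ring
    · rcases Nat.eq_zero_or_pos n with hn | hn
      · rw [if_neg (by omega), if_pos (by omega), if_neg (by omega), if_pos (by omega)]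
        ring
      · rw [if_neg (by omega), if_neg (by omega), if_pos (by omega), if_pos (by omega)]
        ring
  · rw [if_neg (by omega), if_neg (by omega), if_neg (by omega), if_neg (by omega)]
    ring

/-! ### Consequences of multiplicativity -/

theorem rslice_prodBracket {ξ : LoopRing A →ₗ[ℂ] ℂ} (hξ : IsDerivAlong (eps A) ξ)
    (h0 : ∀ f h, ξ (P f h) = 0) (s t : LoopRing A ⊗[ℂ] LoopRing A) :
    rslice ξ (prodBracket P P s t) =
      P (rslice ξ s) (rslice (eps A).toLinearMap t) +
        P (rslice (eps A).toLinearMap s) (rslice ξ t) := by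
  induction s with
  | zero => simp
  | add s s' hs hs' => simp only [map_add, LinearMap.add_apply, hs, hs']; ring
  | tmul b c =>
    induction t with
    | zero => simp
    | add t t' ht ht' => simp only [map_add, ht, ht']; ring
    | tmul b' c' =>
      simp only [prodBracket_tmul, map_add, rslice_tmul, h0, zero_smul, add_zero, map_smul,
        LinearMap.smul_apply, AlgHom.toLinearMap_apply, smul_smul]
      rw [← add_smul, hξ c c']
      congr 1
      ring

/-- Multiplicativity at (e, e) says that the value of the bracket at e equals twice itself. -/
theorem eps_bracket (hP : IsPoissonHom P (prodBracket P P) (comul A)) (f h : LoopRing A) :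
    eps A (P f h) = 0 := by
  have key : ∀ s t : LoopRing A ⊗[ℂ] LoopRing A,
      eps A (rslice (eps A).toLinearMap (prodBracket P P s t)) =
      eps A (P (rslice (eps A).toLinearMap s) (rslice (eps A).toLinearMap t)) +
        eps A (P (lslice (eps A).toLinearMap s) (lslice (eps A).toLinearMap t)) := by
    intro s t
    induction s with
    | zero => simp
    | add s s' hs hs' => simp only [map_add, LinearMap.add_apply, hs, hs']; ring
    | tmul b c =>
      induction t with
      | zero => simp
      | add t t' ht ht' => simp only [map_add, ht, ht']; ring
      | tmul b' c' =>
        simp only [prodBracket_tmul, map_add, rslice_tmul, lslice_tmul, map_smul,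
          LinearMap.smul_apply, AlgHom.toLinearMap_apply, smul_eq_mul, map_mul]
        ring
  have h1 := key (comul A f) (comul A h)
  rw [← hP, rslice_eps_comul, rslice_eps_comul, rslice_eps_comul, lslice_eps_comul,
    lslice_eps_comul] at h1
  exact left_eq_add.1 h1

/-- Differentiating multiplicativity in the second factor at e: the failure of left invariance is
governed by the linearization, which is assumed to vanish. -/
theorem loopField_bracket (hP : IsPoissonHom P (prodBracket P P) (comul A))
    (h0 : ∀ x n f h, tangentL x n (P f h) = 0) (x : LieAlg A) (n : ℕ) (f h : LoopRing A) :
    loopField x n (P f h) = P (loopField x n f) h + P f (loopField x n h) := by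
  rw [loopField_apply, hP, rslice_prodBracket (tangentL_isDerivAlong x n) (h0 x n),
    rslice_eps_comul, rslice_eps_comul]
  rfl

/-- A multiplicative bracket with vanishing linearization is zero. -/
theorem eq_zero_of_tangentL_eq_zero [Algebra.FiniteType ℂ A]
    (hP : IsPoissonHom P (prodBracket P P) (comul A))
    (h0 : ∀ x n f h, tangentL x n (P f h) = 0) : P = 0 :=
  bilinear_eq_zero P (loopField_bracket hP h0) (eps_bracket hP)

/-! ### The linearization of the bracket -/

/-- Because the bracket vanishes at e, its derivative there is a biderivation along the counit, as
is the right side. It suffices to compare generators. -/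
theorem IsLoopBracket.tangentL_apply [Algebra.FiniteType ℂ A] (hP : IsLoopBracket e e' P)
    (hd : IsDualPair κ e e')
    (hκ_inv : ∀ x y w, κ ⁅x, y⁆ w = κ x ⁅y, w⁆) (x : LieAlg A) (k : ℕ) (f h : LoopRing A) :
    tangentL x k (P f h) = -∑ p ∈ Finset.HasAntidiagonal.antidiagonal k, ∑ i, ∑ j,
      κ x ⁅e i, e j⁆ * (tangentL (e' i) p.1 f * tangentL (e' j) p.2 h) := by
  have hε := eps_bracket (hP.comul_isPoissonHom hd hκ_inv)
  have h1 : IsBideriv (eps A) (P.compr₂ (tangentL x k)) := by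
    constructor
    · intro f g g'
      simp only [LinearMap.compr₂_apply]
      rw [hP.bideriv.map_mul, map_add, tangentL_isDerivAlong, tangentL_isDerivAlong]
      simp only [AlgHom.id_apply, hε]
      ring
    · intro f g g'
      simp only [LinearMap.compr₂_apply, LinearMap.flip_apply]
      rw [hP.bideriv.mul_map, map_add, tangentL_isDerivAlong, tangentL_isDerivAlong]
      simp only [AlgHom.id_apply, hε]
      ring
  have hD : ∀ u v p q, IsBideriv (eps A)
      ((LinearMap.mul ℂ ℂ).compl₁₂ (tangentL (A := A) u p) (tangentL v q)) := fun u v p q =>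
    ⟨fun f g g' => by
      simp only [LinearMap.compl₁₂_apply, LinearMap.mul_apply']
      rw [tangentL_isDerivAlong]
      ring, fun f g g' => by
      simp only [LinearMap.compl₁₂_apply, LinearMap.mul_apply', LinearMap.flip_apply]
      rw [tangentL_isDerivAlong]
      ring⟩
  have h2 : IsBideriv (eps A) ((-1 : ℂ) • ∑ p ∈ Finset.HasAntidiagonal.antidiagonal k, ∑ i, ∑ j,
      κ x ⁅e i, e j⁆ • (LinearMap.mul ℂ ℂ).compl₁₂ (tangentL (A := A) (e' i) p.1)
        (tangentL (e' j) p.2)) :=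
    (IsBideriv.sum _ fun p _ => IsBideriv.sum _ fun i _ => IsBideriv.sum _ fun j _ =>
      (hD _ _ _ _).smul _).smul _
  have key := IsBideriv.ext_gen h1 h2 fun a m b n => by
    simp only [LinearMap.compr₂_apply, LinearMap.smul_apply, LinearMap.sum_apply,
      LinearMap.compl₁₂_apply, LinearMap.mul_apply', tangentL_gen, hP.gen_gen, smul_eq_mul,
      tangentL_genBracket hd hκ_inv]
    have h3 : ∀ p : ℕ × ℕ, (∑ i, ∑ j, κ x ⁅e i, e j⁆ *
        ((if m = p.1 + 1 then (e' i).eval a else 0) * if n = p.2 + 1 then (e' j).eval b else 0)) =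
        if m = p.1 + 1 ∧ n = p.2 + 1 then linCoeff e e' κ x a b else 0 := fun p => by
      rw [linCoeff, ite_and]
      split_ifs <;> simp
    simp only [h3]
    split_ifs with h
    -- The tangent direction of index `p` is x z⁻ᵖ⁻¹, so it detects generators of index `p + 1`;
    -- hence the shift by one.
    · rw [Finset.sum_eq_single (m - 1, n - 1), if_pos (by omega), neg_one_mul]
      · rintro ⟨i, j⟩ _ hij
        refine if_neg fun hmn => hij (Prod.ext ?_ ?_) <;> dsimp only at hmn ⊢ <;> omega
      · intro hn
        exact absurd (Finset.HasAntidiagonal.mem_antidiagonal.2 (by dsimp only; omega)) hn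
    · rw [Finset.sum_eq_zero, mul_zero]
      rintro ⟨i, j⟩ hij
      have hij' : i + j = k := Finset.HasAntidiagonal.mem_antidiagonal.1 hij
      exact if_neg (by dsimp only; omega)
  have h3 := congrArg (fun F : LoopRing A →ₗ[ℂ] LoopRing A →ₗ[ℂ] ℂ => F f h) key
  simp only [LinearMap.compr₂_apply, LinearMap.smul_apply, LinearMap.sum_apply,
      LinearMap.compl₁₂_apply, LinearMap.mul_apply', smul_eq_mul, neg_one_mul] at h3
  exact h3

theorem IsLoopBracket.isDifferential [Algebra.FiniteType ℂ A] (hP : IsLoopBracket e e' P)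
    (hd : IsDualPair κ e e') (hκ_inv : ∀ x y w, κ ⁅x, y⁆ w = κ x ⁅y, w⁆) {f h : LoopRing A}
    {ξ η : LoopLie A} (hf : IsDifferential κ f ξ) (hh : IsDifferential κ h η) :
    IsDifferential κ (P f h) ⁅ξ, η⁆ := by
  refine ⟨lie_mem_polyLie hf.mem hh.mem, fun x k => ?_⟩
  obtain ⟨c, rfl⟩ := exists_polySum_eq hf.mem
  obtain ⟨d, rfl⟩ := exists_polySum_eq hh.mem
  rw [← LoopRing.tangentL_apply, hP.tangentL_apply hd hκ_inv, loopForm_lie_polySum]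
  congr 1
  refine Finset.sum_congr rfl fun p _ => ?_
  have hx : ∀ y z : LieAlg A, κ x ⁅y, z⁆ = ∑ i, ∑ j, κ x ⁅e i, e j⁆ * (κ y (e' i) * κ z (e' j)) := by
    intro y z
    conv_lhs => rw [← hd.right y, ← hd.right z]
    rw [sum_lie, map_sum]
    refine Finset.sum_congr rfl fun i _ => ?_
    rw [lie_sum, map_sum]
    refine Finset.sum_congr rfl fun j _ => ?_
    rw [smul_lie, lie_smul, map_smul, map_smul, smul_eq_mul, smul_eq_mul]
    ring
  rw [hx]
  refine Finset.sum_congr rfl fun i _ => Finset.sum_congr rfl fun j _ => ?_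
  rw [hf.tangentL_eq, hh.tangentL_eq, loopForm_polySum, loopForm_polySum, neg_mul_neg,
    hd.symm (c p.1), hd.symm (d p.2)]

end LoopRing

/-! ### The Jacobiator -/

section Jacobiator

variable {B : Type u} [CommRing B] [Algebra ℂ B]

/-- The Jacobiator of a bracket. -/
def jacobiator (P : B →ₗ[ℂ] B →ₗ[ℂ] B) (f g h : B) : B :=
  P f (P g h) + P g (P h f) + P h (P f g)

variable {P : B →ₗ[ℂ] B →ₗ[ℂ] B}

/-- Terms bracketing both tensor factors occur in pairs of opposite sign and cancel by skew
symmetry. -/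
theorem jacobiator_tmul (hP : IsBideriv (AlgHom.id ℂ B) P) (hs : ∀ f h, P f h = -P h f)
    (b₁ c₁ b₂ c₂ b₃ c₃ : B) :
    jacobiator (prodBracket P P) (b₁ ⊗ₜ[ℂ] c₁) (b₂ ⊗ₜ[ℂ] c₂) (b₃ ⊗ₜ[ℂ] c₃) =
      jacobiator P b₁ b₂ b₃ ⊗ₜ[ℂ] (c₁ * c₂ * c₃) + (b₁ * b₂ * b₃) ⊗ₜ[ℂ] jacobiator P c₁ c₂ c₃ := by
  have h : ∀ b₁ c₁ b₂ c₂ b₃ c₃ : B, prodBracket P P (b₁ ⊗ₜ[ℂ] c₁)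
      (prodBracket P P (b₂ ⊗ₜ[ℂ] c₂) (b₃ ⊗ₜ[ℂ] c₃)) =
      P b₁ (P b₂ b₃) ⊗ₜ[ℂ] (c₁ * c₂ * c₃) + (b₁ * P b₂ b₃) ⊗ₜ[ℂ] (c₂ * P c₁ c₃) +
      (b₁ * P b₂ b₃) ⊗ₜ[ℂ] (c₃ * P c₁ c₂) + (b₂ * P b₁ b₃) ⊗ₜ[ℂ] (c₁ * P c₂ c₃) +
      (b₃ * P b₁ b₂) ⊗ₜ[ℂ] (c₁ * P c₂ c₃) + (b₁ * b₂ * b₃) ⊗ₜ[ℂ] P c₁ (P c₂ c₃) := by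
    intro b₁ c₁ b₂ c₂ b₃ c₃
    simp only [prodBracket_tmul, map_add, hP.map_mul, AlgHom.id_apply, TensorProduct.add_tmul,
      TensorProduct.tmul_add, mul_assoc]
    abel
  rw [jacobiator, h, h, h, jacobiator, jacobiator, hs b₃ b₁, hs c₃ c₁, hs b₂ b₁, hs c₂ c₁,
    hs b₃ b₂, hs c₃ c₂, show c₂ * c₃ * c₁ = c₁ * c₂ * c₃ by ring,
    show c₃ * c₁ * c₂ = c₁ * c₂ * c₃ by ring, show b₂ * b₃ * b₁ = b₁ * b₂ * b₃ by ring,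
    show b₃ * b₁ * b₂ = b₁ * b₂ * b₃ by ring]
  simp only [mul_neg, TensorProduct.neg_tmul, TensorProduct.tmul_neg, TensorProduct.add_tmul,
    TensorProduct.tmul_add, map_neg, neg_neg]
  abel

theorem jacobiator_add₁ (f f' g h : B) :
    jacobiator P (f + f') g h = jacobiator P f g h + jacobiator P f' g h := by
  simp only [jacobiator, map_add, LinearMap.add_apply]; abel

theorem jacobiator_add₂ (f g g' h : B) :
    jacobiator P f (g + g') h = jacobiator P f g h + jacobiator P f g' h := by
  simp only [jacobiator, map_add, LinearMap.add_apply]; abel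

theorem jacobiator_add₃ (f g h h' : B) :
    jacobiator P f g (h + h') = jacobiator P f g h + jacobiator P f g h' := by
  simp only [jacobiator, map_add, LinearMap.add_apply]; abel

theorem jacobiator_zero₁ (g h : B) : jacobiator P 0 g h = 0 := by simp [jacobiator]

theorem jacobiator_zero₂ (f h : B) : jacobiator P f 0 h = 0 := by simp [jacobiator]

theorem jacobiator_zero₃ (f g : B) : jacobiator P f g 0 = 0 := by simp [jacobiator]

theorem jacobiator_smul₁ (c : ℂ) (f g h : B) :
    jacobiator P (c • f) g h = c • jacobiator P f g h := by
  simp only [jacobiator, map_smul, LinearMap.smul_apply, smul_add]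

theorem jacobiator_smul₂ (c : ℂ) (f g h : B) :
    jacobiator P f (c • g) h = c • jacobiator P f g h := by
  simp only [jacobiator, map_smul, LinearMap.smul_apply, smul_add]

theorem jacobiator_smul₃ (c : ℂ) (f g h : B) :
    jacobiator P f g (c • h) = c • jacobiator P f g h := by
  simp only [jacobiator, map_smul, LinearMap.smul_apply, smul_add]

end Jacobiator

namespace LoopRing

variable {A : Type u} [CommRing A] [HopfAlgebra ℂ A]
variable {ι : Type w} [Fintype ι] {e e' : ι → LieAlg A}
variable {κ : LinearMap.BilinForm ℂ (LieAlg A)}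
  {P : LoopRing A →ₗ[ℂ] LoopRing A →ₗ[ℂ] LoopRing A}

theorem rslice_jacobiator (hP : IsBideriv (AlgHom.id ℂ _) P) (hs : ∀ f h, P f h = -P h f)
    {ξ : LoopRing A →ₗ[ℂ] ℂ} (hξ : IsDerivAlong (eps A) ξ)
    (h0 : ∀ f g h, ξ (jacobiator P f g h) = 0) (s t r : LoopRing A ⊗[ℂ] LoopRing A) :
    rslice ξ (jacobiator (prodBracket P P) s t r) =
      jacobiator P (rslice ξ s) (rslice (eps A).toLinearMap t) (rslice (eps A).toLinearMap r) +
      jacobiator P (rslice (eps A).toLinearMap s) (rslice ξ t) (rslice (eps A).toLinearMap r) +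
      jacobiator P (rslice (eps A).toLinearMap s) (rslice (eps A).toLinearMap t) (rslice ξ r) := by
  induction s with
  | zero => simp [jacobiator_zero₁]
  | add s s' hs hs' => simp only [map_add, jacobiator_add₁, hs, hs']; ring
  | tmul b₁ c₁ =>
    induction t with
    | zero => simp [jacobiator_zero₂]
    | add s s' hs hs' => simp only [map_add, jacobiator_add₂, hs, hs']; ring
    | tmul b₂ c₂ =>
      induction r with
      | zero => simp [jacobiator_zero₃]
      | add s s' hs hs' => simp only [map_add, jacobiator_add₃, hs, hs']; ring
      | tmul b₃ c₃ =>
        rw [jacobiator_tmul hP hs]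
        simp only [map_add, rslice_tmul, h0, zero_smul, add_zero, jacobiator_smul₁,
          jacobiator_smul₂, jacobiator_smul₃, smul_smul, AlgHom.toLinearMap_apply]
        rw [← add_smul, ← add_smul, hξ (c₁ * c₂), hξ c₁, map_mul]
        congr 1
        ring

/-- The Jacobiator of a multiplicative bracket is itself multiplicative, so it is invariant as soon
as its derivatives at e vanish. -/
theorem loopField_jacobiator (hP : IsBideriv (AlgHom.id ℂ _) P) (hs : ∀ f h, P f h = -P h f)
    (hm : IsPoissonHom P (prodBracket P P) (comul A))
    (h0 : ∀ x n f g h, tangentL x n (jacobiator P f g h) = 0) (x : LieAlg A) (n : ℕ)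
    (f g h : LoopRing A) : loopField x n (jacobiator P f g h) =
      jacobiator P (loopField x n f) g h + jacobiator P f (loopField x n g) h +
        jacobiator P f g (loopField x n h) := by
  have h1 : comul A (jacobiator P f g h) =
      jacobiator (prodBracket P P) (comul A f) (comul A g) (comul A h) := by
    simp only [jacobiator, map_add, hm _ _]
  rw [loopField_apply, h1, rslice_jacobiator hP hs (tangentL_isDerivAlong x n) (h0 x n)]
  simp only [rslice_eps_comul]
  rfl

/-- The differential of the Jacobiator at e is the cyclic sum of iterated brackets in 𝔤[z], zero by
the Jacobi identity there. -/
theorem IsLoopBracket.tangentL_jacobiator [Algebra.FiniteType ℂ A] (hP : IsLoopBracket e e' P)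
    (hd : IsDualPair κ e e') (hκ_inv : ∀ x y w, κ ⁅x, y⁆ w = κ x ⁅y, w⁆) (x : LieAlg A) (n : ℕ)
    (f g h : LoopRing A) : tangentL x n (jacobiator P f g h) = 0 := by
  obtain ⟨ξ, hξ⟩ := exists_isDifferential hd f
  obtain ⟨η, hη⟩ := exists_isDifferential hd g
  obtain ⟨ζ, hζ⟩ := exists_isDifferential hd h
  have hD := fun {f h : LoopRing A} {ξ η : LoopLie A} (hf : IsDifferential κ f ξ)
    (hh : IsDifferential κ h η) => hP.isDifferential hd hκ_inv hf hh
  have h1 := ((hD hξ (hD hη hζ)).add (hD hη (hD hζ hξ))).add (hD hζ (hD hξ hη))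
  rw [lie_jacobi] at h1
  exact (h1.tangentL_eq x n).trans (loopForm_zero _ _)

theorem IsLoopBracket.isLoopPoisson [Algebra.FiniteType ℂ A] (hP : IsLoopBracket e e' P)
    (hd : IsDualPair κ e e') (hκ_inv : ∀ x y w, κ ⁅x, y⁆ w = κ x ⁅y, w⁆) :
    IsLoopPoisson κ P where
  poisson :=
    { self := fun f => by
        have h := hP.skew hd hκ_inv f f
        have h2 : (2 : ℂ) • P f f = 0 := by rw [two_smul]; exact add_eq_zero_iff_eq_neg.2 h
        exact (smul_eq_zero.1 h2).resolve_left two_ne_zero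
      leibniz := fun f g h => by
        rw [hP.bideriv.map_mul]
        simp only [AlgHom.id_apply]
        ring
      jacobi := trilinear_eq_zero (jacobiator P) jacobiator_zero₁ jacobiator_zero₂
        jacobiator_zero₃ (loopField_jacobiator hP.bideriv (hP.skew hd hκ_inv)
          (hP.comul_isPoissonHom hd hκ_inv) (hP.tangentL_jacobiator hd hκ_inv)) fun f g h => by
            simp only [jacobiator, map_add, eps_bracket (hP.comul_isPoissonHom hd hκ_inv),
              add_zero] }
  multiplicative := hP.comul_isPoissonHom hd hκ_inv
  linearization := fun f h ξ η hf hh => hP.isDifferential hd hκ_inv hf hh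

/-- The product bracket is linear in the pair of brackets, so the difference of two candidates is
still multiplicative. Its linearization is zero. -/
theorem isLoopPoisson_unique [Algebra.FiniteType ℂ A] (hd : IsDualPair κ e e')
    {P' : LoopRing A →ₗ[ℂ] LoopRing A →ₗ[ℂ] LoopRing A} (hP : IsLoopPoisson κ P)
    (hP' : IsLoopPoisson κ P') : P = P' := by
  rw [← sub_eq_zero]
  refine eq_zero_of_tangentL_eq_zero (fun f h => ?_) (fun x n f h => ?_)
  · have h1 : prodBracket (P - P') (P - P') = prodBracket P P - prodBracket P' P' := by
      ext b c b' c'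
      simp [TensorProduct.sub_tmul, TensorProduct.tmul_sub]
      abel
    rw [h1, LinearMap.sub_apply, LinearMap.sub_apply, LinearMap.sub_apply, LinearMap.sub_apply,
      map_sub, hP.multiplicative, hP'.multiplicative]
  · obtain ⟨ξ, hξ⟩ := exists_isDifferential hd f
    obtain ⟨η, hη⟩ := exists_isDifferential hd h
    rw [LinearMap.sub_apply, LinearMap.sub_apply, map_sub,
      (hP.linearization f h ξ η hξ hη).tangentL_eq,
      (hP'.linearization f h ξ η hξ hη).tangentL_eq, sub_self]

theorem exists_isLoopBracket [Algebra.FiniteType ℂ A] (hd : IsDualPair κ e e')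
    (hκ_inv : ∀ x y w, κ ⁅x, y⁆ w = κ x ⁅y, w⁆) :
    ∃ P : LoopRing A →ₗ[ℂ] LoopRing A →ₗ[ℂ] LoopRing A, IsLoopBracket e e' P := by
  obtain ⟨P, h1, h2, h3⟩ := exists_loopBracket hd hκ_inv
  exact ⟨P, ⟨h1, h2⟩, h3⟩

theorem existsUnique_isLoopPoisson [Algebra.FiniteType ℂ A] (hκ_nondeg : κ.Nondegenerate)
    (hκ_symm : ∀ x y, κ x y = κ y x) (hκ_inv : ∀ x y w, κ ⁅x, y⁆ w = κ x ⁅y, w⁆) :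
    ∃! P, IsLoopPoisson κ P := by
  obtain ⟨e, e', hd⟩ := exists_isDualPair hκ_nondeg hκ_symm
  obtain ⟨P, hP⟩ := exists_isLoopBracket hd hκ_inv
  exact ⟨P, hP.isLoopPoisson hd hκ_inv, fun P' hP' =>
    isLoopPoisson_unique hd hP' (hP.isLoopPoisson hd hκ_inv)⟩

/-- By uniqueness an abstractly given bracket is the explicit one, for which these properties were
checked on generators. -/
theorem sigma_isPoissonHom_and_euler_bracket [Algebra.FiniteType ℂ A] (hP : IsLoopPoisson κ P)
    (θ : GroupInvolution A) (hκ_nondeg : κ.Nondegenerate)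
    (hκ_symm : ∀ x y, κ x y = κ y x) (hκ_inv : ∀ x y w, κ ⁅x, y⁆ w = κ x ⁅y, w⁆)
    (hκ_omega : ∀ x y, κ (θ.onLie x) (θ.onLie y) = κ x y) :
    IsPoissonHom P P (sigma θ) ∧
      ∀ f h, euler A (P f h) = P (euler A f) h + P f (euler A h) - P f h := by
  obtain ⟨e, e', hd⟩ := exists_isDualPair hκ_nondeg hκ_symm
  obtain ⟨P', hP'⟩ := exists_isLoopBracket hd hκ_inv
  obtain rfl := isLoopPoisson_unique hd hP (hP'.isLoopPoisson hd hκ_inv)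
  exact ⟨hP'.sigma_isPoissonHom θ hd hκ_omega, hP'.euler_apply⟩

end LoopRing

/-! ### Dirac reduction -/

section Dirac

variable {B : Type u} [CommRing B] [Algebra ℂ B] {P : B →ₗ[ℂ] B →ₗ[ℂ] B} {s : B →ₐ[ℂ] B}

theorem IsPoissonBracket.skew (hP : IsPoissonBracket P) (f h : B) : P f h = -P h f := by
  have := hP.self (f + h)
  rw [map_add, map_add, LinearMap.add_apply, LinearMap.add_apply, hP.self, hP.self,
    zero_add, add_zero] at this
  exact eq_neg_of_add_eq_zero_right this

theorem IsPoissonBracket.isBideriv (hP : IsPoissonBracket P) : IsBideriv (AlgHom.id ℂ B) P := by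
  have h : ∀ f, IsDerivAlong (AlgHom.id ℂ B) (P f) := fun f g h => by
    rw [hP.leibniz]
    simp only [AlgHom.id_apply]
    ring
  refine ⟨h, fun f g g' => ?_⟩
  simp only [LinearMap.flip_apply]
  rw [hP.skew, h, hP.skew g f, hP.skew g' f]
  ring

theorem IsPoissonBracket.smul (hP : IsPoissonBracket P) (c : ℂ) : IsPoissonBracket (c • P) where
  self f := by rw [LinearMap.smul_apply, LinearMap.smul_apply, hP.self, smul_zero]
  leibniz f g h := by
    simp only [LinearMap.smul_apply]
    rw [hP.leibniz, smul_add, smul_mul_assoc, mul_smul_comm]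
  jacobi f g h := by
    simp only [LinearMap.smul_apply, map_smul]
    rw [← smul_add, ← smul_add, ← smul_add, ← smul_add, hP.jacobi, smul_zero, smul_zero]

/-- The average `(f + s f) / 2`. -/
noncomputable def average (s : B →ₐ[ℂ] B) : B →ₗ[ℂ] B :=
  (1 / 2 : ℂ) • (LinearMap.id + s.toLinearMap)

theorem average_apply (f : B) : average s f = (1 / 2 : ℂ) • (f + s f) := rfl

theorem average_eq_self {f : B} (h : s f = f) : average s f = f := by
  rw [average_apply, h, ← two_smul ℂ, smul_smul]
  norm_num

theorem map_average (hs : ∀ f, s (s f) = f) (f : B) : s (average s f) = average s f := by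
  rw [average_apply, map_smul, map_add, hs, add_comm]

theorem FixedRing.mk_map (f : B) : FixedRing.mk s (s f) = FixedRing.mk s f :=
  DFunLike.congr_fun (FixedRing.mk_comp s) f

theorem FixedRing.mk_average (f : B) : FixedRing.mk s (average s f) = FixedRing.mk s f := by
  rw [average_apply, map_smul, map_add, FixedRing.mk_map, ← two_smul ℂ, smul_smul]
  norm_num

theorem FixedRing.exists_invariant (hs : ∀ f, s (s f) = f) (x : FixedRing s) :
    ∃ f, s f = f ∧ FixedRing.mk s f = x := by
  obtain ⟨f, rfl⟩ := FixedRing.mk_surjective s x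
  exact ⟨average s f, map_average hs f, FixedRing.mk_average f⟩

/-- This makes the Dirac reduction well defined. The average of g (s u - u) is half of (g - s g)(s u
- u), a product of two elements of the ideal, and a derivation maps such a product into the ideal.
-/
theorem mk_bracket_average_eq_zero (hP : IsBideriv (AlgHom.id ℂ B) P) (hs : ∀ f, s (s f) = f)
    {f : B} (hf : FixedRing.mk s f = 0) (h : B) : FixedRing.mk s (P (average s f) h) = 0 := by
  have key : ∀ f ∈ fixedIdeal s, FixedRing.mk s (P (average s f) h) = 0 := by
    intro f hf
    induction hf using Submodule.closure_induction with
    | zero => simp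
    | add f f' _ _ h1 h2 =>
      rw [map_add, map_add, LinearMap.add_apply, map_add, h1, h2, add_zero]
    | smul_mem g f hf =>
      obtain ⟨u, rfl⟩ := hf
      have h1 : average s (g • (s u - u)) = (1 / 2 : ℂ) • ((g - s g) * (s u - u)) := by
        rw [average_apply, smul_eq_mul, map_mul, map_sub, hs]
        congr 1
        ring
      have h2 : FixedRing.mk s (g - s g) = 0 := by rw [map_sub, FixedRing.mk_map, sub_self]
      have h3 : FixedRing.mk s (s u - u) = 0 := by rw [map_sub, FixedRing.mk_map, sub_self]
      rw [h1, map_smul, LinearMap.smul_apply, map_smul, hP.mul_map, map_add, map_mul, map_mul]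
      simp only [AlgHom.id_apply, h2, h3, zero_mul, add_zero, smul_zero]
  exact key f (Ideal.Quotient.eq_zero_iff_mem.1 hf)

variable {D : FixedRing s →ₗ[ℂ] FixedRing s →ₗ[ℂ] FixedRing s}

theorem IsDiracReduction.apply_mk (hD : IsDiracReduction P s D) (hs : ∀ f, s (s f) = f)
    (f h : B) : D (FixedRing.mk s f) (FixedRing.mk s h) =
      FixedRing.mk s (P (average s f) (average s h)) := by
  rw [← FixedRing.mk_average f, ← FixedRing.mk_average h]
  exact hD _ _ (map_average hs f) (map_average hs h)

theorem existsUnique_isDiracReduction (hP : IsBideriv (AlgHom.id ℂ B) P)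
    (hs : ∀ f, s (s f) = f) : ∃! D, IsDiracReduction P s D := by
  -- An arbitrary linear section of the restriction map provides extensions, which averaging makes
  -- invariant. The preceding lemma removes the dependence on the section.
  obtain ⟨r, hr⟩ := LinearMap.exists_rightInverse_of_surjective (FixedRing.mk s).toLinearMap
    (LinearMap.range_eq_top.2 (FixedRing.mk_surjective s))
  have hr' : ∀ x, FixedRing.mk s (r x) = x := DFunLike.congr_fun hr
  refine ⟨(P.compl₁₂ (average s ∘ₗ r) (average s ∘ₗ r)).compr₂ (FixedRing.mk s).toLinearMap,
    fun f h hf hh => ?_, fun D hD => ?_⟩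
  · change FixedRing.mk s (P (average s (r _)) (average s (r _))) = _
    have h1 : ∀ f h, FixedRing.mk s (P (average s (r (FixedRing.mk s f))) h) =
        FixedRing.mk s (P (average s f) h) := fun f h => by
      rw [← sub_eq_zero, ← map_sub, ← LinearMap.sub_apply, ← map_sub, ← map_sub]
      exact mk_bracket_average_eq_zero hP hs (by rw [map_sub, hr', sub_self]) h
    have h2 : ∀ f h, FixedRing.mk s (P f (average s (r (FixedRing.mk s h)))) =
        FixedRing.mk s (P f (average s h)) := fun f h => by
      rw [← sub_eq_zero, ← map_sub, ← map_sub, ← map_sub]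
      exact mk_bracket_average_eq_zero hP.flip hs (by rw [map_sub, hr', sub_self]) f
    rw [h1, h2, average_eq_self hf, average_eq_self hh]
  · ext x y
    obtain ⟨f, rfl⟩ := FixedRing.mk_surjective s x
    obtain ⟨h, rfl⟩ := FixedRing.mk_surjective s y
    rw [hD.apply_mk hs, ← hr' (FixedRing.mk s f), ← hr' (FixedRing.mk s h)]
    change _ = FixedRing.mk s (P (average s (r _)) (average s (r _)))
    rw [hr', hr', ← hD.apply_mk hs, ← hD.apply_mk hs, hr', hr']

/-- Invariant functions restrict onto all functions on the fixed locus, and they are closed under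
the bracket because s is Poisson, so the identities are inherited. -/
theorem IsDiracReduction.isPoissonBracket (hD : IsDiracReduction P s D)
    (hP : IsPoissonBracket P) (hs : ∀ f, s (s f) = f) (hsP : IsPoissonHom P P s) :
    IsPoissonBracket D where
  self x := by
    obtain ⟨f, rfl⟩ := FixedRing.mk_surjective s x
    rw [hD.apply_mk hs, hP.self, map_zero]
  leibniz x y z := by
    obtain ⟨f, hf, rfl⟩ := FixedRing.exists_invariant hs x
    obtain ⟨g, hg, rfl⟩ := FixedRing.exists_invariant hs y
    obtain ⟨h, hh, rfl⟩ := FixedRing.exists_invariant hs z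
    rw [← map_mul, hD f (g * h) hf (by rw [map_mul, hg, hh]), hD f g hf hg, hD f h hf hh,
      hP.leibniz, map_add, map_mul, map_mul]
  jacobi x y z := by
    obtain ⟨f, hf, rfl⟩ := FixedRing.exists_invariant hs x
    obtain ⟨g, hg, rfl⟩ := FixedRing.exists_invariant hs y
    obtain ⟨h, hh, rfl⟩ := FixedRing.exists_invariant hs z
    have hinv : ∀ f h, s f = f → s h = h → s (P f h) = P f h := fun f h hf hh => by
      rw [hsP, hf, hh]
    rw [hD f g hf hg, hD g h hg hh, hD h f hh hf, hD f _ hf (hinv _ _ hg hh),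
      hD g _ hg (hinv _ _ hh hf), hD h _ hh (hinv _ _ hf hg), ← map_add, ← map_add, hP.jacobi,
      map_zero]

/-- The doubled Dirac bracket on all restrictions. -/
theorem IsDiracReduction.two_smul_apply_mk (hD : IsDiracReduction P s D)
    (hs : ∀ f, s (s f) = f) (hsP : IsPoissonHom P P s) (f h : B) :
    ((2 : ℂ) • D) (FixedRing.mk s f) (FixedRing.mk s h) =
      FixedRing.mk s (P f h) + FixedRing.mk s (P (s f) h) := by
  have h1 : FixedRing.mk s (P (s f) (s h)) = FixedRing.mk s (P f h) := by
    rw [← hsP, FixedRing.mk_map]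
  have h2 : FixedRing.mk s (P f (s h)) = FixedRing.mk s (P (s f) h) := by
    rw [← FixedRing.mk_map (P f (s h)), hsP, hs]
  rw [LinearMap.smul_apply, LinearMap.smul_apply, hD.apply_mk hs, average_apply, average_apply]
  simp only [map_smul, map_add, LinearMap.smul_apply, LinearMap.add_apply, h1, h2, smul_smul,
    smul_add]
  rw [← sub_eq_zero]
  module

end Dirac

/-! ### The action on the fixed-point scheme is Poisson -/

section Action

variable {B : Type u} [CommRing B] [Algebra ℂ B] (s : B →ₐ[ℂ] B)

/-- The comorphism `(g, h, k) ↦ (σ k, σ h, σ g)`. -/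
noncomputable def reverseHom : B ⊗[ℂ] (B ⊗[ℂ] B) →ₐ[ℂ] B ⊗[ℂ] (B ⊗[ℂ] B) :=
  Algebra.TensorProduct.productMap
    ((Algebra.TensorProduct.includeRight.comp Algebra.TensorProduct.includeRight).comp s)
    (Algebra.TensorProduct.productMap
      ((Algebra.TensorProduct.includeRight.comp Algebra.TensorProduct.includeLeft).comp s)
      ((Algebra.TensorProduct.includeLeft : B →ₐ[ℂ] B ⊗[ℂ] (B ⊗[ℂ] B)).comp s))

/-- The comorphism `(g, p) ↦ (g, p, σ g)`. -/
noncomputable def twistHom : B ⊗[ℂ] (B ⊗[ℂ] B) →ₐ[ℂ] B ⊗[ℂ] FixedRing s :=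
  Algebra.TensorProduct.productMap Algebra.TensorProduct.includeLeft
    (Algebra.TensorProduct.productMap
      (Algebra.TensorProduct.includeRight.comp (FixedRing.mk s))
      (Algebra.TensorProduct.includeLeft.comp s))

theorem reverseHom_tmul (x y z : B) :
    reverseHom s (x ⊗ₜ[ℂ] (y ⊗ₜ[ℂ] z)) = s z ⊗ₜ[ℂ] (s y ⊗ₜ[ℂ] s x) := by
  simp [reverseHom]

theorem twistHom_tmul (x y z : B) :
    twistHom s (x ⊗ₜ[ℂ] (y ⊗ₜ[ℂ] z)) = (x * s z) ⊗ₜ[ℂ] FixedRing.mk s y := by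
  simp [twistHom]

variable {s} {P : B →ₗ[ℂ] B →ₗ[ℂ] B} {D : FixedRing s →ₗ[ℂ] FixedRing s →ₗ[ℂ] FixedRing s}

/-- In (g, p, σ(g)) the first and third entries are dependent, so `twistHom` is not Poisson: their
cross brackets are missing on the source. The second term, with the entries reversed by σ, supplies
these, and in the middle entry it supplies the second half of the doubled Dirac bracket. -/
theorem prodBracket_twistHom (hD : IsDiracReduction P s D) (hP : IsBideriv (AlgHom.id ℂ B) P)
    (hs : ∀ f, s (s f) = f) (hsP : IsPoissonHom P P s) (F H : B ⊗[ℂ] (B ⊗[ℂ] B)) :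
    prodBracket P ((2 : ℂ) • D) (twistHom s F) (twistHom s H) =
      twistHom s (prodBracket P (prodBracket P P) F H) +
        twistHom s (prodBracket P (prodBracket P P) (reverseHom s F) H) := by
  induction F with
  | zero => simp
  | add F F' h h' => simp only [map_add, LinearMap.add_apply, h, h']; abel
  | tmul x F =>
    induction F with
    | zero => simp
    | add F F' h h' =>
      simp only [TensorProduct.tmul_add, map_add, LinearMap.add_apply, h, h']; abel
    | tmul y z =>
      induction H with
      | zero => simp
      | add F F' h h' => simp only [map_add, h, h']; abel
      | tmul x' F =>
        induction F with
        | zero => simp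
        | add F F' h h' => simp only [TensorProduct.tmul_add, map_add, h, h']; abel
        | tmul y' z' =>
          rw [twistHom_tmul, twistHom_tmul, reverseHom_tmul, prodBracket_tmul,
            hD.two_smul_apply_mk hs hsP]
          simp only [prodBracket_tmul, Algebra.TensorProduct.tmul_mul_tmul,
            TensorProduct.tmul_add, map_add, twistHom_tmul, hP.map_mul, hP.mul_map,
            AlgHom.id_apply, hsP _ _, hs, map_mul, FixedRing.mk_map, TensorProduct.add_tmul,
            mul_add]
          ring_nf

end Action

/-! ### Poisson maps between products -/

section Products

variable {B : Type u} [CommRing B] [Algebra ℂ B] {C : Type v} [CommRing C] [Algebra ℂ C]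
variable {C' : Type w} [CommRing C'] [Algebra ℂ C']

theorem IsPoissonHom.map_right {P : B →ₗ[ℂ] B →ₗ[ℂ] B} {Q : C →ₗ[ℂ] C →ₗ[ℂ] C}
    {Q' : C' →ₗ[ℂ] C' →ₗ[ℂ] C'} {F : C →ₐ[ℂ] C'} (hF : IsPoissonHom Q Q' F) :
    IsPoissonHom (prodBracket P Q) (prodBracket P Q')
      (Algebra.TensorProduct.map (AlgHom.id ℂ B) F) := by
  intro s t
  induction s with
  | zero => simp
  | add s s' h h' => simp only [map_add, LinearMap.add_apply, h, h']
  | tmul b c =>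
    induction t with
    | zero => simp
    | add s s' h h' => simp only [map_add, h, h']
    | tmul b' c' =>
      simp only [prodBracket_tmul, map_add, Algebra.TensorProduct.map_tmul, AlgHom.id_apply,
        map_mul, hF c c']

theorem IsPoissonHom.comp {P : B →ₗ[ℂ] B →ₗ[ℂ] B} {Q : C →ₗ[ℂ] C →ₗ[ℂ] C}
    {Q' : C' →ₗ[ℂ] C' →ₗ[ℂ] C'} {F : C →ₐ[ℂ] C'} {G : B →ₐ[ℂ] C} (hF : IsPoissonHom Q Q' F)
    (hG : IsPoissonHom P Q G) : IsPoissonHom P Q' (F.comp G) := fun f h => by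
  simp only [AlgHom.comp_apply, hG f h, hF (G f) (G h)]

end Products

/-! ### The action as a twisted triple multiplication -/

section Action

variable {A : Type u} [CommRing A] [HopfAlgebra ℂ A] (θ : GroupInvolution A)

namespace LoopRing

theorem sigma_sigma_apply (f : LoopRing A) : sigma θ (sigma θ f) = f := by
  have h : (sigma θ).comp (sigma θ) = AlgHom.id ℂ (LoopRing A) := by
    apply algHom_ext
    rw [map_comp, map_sigma_univ, LoopGroup.map_sigma, map_sigma_univ, LoopGroup.sigma_sigma,
      LoopGroup.map_id]
  exact DFunLike.congr_fun h f

variable (A) in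
/-- The comorphism of `(g, h, k) ↦ g h k`. -/
noncomputable def comul₃ : LoopRing A →ₐ[ℂ] LoopRing A ⊗[ℂ] (LoopRing A ⊗[ℂ] LoopRing A) :=
  (Algebra.TensorProduct.map (AlgHom.id ℂ _) (comul A)).comp (comul A)

theorem map_comul₃_univ : LoopGroup.map (comul₃ A) univ =
    LoopGroup.map Algebra.TensorProduct.includeLeft univ *
    (LoopGroup.map (Algebra.TensorProduct.includeRight.comp
      Algebra.TensorProduct.includeLeft) univ *
    LoopGroup.map (Algebra.TensorProduct.includeRight.comp
      Algebra.TensorProduct.includeRight) univ) := by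
  rw [comul₃, map_comp, map_comul_univ, map_mul, LoopGroup.map_comp, LoopGroup.map_comp,
    Algebra.TensorProduct.map_comp_includeLeft, Algebra.TensorProduct.map_comp_includeRight,
    AlgHom.comp_id, map_comp (comul A), map_comul_univ, map_mul, LoopGroup.map_comp,
    LoopGroup.map_comp]

/-- On points: σ(g h k) = σ(k) σ(h) σ(g). Triple coproducts of σ-invariant functions are therefore
fixed by the reversal. -/
theorem reverseHom_comp_comul₃ :
    (reverseHom (sigma θ)).comp (comul₃ A) = (comul₃ A).comp (sigma θ) := by
  have h1 : (reverseHom (sigma θ)).comp Algebra.TensorProduct.includeLeft =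
      (Algebra.TensorProduct.includeRight.comp Algebra.TensorProduct.includeRight).comp
        (sigma θ) := Algebra.TensorProduct.productMap_left _ _
  have h2 : (reverseHom (sigma θ)).comp (Algebra.TensorProduct.includeRight.comp
      Algebra.TensorProduct.includeLeft) =
      (Algebra.TensorProduct.includeRight.comp Algebra.TensorProduct.includeLeft).comp
        (sigma θ) := by
    rw [← AlgHom.comp_assoc, reverseHom, Algebra.TensorProduct.productMap_right,
      Algebra.TensorProduct.productMap_left]
  have h3 : (reverseHom (sigma θ)).comp (Algebra.TensorProduct.includeRight.comp
      Algebra.TensorProduct.includeRight) =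
      Algebra.TensorProduct.includeLeft.comp (sigma θ) := by
    rw [← AlgHom.comp_assoc, reverseHom, Algebra.TensorProduct.productMap_right,
      Algebra.TensorProduct.productMap_right]
  apply algHom_ext
  rw [map_comp, map_comul₃_univ, map_mul, map_mul, LoopGroup.map_comp, LoopGroup.map_comp,
    LoopGroup.map_comp, h1, h2, h3, map_comp (sigma θ) (comul₃ A), map_sigma_univ,
    LoopGroup.map_sigma,
    map_comul₃_univ, LoopGroup.sigma_mul, LoopGroup.sigma_mul, mul_assoc]
  simp only [← LoopGroup.map_sigma, ← map_sigma_univ, LoopGroup.map_comp, AlgHom.comp_assoc]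

end LoopRing

open LoopRing

theorem coaction_comp_mk : (coaction θ).comp (FixedRing.mk (sigma θ)) =
    (twistHom (sigma θ)).comp (comul₃ A) := by
  have h1 : (twistHom (sigma θ)).comp Algebra.TensorProduct.includeLeft =
      (Algebra.TensorProduct.includeLeft : LoopRing A →ₐ[ℂ] LoopRing A ⊗[ℂ] SigmaRing θ) :=
    Algebra.TensorProduct.productMap_left _ _
  have h2 : (twistHom (sigma θ)).comp (Algebra.TensorProduct.includeRight.comp
      Algebra.TensorProduct.includeLeft) =
      Algebra.TensorProduct.includeRight.comp (FixedRing.mk (sigma θ)) := by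
    rw [← AlgHom.comp_assoc, twistHom, Algebra.TensorProduct.productMap_right,
      Algebra.TensorProduct.productMap_left]
  have h3 : (twistHom (sigma θ)).comp (Algebra.TensorProduct.includeRight.comp
      Algebra.TensorProduct.includeRight) =
      (Algebra.TensorProduct.includeLeft : LoopRing A →ₐ[ℂ] LoopRing A ⊗[ℂ] SigmaRing θ).comp
        (sigma θ) := by
    rw [← AlgHom.comp_assoc, twistHom, Algebra.TensorProduct.productMap_right,
      Algebra.TensorProduct.productMap_right]
  apply algHom_ext
  rw [map_comp, ← univSigma, map_coaction, map_comp, map_comul₃_univ, map_mul, map_mul,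
    LoopGroup.map_comp, LoopGroup.map_comp, LoopGroup.map_comp, h1, h2, h3, univSigma,
    LoopGroup.map_comp, ← LoopGroup.map_sigma, ← map_sigma_univ, LoopGroup.map_comp, mul_assoc]

variable {θ} {P : LoopRing A →ₗ[ℂ] LoopRing A →ₗ[ℂ] LoopRing A}
  {D : SigmaRing θ →ₗ[ℂ] SigmaRing θ →ₗ[ℂ] SigmaRing θ}

/-- For a σ-invariant extension f, the two terms of `prodBracket_twistHom` coincide. Their sum is
twice the pullback of the bracket, matching the doubled Dirac bracket. -/
theorem coaction_isPoissonHom (hP : IsPoissonBracket P)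
    (hm : IsPoissonHom P (prodBracket P P) (comul A)) (hsP : IsPoissonHom P P (sigma θ))
    (hD : IsDiracReduction P (sigma θ) D) :
    IsPoissonHom ((2 : ℂ) • D) (prodBracket P ((2 : ℂ) • D)) (coaction θ) := by
  intro x y
  obtain ⟨f, hf, rfl⟩ := FixedRing.exists_invariant (sigma_sigma_apply θ) x
  obtain ⟨h, hh, rfl⟩ := FixedRing.exists_invariant (sigma_sigma_apply θ) y
  have hc : ∀ f, coaction θ (FixedRing.mk (sigma θ) f) = twistHom (sigma θ) (comul₃ A f) :=
    DFunLike.congr_fun (coaction_comp_mk θ)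
  have hr : reverseHom (sigma θ) (comul₃ A f) = comul₃ A f := by
    have := DFunLike.congr_fun (reverseHom_comp_comul₃ θ) f
    rwa [AlgHom.comp_apply, AlgHom.comp_apply, hf] at this
  have h3 : IsPoissonHom P (prodBracket P (prodBracket P P)) (comul₃ A) :=
    IsPoissonHom.comp (IsPoissonHom.map_right hm) hm
  rw [hc, hc, prodBracket_twistHom hD hP.isBideriv (sigma_sigma_apply θ) hsP, hr, ← h3,
    LinearMap.smul_apply, LinearMap.smul_apply, hD f h hf hh, map_smul, hc, two_smul]

variable (θ) in
/-- Evaluation of functions on `G₁[[z⁻¹]]^σ` at the identity. -/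
noncomputable def sigmaEps : SigmaRing θ →ₐ[ℂ] ℂ :=
  sigmaLift θ 1 (by simp [LoopGroup.sigma])

theorem sigmaEps_mk (f : LoopRing A) : sigmaEps θ (FixedRing.mk (sigma θ) f) = eps A f := rfl

/-- The orbit map is the action map restricted to p = e. -/
theorem orbitComorphism_eq (c : SigmaRing θ) :
    orbitComorphism θ c = rslice (sigmaEps θ).toLinearMap (coaction θ c) := by
  have h : orbitComorphism θ = (Algebra.TensorProduct.productMap (AlgHom.id ℂ (LoopRing A))
      ((Algebra.ofId ℂ (LoopRing A)).comp (sigmaEps θ))).comp (coaction θ) := by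
    apply sigmaRing_algHom_ext
    rw [map_orbitComorphism, map_comp, map_coaction, map_mul, map_mul, LoopGroup.map_comp,
      LoopGroup.map_comp, LoopGroup.map_sigma, LoopGroup.map_comp,
      Algebra.TensorProduct.productMap_left, Algebra.TensorProduct.productMap_right,
      LoopGroup.map_id, map_comp, sigmaEps, map_sigmaLift, map_one, mul_one]
  rw [h, AlgHom.comp_apply]
  generalize coaction θ c = s
  induction s with
  | zero => simp
  | add s t hs ht => simp only [map_add, hs, ht]
  | tmul a b =>
    rw [Algebra.TensorProduct.productMap_apply_tmul, rslice_tmul, Algebra.smul_def, mul_comm]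
    rfl

/-- The Dirac bracket vanishes at e, so restricting the Poisson action map to p = e leaves only the
bracket in the group variable. -/
theorem orbitComorphism_isPoissonHom (hP : IsPoissonBracket P)
    (hm : IsPoissonHom P (prodBracket P P) (comul A)) (hsP : IsPoissonHom P P (sigma θ))
    (hD : IsDiracReduction P (sigma θ) D) :
    IsPoissonHom ((2 : ℂ) • D) P (orbitComorphism θ) := by
  intro x y
  have hε : ∀ x y, sigmaEps θ (((2 : ℂ) • D) x y) = 0 := fun x y => by
    obtain ⟨f, hf, rfl⟩ := FixedRing.exists_invariant (sigma_sigma_apply θ) x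
    obtain ⟨h, hh, rfl⟩ := FixedRing.exists_invariant (sigma_sigma_apply θ) y
    rw [LinearMap.smul_apply, LinearMap.smul_apply, hD f h hf hh, map_smul, sigmaEps_mk,
      eps_bracket hm, smul_zero]
  rw [orbitComorphism_eq, orbitComorphism_eq, orbitComorphism_eq,
    coaction_isPoissonHom hP hm hsP hD]
  generalize coaction θ x = s
  generalize coaction θ y = t
  generalize (2 : ℂ) • D = D' at hε
  induction s with
  | zero => simp
  | add s s' h h' => simp only [map_add, LinearMap.add_apply, h, h']
  | tmul b c =>
    induction t with
    | zero => simp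
    | add s s' h h' => simp only [map_add, h, h']
    | tmul b' c' =>
      simp only [prodBracket_tmul, map_add, rslice_tmul, AlgHom.toLinearMap_apply, hε, zero_smul,
        add_zero, map_mul, map_smul, LinearMap.smul_apply, smul_smul]
      rw [mul_comm]

end Action

/-! ### Gradings -/

section Internal

variable {V : Type u} [AddCommGroup V] [Module ℂ V] {𝒜 ℰ : ℤ → Submodule ℂ V}

theorem isInternal_of_le (hind : iSupIndep ℰ) (hle : ∀ n, 𝒜 n ≤ ℰ n) (htop : ⨆ n, 𝒜 n = ⊤) :
    DirectSum.IsInternal 𝒜 :=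
  DirectSum.isInternal_submodule_of_iSupIndep_of_iSup_eq_top (hind.mono hle) htop

/-- Subspaces of independent pieces that already span everything must fill each piece. This upgrades
the inclusion into eigenspaces to an equality. -/
theorem eq_of_le_of_iSup_eq_top (hind : iSupIndep ℰ) (hle : ∀ n, 𝒜 n ≤ ℰ n)
    (htop : ⨆ n, 𝒜 n = ⊤) (n : ℤ) : 𝒜 n = ℰ n := by
  refine le_antisymm (hle n) fun f hf => ?_
  have hsup : 𝒜 n ⊔ ⨆ (k) (_ : k ≠ n), 𝒜 k = ⊤ := by
    rw [eq_top_iff, ← htop]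
    refine iSup_le fun k => ?_
    by_cases h : k = n
    · rw [h]; exact le_sup_left
    · exact le_sup_of_le_right (le_iSup₂_of_le k h le_rfl)
  obtain ⟨a, ha, b, hb, rfl⟩ := Submodule.mem_sup.1 (hsup ▸ Submodule.mem_top : f ∈ _)
  have hb' : b ∈ ⨆ (k) (_ : k ≠ n), ℰ k := (iSup₂_mono fun k _ => hle k) hb
  have hb'' : b ∈ ℰ n := by
    have := (ℰ n).sub_mem hf (hle n ha)
    rwa [add_sub_cancel_left] at this
  have : b = 0 := Submodule.disjoint_def.1 (hind n) b hb'' hb'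
  rw [this, add_zero]
  exact ha

theorem iSupIndep_comap {W : Type v} [AddCommGroup W] [Module ℂ W] (F : W →ₗ[ℂ] V)
    (hF : Function.Injective F) (hind : iSupIndep ℰ) : iSupIndep fun n => (ℰ n).comap F := by
  intro n
  rw [Submodule.disjoint_def]
  intro x hx hx'
  refine hF ?_
  rw [map_zero]
  refine Submodule.disjoint_def.1 (hind n) (F x) hx ?_
  have h : (⨆ (k) (_ : k ≠ n), (ℰ k).comap F).map F ≤ ⨆ (k) (_ : k ≠ n), ℰ k := by
    simp only [Submodule.map_iSup]
    exact iSup₂_mono fun k _ => Submodule.map_comap_le F (ℰ k)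
  exact h (Submodule.mem_map_of_mem hx')

end Internal

/-! ### The grading by eigenspaces of the Euler derivation -/

namespace LoopRing

variable {A : Type u} [CommRing A] [HopfAlgebra ℂ A]

variable (A) in
/-- The weight of the variables. -/
def genWeight (p : A × ℕ) : ℤ := p.2

theorem euler_proj_monomial (d : A × ℕ →₀ ℕ) (c : ℂ) :
    euler A (proj A (MvPolynomial.monomial d c)) =
      ((Finsupp.weight (genWeight A) d : ℤ) : ℂ) • proj A (MvPolynomial.monomial d c) := by
  have hE := euler_isDerivAlong (A := A)
  have hmul : ∀ d d' : A × ℕ →₀ ℕ, proj A (MvPolynomial.monomial (d + d') 1) =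
      proj A (MvPolynomial.monomial d 1) * proj A (MvPolynomial.monomial d' 1) := fun d d' => by
    rw [← map_mul, MvPolynomial.monomial_mul, one_mul]
  have hadd : ∀ d d' : A × ℕ →₀ ℕ,
      euler A (proj A (MvPolynomial.monomial d 1)) =
        ((Finsupp.weight (genWeight A) d : ℤ) : ℂ) • proj A (MvPolynomial.monomial d 1) →
      euler A (proj A (MvPolynomial.monomial d' 1)) =
        ((Finsupp.weight (genWeight A) d' : ℤ) : ℂ) • proj A (MvPolynomial.monomial d' 1) →
      euler A (proj A (MvPolynomial.monomial (d + d') 1)) =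
        ((Finsupp.weight (genWeight A) (d + d') : ℤ) : ℂ) •
          proj A (MvPolynomial.monomial (d + d') 1) := fun d d' h h' => by
    rw [hmul, hE, h, h', map_add, Int.cast_add, add_smul, AlgHom.id_apply, AlgHom.id_apply,
      mul_smul_comm, mul_smul_comm, mul_comm (proj A (MvPolynomial.monomial d' 1)), add_comm]
  have hzero : euler A (proj A (MvPolynomial.monomial (0 : A × ℕ →₀ ℕ) 1)) =
      ((Finsupp.weight (genWeight A) (0 : A × ℕ →₀ ℕ) : ℤ) : ℂ) •
        proj A (MvPolynomial.monomial 0 1) := by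
    rw [map_zero, Int.cast_zero, zero_smul,
      show MvPolynomial.monomial (0 : A × ℕ →₀ ℕ) (1 : ℂ) = 1 from rfl, map_one, hE.map_one]
  have hone : ∀ d : A × ℕ →₀ ℕ, euler A (proj A (MvPolynomial.monomial d 1)) =
      ((Finsupp.weight (genWeight A) d : ℤ) : ℂ) • proj A (MvPolynomial.monomial d 1) := by
    intro d
    induction d using Finsupp.induction_linear with
    | zero => exact hzero
    | add d d' h h' => exact hadd d d' h h'
    | single p m =>
      induction m with
      | zero => rw [Finsupp.single_zero]; exact hzero
      | succ m ih =>
        rw [Finsupp.single_add]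
        refine hadd _ _ ih ?_
        rw [Finsupp.weight_single, one_smul, genWeight]
        exact (euler_gen p.1 p.2).trans (by simp; rfl)
  have hc : MvPolynomial.monomial d c = c • MvPolynomial.monomial d 1 := by
    rw [MvPolynomial.smul_monomial, smul_eq_mul, mul_one]
  rw [hc, map_smul, map_smul, hone, smul_comm]

theorem loopGrading_le_eigenspace (n : ℤ) :
    loopGrading A n ≤ Module.End.eigenspace (euler A) (n : ℂ) := by
  rintro _ ⟨r, hr, rfl⟩
  have hr' : MvPolynomial.IsWeightedHomogeneous (genWeight A) r n := hr
  rw [Module.End.mem_eigenspace_iff]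
  change euler A (proj A r) = (n : ℂ) • proj A r
  rw [MvPolynomial.as_sum r, map_sum, map_sum, Finset.smul_sum]
  refine Finset.sum_congr rfl fun d hd => ?_
  rw [euler_proj_monomial, hr' (MvPolynomial.mem_support_iff.1 hd)]

theorem iSup_loopGrading : ⨆ n, loopGrading A n = ⊤ := by
  rw [eq_top_iff]
  intro f _
  obtain ⟨r, rfl⟩ : ∃ r, proj A r = f := Ideal.Quotient.mk_surjective f
  rw [MvPolynomial.as_sum r, map_sum]
  refine Submodule.sum_mem _ fun d _ => ?_
  refine Submodule.mem_iSup_of_mem (Finsupp.weight (genWeight A) d) ⟨_, ?_, rfl⟩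
  exact MvPolynomial.isWeightedHomogeneous_monomial (genWeight A) d _ rfl

theorem iSupIndep_eigenspace :
    iSupIndep fun n : ℤ => Module.End.eigenspace (euler A) (n : ℂ) :=
  (Module.End.eigenspaces_iSupIndep (euler A)).comp Int.cast_injective

/-- Through this criterion independence, multiplicativity and the degree of the bracket become
statements about eigenvalues, and homogeneity of the defining ideal is never needed separately. -/
theorem mem_loopGrading_iff (n : ℤ) (f : LoopRing A) :
    f ∈ loopGrading A n ↔ euler A f = (n : ℂ) • f := by
  rw [eq_of_le_of_iSup_eq_top iSupIndep_eigenspace loopGrading_le_eigenspace iSup_loopGrading,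
    Module.End.mem_eigenspace_iff]

theorem iSupIndep_loopGrading : iSupIndep (loopGrading A) :=
  iSupIndep_eigenspace.mono loopGrading_le_eigenspace

theorem one_mem_loopGrading : (1 : LoopRing A) ∈ loopGrading A 0 := by
  rw [mem_loopGrading_iff, euler_isDerivAlong.map_one, Int.cast_zero, zero_smul]

theorem mul_mem_loopGrading {i j : ℤ} {f h : LoopRing A} (hf : f ∈ loopGrading A i)
    (hh : h ∈ loopGrading A j) : f * h ∈ loopGrading A (i + j) := by
  rw [mem_loopGrading_iff] at hf hh ⊢
  rw [euler_isDerivAlong, hf, hh, Int.cast_add, add_smul, AlgHom.id_apply, AlgHom.id_apply,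
    mul_smul_comm, mul_smul_comm, mul_comm h, add_comm]

theorem gen_mem_loopGrading (a : A) (n : ℕ) : gen a n ∈ loopGrading A n := by
  rw [mem_loopGrading_iff, euler_gen, Int.cast_natCast]

theorem isGradedPoisson_loopGrading {P : LoopRing A →ₗ[ℂ] LoopRing A →ₗ[ℂ] LoopRing A}
    (hP : ∀ f h, euler A (P f h) = P (euler A f) h + P f (euler A h) - P f h) :
    IsGradedPoisson (loopGrading A) P where
  gradedMonoid :=
    { one_mem := one_mem_loopGrading
      mul_mem := fun _ _ _ _ hf hh => mul_mem_loopGrading hf hh }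
  isInternal := isInternal_of_le iSupIndep_eigenspace loopGrading_le_eigenspace iSup_loopGrading
  bracket_mem i j f h hf hh := by
    rw [mem_loopGrading_iff] at hf hh ⊢
    rw [hP, hf, hh, map_smul, map_smul, LinearMap.smul_apply]
    push_cast
    rw [sub_smul, add_smul, one_smul]

end LoopRing

/-! ### The induced grading of the σ-fixed locus -/

section Sigma

open LoopRing

variable {A : Type u} [CommRing A] [HopfAlgebra ℂ A] (θ : GroupInvolution A)

theorem orbitComorphism_comp_mk : (orbitComorphism θ).comp (FixedRing.mk (sigma θ)) =
    (Algebra.TensorProduct.productMap (AlgHom.id ℂ (LoopRing A)) (sigma θ)).comp (comul A) := by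
  apply algHom_ext
  rw [map_comp, ← univSigma, map_orbitComorphism, map_comp, map_comul_univ, map_mul,
    LoopGroup.map_comp, LoopGroup.map_comp, Algebra.TensorProduct.productMap_left,
    Algebra.TensorProduct.productMap_right, LoopGroup.map_id, map_sigma_univ]

/-- The function is the coefficient of tⁿ in a(g σ(g)): the coproduct distributes the order over
both factors, and σ preserves the order. -/
theorem orbitComorphism_mk_gen_mem (a : A) (n : ℕ) :
    orbitComorphism θ (FixedRing.mk (sigma θ) (gen a n)) ∈ loopGrading A n := by
  have h := DFunLike.congr_fun (orbitComorphism_comp_mk θ) (gen a n)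
  rw [AlgHom.comp_apply, AlgHom.comp_apply, comul_gen, map_sum] at h
  rw [h]
  refine Submodule.sum_mem _ fun p hp => ?_
  rw [← Finset.HasAntidiagonal.mem_antidiagonal.1 hp, Nat.cast_add]
  generalize Coalgebra.comul (R := ℂ) a = s
  induction s with
  | zero => simp
  | add s t hs ht => rw [map_add, map_add]; exact Submodule.add_mem _ hs ht
  | tmul b c =>
    rw [TensorProduct.map_tmul, Algebra.TensorProduct.productMap_apply_tmul, genL_apply,
      genL_apply, sigma_gen]
    exact mul_mem_loopGrading (gen_mem_loopGrading b _)
      (Submodule.smul_mem _ _ (gen_mem_loopGrading _ _))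

theorem sigmaGrading_le (n : ℤ) : sigmaGrading θ n ≤
    (loopGrading A n).comap (orbitComorphism θ).toLinearMap := by
  rintro _ ⟨f, hf, rfl⟩
  let F : LoopRing A →ₐ[ℂ] LoopRing A := (orbitComorphism θ).comp (FixedRing.mk (sigma θ))
  have hE := euler_isDerivAlong (A := A)
  -- Both composites are derivations along `F`, so they need only be compared on generators, which
  -- `F` sends to functions of the same degree.
  have h : euler A ∘ₗ F.toLinearMap = F.toLinearMap ∘ₗ euler A :=
    derivAlong_ext (φ := F)
      (fun f g => by simp only [LinearMap.comp_apply, AlgHom.toLinearMap_apply, map_mul, hE _ _,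
        AlgHom.id_apply])
      (fun f g => by simp only [LinearMap.comp_apply, AlgHom.toLinearMap_apply, map_mul, hE _ _,
        AlgHom.id_apply, map_add])
      (fun a m => by
        simp only [LinearMap.comp_apply, AlgHom.toLinearMap_apply, euler_gen, map_smul]
        have := (mem_loopGrading_iff _ _).1 (orbitComorphism_mk_gen_mem θ a m)
        rwa [Int.cast_natCast] at this)
  change F f ∈ loopGrading A n
  have hf' : f ∈ loopGrading A n := hf
  rw [mem_loopGrading_iff] at hf' ⊢
  have h2 := DFunLike.congr_fun h f
  simp only [LinearMap.comp_apply, AlgHom.toLinearMap_apply, hf', map_smul] at h2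
  exact h2

theorem iSup_sigmaGrading : ⨆ n, sigmaGrading θ n = ⊤ := by
  have h : ⨆ n, sigmaGrading θ n =
      (⨆ n, loopGrading A n).map (FixedRing.mk (sigma θ)).toLinearMap := by
    rw [Submodule.map_iSup]
    rfl
  rw [h, iSup_loopGrading, Submodule.map_top, LinearMap.range_eq_top]
  exact FixedRing.mk_surjective _

/-- Injectivity of the orbit comorphism lets the quotient grading be compared with a grading pulled
back from the group. This yields independence, which a quotient does not inherit automatically. -/
theorem iSupIndep_comap_loopGrading :
    iSupIndep fun n => (loopGrading A n).comap (orbitComorphism θ).toLinearMap :=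
  iSupIndep_comap _ (orbitComorphism_injective θ) iSupIndep_loopGrading

theorem mem_sigmaGrading_iff (n : ℤ) (c : SigmaRing θ) :
    c ∈ sigmaGrading θ n ↔ orbitComorphism θ c ∈ loopGrading A n := by
  rw [eq_of_le_of_iSup_eq_top (iSupIndep_comap_loopGrading θ) (sigmaGrading_le θ)
    (iSup_sigmaGrading θ)]
  rfl

theorem isGradedPoisson_sigmaGrading {P : LoopRing A →ₗ[ℂ] LoopRing A →ₗ[ℂ] LoopRing A}
    {D : SigmaRing θ →ₗ[ℂ] SigmaRing θ →ₗ[ℂ] SigmaRing θ}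
    (hD : IsPoissonHom D P (orbitComorphism θ)) (hP : IsGradedPoisson (loopGrading A) P) :
    IsGradedPoisson (sigmaGrading θ) D where
  gradedMonoid :=
    { one_mem := by
        rw [mem_sigmaGrading_iff, map_one]
        exact one_mem_loopGrading
      mul_mem := fun i j f h hf hh => by
        rw [mem_sigmaGrading_iff] at hf hh ⊢
        rw [map_mul]
        exact mul_mem_loopGrading hf hh }
  isInternal := isInternal_of_le (iSupIndep_comap_loopGrading θ) (sigmaGrading_le θ)
    (iSup_sigmaGrading θ)
  bracket_mem i j f h hf hh := by
    rw [mem_sigmaGrading_iff] at hf hh ⊢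
    rw [hD]
    exact hP.bracket_mem i j _ _ hf hh

end Sigma
end LoopSym

/-! ### The main theorem -/

theorem mainTheorem3
    {A : Type u} [CommRing A] [HopfAlgebra ℂ A] [Algebra.FiniteType ℂ A]
    (θ : GroupInvolution A)
    (κ : LinearMap.BilinForm ℂ (LieAlg A))
    (hκ_nondeg : κ.Nondegenerate)
    (hκ_symm : ∀ x y, κ x y = κ y x)
    (hκ_inv : ∀ x y w, κ ⁅x, y⁆ w = κ x ⁅y, w⁆)
    (hκ_omega : ∀ x y, κ (θ.onLie x) (θ.onLie y) = κ x y) :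
    -- multiplication is an isomorphism of affine schemes
    Function.Bijective (mulComorphism θ) ∧
    -- the action on the fixed-point locus is transitive (on `R`-points, for every `R`)
    (∀ (R : Type v) [CommRing R] [Algebra ℂ R],
      MulAction.IsPretransitive (LoopGroup A R) (LoopGroup.SigmaFixed θ R)) ∧
    -- the orbit map of `e` induces an equivariant isomorphism from the quotient
    (∀ (R : Type v) [CommRing R] [Algebra ℂ R],
      Function.Bijective (LoopGroup.orbitMap θ R) ∧
      ∀ (g : LoopGroup A R) (q : LoopGroup A R ⧸ LoopGroup.omegaFixed θ R),
        LoopGroup.orbitMap θ R (g • q) = g • LoopGroup.orbitMap θ R q) ∧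
    -- the Poisson structure of the Manin triple, and its Dirac reduction
    (∃! P, IsLoopPoisson κ P) ∧
    ∀ P : LoopRing A →ₗ[ℂ] LoopRing A →ₗ[ℂ] LoopRing A, IsLoopPoisson κ P →
      (∃! D, IsDiracReduction P (LoopRing.sigma θ) D) ∧
      ∀ D : SigmaRing θ →ₗ[ℂ] SigmaRing θ →ₗ[ℂ] SigmaRing θ,
        IsDiracReduction P (LoopRing.sigma θ) D →
        IsPoissonBracket ((2 : ℂ) • D) ∧
        -- the action is Poisson for the doubled Dirac structure
        IsPoissonHom ((2 : ℂ) • D) (prodBracket P ((2 : ℂ) • D)) (coaction θ) ∧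
        -- the quotient inherits a Poisson structure
        (∀ f ∈ invariants θ, ∀ h ∈ invariants θ, P f h ∈ invariants θ) ∧
        -- both sides are graded Poisson algebras
        IsGradedPoisson (loopGrading A) P ∧
        IsGradedPoisson (sigmaGrading θ) ((2 : ℂ) • D) ∧
        -- the comorphism of `[g] ↦ g σ(g)` is an isomorphism onto the invariants, compatible
        -- with brackets, gradings and left coactions
        ∃ Φ : SigmaRing θ ≃ₐ[ℂ] invariants θ,
          (∀ c, (Φ c : LoopRing A) = orbitComorphism θ c) ∧
          (∀ c c', (Φ (((2 : ℂ) • D) c c') : LoopRing A) = P (Φ c) (Φ c')) ∧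
          (∀ n c, c ∈ sigmaGrading θ n ↔ (Φ c : LoopRing A) ∈ loopGrading A n) ∧
          (∀ c, LoopRing.comul A (Φ c) =
            Algebra.TensorProduct.map (AlgHom.id ℂ (LoopRing A))
              ((invariants θ).val.comp (Φ : SigmaRing θ →ₐ[ℂ] invariants θ)) (coaction θ c)) := by
  refine ⟨mulComorphism_bijective θ, fun R _ _ => isPretransitive_sigmaFixed θ R,
    fun R _ _ => ⟨orbitMap_bijective θ R, fun g q => orbitMap_smul θ g q⟩,
    LoopRing.existsUnique_isLoopPoisson hκ_nondeg hκ_symm hκ_inv, fun P hP => ?_⟩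
  obtain ⟨hσ, hE⟩ := LoopRing.sigma_isPoissonHom_and_euler_bracket hP θ hκ_nondeg hκ_symm hκ_inv hκ_omega
  have hs := LoopRing.sigma_sigma_apply θ
  refine ⟨existsUnique_isDiracReduction hP.poisson.isBideriv hs, fun D hD => ?_⟩
  have hco := coaction_isPoissonHom hP.poisson hP.multiplicative hσ hD
  have horb := orbitComorphism_isPoissonHom hP.poisson hP.multiplicative hσ hD
  have hgr := LoopRing.isGradedPoisson_loopGrading hE
  refine ⟨(hD.isPoissonBracket hP.poisson hs hσ).smul 2, hco, fun f hf h hh => ?_, hgr,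
    isGradedPoisson_sigmaGrading θ horb hgr, orbitEquiv θ, coe_orbitEquiv θ, fun c c' => ?_,
    fun n c => ?_, fun c => ?_⟩
  -- Invariants are pullbacks along the orbit map, and that map is Poisson, so a bracket of
  -- invariants is again a pullback.
  · obtain ⟨c, hc⟩ := (orbitEquiv θ).surjective ⟨f, hf⟩
    obtain ⟨c', hc'⟩ := (orbitEquiv θ).surjective ⟨h, hh⟩
    have h1 : orbitComorphism θ c = f := congrArg Subtype.val hc
    have h2 : orbitComorphism θ c' = h := congrArg Subtype.val hc'
    rw [← h1, ← h2, ← horb]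
    exact (orbitEquiv θ _).2
  · rw [coe_orbitEquiv, coe_orbitEquiv, coe_orbitEquiv, horb]
  · rw [coe_orbitEquiv]
    exact mem_sigmaGrading_iff θ n c
  · exact comul_orbitComorphism θ c
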